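/- For integers $n\ge 3$ and $0<2r_n<n$, and $x\in\mathbb{R}^n$ with indices read modulo $n$, let $$H_n(x)=-\frac1{2r_n}\sum_{i=1}^n\sum_{j=1}^{r_n}x_ix_{i+j},\qquad T_n(x)=\frac{x_1^2+\cdots+x_n^2}{n},\qquad S_n(x)=x_1+\cdots+x_n,$$ and let $\mu_n$ be the probability measure on $\mathbb{R}^n$ given by $$d\mu_n(x)=\frac1{Z_n}\exp\left(-\frac{H_n(x)}{T_n(x)}\right)\mathbf{1}_{\{T_n(x)>0\}}\prod_{i=1}^n d\nu(x_i),$$ where $\nu$ is the standard normal distribution and $Z_n$ is the normalization constant. Suppose that $r_n\sim\lambda n^{3/4}$ as $n\to\infty$, with $\lambda>0$. Let $(Y_j)_{j\in\mathbb{Z}}$ be i.i.d. standard normal variables. Then the series in $$Z_\lambda=\sqrt2\,Y_0-\frac{3}{2\lambda^2\pi^2}\sum_{j\in\mathbb{Z}\setminus\{0\}}\frac{Y_j^2}{j^2}$$ converges almost surely, $Z_\lambda$ has a density $f$ with respect to the Lebesgue measure, $0<\int_{\mathbb{R}}f(t^2)\,dt<\infty$, and, under $\mu_n$, one has the convergence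 in distribution $$\frac{S_n}{n^{3/4}}\ \longrightarrow\ \frac{f(x^2)\,dx}{\int_{\mathbb{R}}f(t^2)\,dt}\qquad(n\to\infty).$$ -/

import Mathlib

open MeasureTheory ProbabilityTheory Filter Topology Asymptotics
open scoped ENNReal

noncomputable section

namespace SpinChain

/-- The Hamiltonian of a periodic chain of `n` real spins with interaction range `r`. The addition
of indices is that of `Fin n`, that is, addition modulo `n`. -/
def hamiltonian (n r : ℕ) [NeZero n] (x : Fin n → ℝ) : ℝ :=
  -(1 / (2 * (r : ℝ))) * ∑ i : Fin n, ∑ j ∈ Finset.Icc 1 r, x i * x (i + Fin.ofNat n j)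

/-- The self-adjusted temperature. -/
def temperature (n : ℕ) (x : Fin n → ℝ) : ℝ := (∑ i, x i ^ 2) / n

/-- The magnetization. -/
def magnetization (n : ℕ) (x : Fin n → ℝ) : ℝ := ∑ i, x i

/-- The law of `n` independent standard normal spins. -/
def gaussianSpins (n : ℕ) : Measure (Fin n → ℝ) := Measure.pi fun _ => gaussianReal 0 1

/-- The unnormalized density `exp (-H / T) 1_{T > 0}` with respect to the Gaussian spins. -/
def weight (n r : ℕ) [NeZero n] : (Fin n → ℝ) → ℝ≥0∞ :=
  {x | 0 < temperature n x}.indicator fun x =>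
    ENNReal.ofReal (Real.exp (-hamiltonian n r x / temperature n x))

/-- The normalization constant of the model. -/
def partitionFunction (n r : ℕ) [NeZero n] : ℝ≥0∞ := ∫⁻ x, weight n r x ∂gaussianSpins n

/-- The law `μ_n` of the spins with the self-adjusted temperature. -/
def model (n r : ℕ) [NeZero n] : Measure (Fin n → ℝ) :=
  (partitionFunction n r)⁻¹ • (gaussianSpins n).withDensity (weight n r)

/-- The random variable `Z_λ` built on a family `Y` indexed by `ℤ`. -/
def limitVariable {Ω : Type*} (lam : ℝ) (Y : ℤ → Ω → ℝ) (ω : Ω) : ℝ :=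
  √2 * Y 0 ω - 3 / (2 * lam ^ 2 * Real.pi ^ 2) * ∑' j : {j : ℤ // j ≠ 0}, Y j ω ^ 2 / (j : ℝ) ^ 2

/-- The measure `f (x ^ 2) dx / ∫ f (t ^ 2) dt` on the real line. -/
def squareLaw (f : ℝ → ℝ) : Measure ℝ :=
  (∫⁻ t, ENNReal.ofReal (f (t ^ 2)))⁻¹ •
    volume.withDensity fun x => ENNReal.ofReal (f (x ^ 2))

/-! The model is a probability measure. -/

instance (n : ℕ) : IsProbabilityMeasure (gaussianSpins n) := by
  unfold gaussianSpins; infer_instance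

theorem measurable_temperature (n : ℕ) : Measurable (temperature n) := by
  unfold temperature; fun_prop

theorem measurable_hamiltonian (n r : ℕ) [NeZero n] : Measurable (hamiltonian n r) := by
  unfold hamiltonian; fun_prop

theorem measurable_weight (n r : ℕ) [NeZero n] : Measurable (weight n r) := by
  refine Measurable.indicator ?_ (measurableSet_lt measurable_const (measurable_temperature n))
  have := measurable_temperature n
  have := measurable_hamiltonian n r
  fun_prop

theorem neg_hamiltonian_le (n r : ℕ) [NeZero n] (x : Fin n → ℝ) :
    -hamiltonian n r x ≤ (n : ℝ) * temperature n x := by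
  have hn : (n : ℝ) ≠ 0 := Nat.cast_ne_zero.2 (NeZero.ne n)
  have hT : (n : ℝ) * temperature n x = ∑ i, x i ^ 2 := by
    unfold temperature; field_simp
  have h1 : ∀ k : Fin n, ∑ i : Fin n, x i * x (i + k) ≤ ∑ i, x i ^ 2 := by
    intro k
    have hs : ∑ i, x (i + k) ^ 2 = ∑ i, x i ^ 2 :=
      Equiv.sum_comp (Equiv.addRight k) fun i => x i ^ 2
    have h2 : ∑ i : Fin n, 2 * (x i * x (i + k)) ≤ ∑ i : Fin n, (x i ^ 2 + x (i + k) ^ 2) :=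
      Finset.sum_le_sum fun i _ => by nlinarith [sq_nonneg (x i - x (i + k))]
    rw [← Finset.mul_sum, Finset.sum_add_distrib, hs] at h2
    linarith
  have h0 : 0 ≤ ∑ i, x i ^ 2 := Finset.sum_nonneg fun i _ => sq_nonneg _
  rw [hT]
  unfold hamiltonian
  rw [Finset.sum_comm]
  have h3 : ∑ j ∈ Finset.Icc 1 r, ∑ i : Fin n, x i * x (i + Fin.ofNat n j)
      ≤ (r : ℝ) * ∑ i, x i ^ 2 := by
    refine (Finset.sum_le_sum fun j _ => h1 (Fin.ofNat n j)).trans ?_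
    simp
  rcases Nat.eq_zero_or_pos r with rfl | hr
  · simpa using h0
  · have hr' : (0 : ℝ) < r := Nat.cast_pos.2 hr
    have h4 := mul_le_mul_of_nonneg_left h3 (by positivity : 0 ≤ 1 / (2 * (r : ℝ)))
    have h5 : 1 / (2 * (r : ℝ)) * ((r : ℝ) * ∑ i, x i ^ 2) = (∑ i, x i ^ 2) / 2 := by
      field_simp
    linarith

theorem weight_le (n r : ℕ) [NeZero n] (x : Fin n → ℝ) :
    weight n r x ≤ ENNReal.ofReal (Real.exp n) := by
  unfold weight
  refine Set.indicator_apply_le' (fun hx => ?_) fun _ => zero_le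
  have hx' : 0 < temperature n x := hx
  refine ENNReal.ofReal_le_ofReal (Real.exp_le_exp.2 ?_)
  rw [div_le_iff₀ hx']
  exact neg_hamiltonian_le n r x

theorem partitionFunction_ne_top (n r : ℕ) [NeZero n] : partitionFunction n r ≠ ∞ := by
  refine ne_of_lt ((lintegral_mono (weight_le n r)).trans_lt ?_)
  simp

theorem partitionFunction_ne_zero (n r : ℕ) [NeZero n] : partitionFunction n r ≠ 0 := by
  intro h
  rw [partitionFunction, lintegral_eq_zero_iff (measurable_weight n r)] at h
  have h0 : ∀ᵐ x ∂gaussianSpins n, x 0 = 0 := by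
    filter_upwards [h] with x hx
    by_contra hne
    have hT : 0 < temperature n x := by
      refine div_pos ?_ (Nat.cast_pos.2 (NeZero.pos n))
      exact Finset.sum_pos' (fun i _ => sq_nonneg _) ⟨0, Finset.mem_univ _, by positivity⟩
    have hw : weight n r x ≠ 0 := by
      unfold weight
      rw [Set.indicator_of_mem (show x ∈ {x | 0 < temperature n x} from hT)]
      simp [Real.exp_pos]
    exact hw hx
  have h1 : ∀ᵐ x ∂gaussianSpins n, x 0 ≠ 0 := by
    have hna : NullSingletonClass (gaussianReal 0 1) :=
      nullSingletonClass_gaussianReal one_ne_zero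
    have hmp : MeasurePreserving (Function.eval (0 : Fin n)) (gaussianSpins n)
        (gaussianReal 0 1) := measurePreserving_eval (fun _ : Fin n => gaussianReal 0 1) 0
    exact hmp.quasiMeasurePreserving.ae (Measure.ae_ne (gaussianReal 0 1) (0 : ℝ))
  have : ∀ᵐ _ ∂gaussianSpins n, False := by
    filter_upwards [h0, h1] with x a b using b a
  simp [ae_iff] at this

instance (n r : ℕ) [NeZero n] : IsProbabilityMeasure (model n r) := by
  constructor
  rw [model, Measure.smul_apply, withDensity_apply _ MeasurableSet.univ, Measure.restrict_univ,
    smul_eq_mul]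
  exact ENNReal.inv_mul_cancel (partitionFunction_ne_zero n r) (partitionFunction_ne_top n r)

end SpinChain

end

noncomputable section

namespace SpinChain

/-! The interaction matrix is a symmetric circulant. In an orthonormal Hartley basis, with
coordinates `y`, the spins are still standard normal, `H = -(1/2) ∑ λ_k y_k²`, `T = |y|²/n` and `S =
√n y_0`, where `λ_0 = 1` and the other `λ_k` are at least `-1` and, for `r > 0`, less than `1`. The
factor `exp (-H/T)` depends only on the direction of `y`. With `m = n - 1`, write `|y_0| = t √(n -
|z|²)` and let `t z` be the vector of the other coordinates, so that `|y|² = n t²`. The exponent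
then splits into `-n t²/2`, a constant and `-(1/2) ∑ (1 - λ_k) z_k²`. Hence `t` is independent of
`z` and has density proportional to `t^m exp (-n t²/2)`, while `z` is Gaussian with variances `1/(1
- λ_k)`, restricted to `|z|² < n` and tilted by the Jacobian `1/√(n - |z|²)`
(`exists_lintegral_weight_mul`).

Put `W = (n - |z|²)/√n` under the untilted Gaussian law. Then `S/n^{3/4} = ± t √W` with a fair sign,
`W` being conditioned to be positive and tilted by `1/√W` (`map_model_eq_scaledSqrtLaw`). Since `t`
tends to `1`, the limit is governed by the limit of `W`. If that limit has density `f`, the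
substitution `w = x²` cancels the tilt and leaves a density proportional to `f (x²)`
(`squareLaw_eq`).

The limit of `W` is `Z_λ` (`tendsto_energyLaw`). Indeed `W = 1/√n + ∑ ((1 - Y_k²)/√n - a_k Y_k²)`,
where `a_k = (1/(1 - λ_k) - 1)/√n` tends to `3/(2 λ² π² k²)` when `r ~ λ n^{3/4}` and is dominated
by a multiple of `|k|^{-5/4}`. The numerous high frequencies give the Gaussian term by the central
limit theorem and the few low ones give the series; the two groups are independent
(`tendsto_charFun_modes`).

Weak convergence alone does not control the unbounded tilt `1/√w`. The variances are at least `1/2`,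
so the characteristic function of `W` is at most `5/(1 + t²)`, and the laws of `W` have densities
bounded uniformly in `n` (`exists_energyLaw_le`). This makes the singularity uniformly integrable,
passes to the limit, and yields the density of `Z_λ`. The limiting mass of the tilt is positive
because `Z_λ` contains an independent Gaussian summand. -/

/-! ### Diagonalization of the Hamiltonian by the Hartley transform -/

theorem sum_exp_two_pi (n : ℕ) [NeZero n] (d : ℤ) :
    ∑ i : Fin n, Complex.exp (2 * Real.pi * d * i / n * Complex.I) =
      if (n : ℤ) ∣ d then (n : ℂ) else 0 := by
  have hn : (n : ℂ) ≠ 0 := Nat.cast_ne_zero.2 (NeZero.ne n)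
  set ζ : ℂ := Complex.exp (2 * Real.pi * d / n * Complex.I) with hζ
  have h1 : ∀ i : Fin n, Complex.exp (2 * Real.pi * d * i / n * Complex.I) = ζ ^ (i : ℕ) := by
    intro i
    rw [hζ, ← Complex.exp_nat_mul]
    congr 1
    ring
  have hζn : ζ ^ n = 1 := by
    rw [hζ, ← Complex.exp_nat_mul, Complex.exp_eq_one_iff]
    exact ⟨d, by field_simp⟩
  simp_rw [h1]
  rw [Fin.sum_univ_eq_sum_range (fun i => ζ ^ i)]
  split_ifs with h
  · have : ζ = 1 := by
      rw [hζ, Complex.exp_eq_one_iff]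
      obtain ⟨c, rfl⟩ := h
      exact ⟨c, by push_cast; field_simp⟩
    simp [this]
  · have hne : ζ ≠ 1 := by
      rw [hζ, Ne, Complex.exp_eq_one_iff]
      rintro ⟨c, hc⟩
      apply h
      refine ⟨c, ?_⟩
      have h2 : (2 * Real.pi * Complex.I : ℂ) ≠ 0 := Complex.two_pi_I_ne_zero
      have h3 : (2 * Real.pi * Complex.I : ℂ) * d = (2 * Real.pi * Complex.I : ℂ) * (n * c) := by
        field_simp at hc
        linear_combination (2 * Real.pi * Complex.I) * hc
      have h4 := mul_left_cancel₀ h2 h3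
      exact_mod_cast h4
    rw [geom_sum_eq hne, hζn]
    simp

theorem sum_cos_two_pi (n : ℕ) [NeZero n] (d : ℤ) :
    ∑ i : Fin n, Real.cos (2 * Real.pi * d * i / n) = if (n : ℤ) ∣ d then (n : ℝ) else 0 := by
  have h := congrArg Complex.re (sum_exp_two_pi n d)
  rw [Complex.re_sum] at h
  have h1 : ∀ i : Fin n, (Complex.exp (2 * Real.pi * d * i / n * Complex.I)).re =
      Real.cos (2 * Real.pi * d * i / n) := by
    intro i
    rw [← Complex.exp_ofReal_mul_I_re]
    push_cast
    rfl
  simp_rw [h1] at h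
  rw [h]
  split_ifs <;> simp

theorem sum_sin_two_pi (n : ℕ) [NeZero n] (d : ℤ) :
    ∑ i : Fin n, Real.sin (2 * Real.pi * d * i / n) = 0 := by
  have h := congrArg Complex.im (sum_exp_two_pi n d)
  rw [Complex.im_sum] at h
  have h1 : ∀ i : Fin n, (Complex.exp (2 * Real.pi * d * i / n * Complex.I)).im =
      Real.sin (2 * Real.pi * d * i / n) := by
    intro i
    rw [← Complex.exp_ofReal_mul_I_im]
    push_cast
    rfl
  simp_rw [h1] at h
  rw [h]
  split_ifs <;> simp

/-- The Hartley matrix, a real orthogonal matrix that diagonalizes symmetric circulants. -/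
def hartley (n : ℕ) (k i : Fin n) : ℝ :=
  (Real.cos (2 * Real.pi * k * i / n) + Real.sin (2 * Real.pi * k * i / n)) / √n

theorem hartley_add (n : ℕ) [NeZero n] (k i : Fin n) (j : ℕ) :
    hartley n k (i + Fin.ofNat n j) =
      (Real.cos (2 * Real.pi * k * j / n) * (Real.cos (2 * Real.pi * k * i / n) +
          Real.sin (2 * Real.pi * k * i / n)) +
        Real.sin (2 * Real.pi * k * j / n) * (Real.cos (2 * Real.pi * k * i / n) -
          Real.sin (2 * Real.pi * k * i / n))) / √n := by
  have hn : (n : ℝ) ≠ 0 := Nat.cast_ne_zero.2 (NeZero.ne n)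
  have hval : ((i + Fin.ofNat n j : Fin n) : ℕ) = (i + j) % n := by
    simp [Fin.val_add, Fin.ofNat]
  have hdiv : ((i : ℕ) + j : ℝ) = ((i + Fin.ofNat n j : Fin n) : ℕ) + n * (((i + j) / n : ℕ) : ℝ) := by
    rw [hval]
    have := Nat.mod_add_div ((i : ℕ) + j) n
    exact_mod_cast this.symm
  have hang : 2 * Real.pi * k * i / n + 2 * Real.pi * k * j / n =
      2 * Real.pi * k * ((i + Fin.ofNat n j : Fin n) : ℕ) / n +
        ((k * ((i + j) / n) : ℕ) : ℝ) * (2 * Real.pi) := by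
    have : 2 * Real.pi * k * i / n + 2 * Real.pi * k * j / n =
      2 * Real.pi * k * ((i : ℕ) + j : ℝ) / n := by ring
    rw [this, hdiv]
    push_cast
    field_simp
  have hc := congrArg Real.cos hang
  have hs := congrArg Real.sin hang
  rw [Real.cos_add_nat_mul_two_pi, Real.cos_add] at hc
  rw [Real.sin_add_nat_mul_two_pi, Real.sin_add] at hs
  rw [hartley, ← hc, ← hs]
  ring

theorem natCast_dvd_sub_iff_eq {n : ℕ} (k l : Fin n) :
    (n : ℤ) ∣ (k : ℕ) - (l : ℕ) ↔ k = l := by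
  constructor
  · intro h
    ext
    have hk := k.2
    have hl := l.2
    have := Int.eq_zero_of_abs_lt_dvd h (by rw [abs_lt]; omega)
    omega
  · rintro rfl; simp

/-- Product formulas turn each term into sines and cosines at the frequencies `k - l` and `k + l`,
whose full sums vanish unless `n` divides the frequency. The sine term, present for `l = -k` modulo
`n`, reflects that a single shift is not symmetric; it disappears from quadratic forms. -/
theorem sum_hartley_mul_hartley_add (n : ℕ) [NeZero n] (k l : Fin n) (j : ℕ) :
    ∑ i, hartley n k i * hartley n l (i + Fin.ofNat n j) =
      (if k = l then Real.cos (2 * Real.pi * l * j / n) else 0) +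
        if (n : ℤ) ∣ (k : ℕ) + (l : ℕ) then Real.sin (2 * Real.pi * l * j / n) else 0 := by
  have hn : (n : ℝ) ≠ 0 := Nat.cast_ne_zero.2 (NeZero.ne n)
  have hsq : √(n : ℝ) * √(n : ℝ) = n := Real.mul_self_sqrt (Nat.cast_nonneg n)
  have hterm : ∀ i : Fin n, hartley n k i * hartley n l (i + Fin.ofNat n j) =
      (Real.cos (2 * Real.pi * l * j / n) *
        (Real.cos (2 * Real.pi * ((k : ℕ) - (l : ℕ) : ℤ) * i / n) +
          Real.sin (2 * Real.pi * ((k : ℕ) + (l : ℕ) : ℤ) * i / n)) +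
        Real.sin (2 * Real.pi * l * j / n) *
        (Real.cos (2 * Real.pi * ((k : ℕ) + (l : ℕ) : ℤ) * i / n) +
          Real.sin (2 * Real.pi * ((k : ℕ) - (l : ℕ) : ℤ) * i / n))) / n := by
    intro i
    rw [hartley_add, hartley, div_mul_div_comm, hsq]
    have e1 : 2 * Real.pi * ((k : ℕ) - (l : ℕ) : ℤ) * i / n =
        2 * Real.pi * k * i / n - 2 * Real.pi * l * i / n := by push_cast; ring
    have e2 : 2 * Real.pi * ((k : ℕ) + (l : ℕ) : ℤ) * i / n =
        2 * Real.pi * k * i / n + 2 * Real.pi * l * i / n := by push_cast; ring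
    rw [e1, e2, Real.cos_add, Real.cos_sub, Real.sin_add, Real.sin_sub]
    ring
  simp_rw [hterm]
  rw [← Finset.sum_div, Finset.sum_add_distrib, ← Finset.mul_sum, ← Finset.mul_sum,
    Finset.sum_add_distrib, Finset.sum_add_distrib, sum_cos_two_pi, sum_cos_two_pi,
    sum_sin_two_pi, sum_sin_two_pi]
  simp only [natCast_dvd_sub_iff_eq]
  split_ifs <;> field_simp <;> ring

theorem sum_hartley_mul_hartley (n : ℕ) [NeZero n] (k l : Fin n) :
    ∑ i, hartley n k i * hartley n l i = if k = l then 1 else 0 := by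
  have h := sum_hartley_mul_hartley_add n k l 0
  have h0 : (Fin.ofNat n 0 : Fin n) = 0 := rfl
  simpa [h0] using h

/-- The Hartley basis of the Euclidean space. -/
def hartleyBasis (n : ℕ) [NeZero n] : OrthonormalBasis (Fin n) ℝ (EuclideanSpace ℝ (Fin n)) :=
  have hon : Orthonormal ℝ fun k : Fin n => WithLp.toLp 2 (hartley n k) := by
    rw [orthonormal_iff_ite]
    intro k l
    rw [← sum_hartley_mul_hartley, PiLp.inner_apply]
    exact Finset.sum_congr rfl fun i _ => mul_comm _ _
  (basisOfOrthonormalOfCardEqFinrank hon (by simp)).toOrthonormalBasis (by simpa using hon)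

theorem hartleyBasis_apply (n : ℕ) [NeZero n] (k : Fin n) :
    hartleyBasis n k = WithLp.toLp 2 (hartley n k) := by
  simp [hartleyBasis]

/-- The inverse Hartley transform. -/
def ofHartley (n : ℕ) (y : Fin n → ℝ) (i : Fin n) : ℝ := ∑ k, y k * hartley n k i

theorem measurable_ofHartley (n : ℕ) : Measurable (ofHartley n) := by
  unfold ofHartley; fun_prop

/-- Rotation invariance: coordinates in any orthonormal basis give the same standard Gaussian law.
-/
theorem measurePreserving_ofHartley (n : ℕ) [NeZero n] :
    MeasurePreserving (ofHartley n) (gaussianSpins n) (gaussianSpins n) := by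
  refine ⟨measurable_ofHartley n, ?_⟩
  have h1 := stdGaussian_eq_map_pi_orthonormalBasis (hartleyBasis n)
  rw [← map_pi_eq_stdGaussian] at h1
  have h2 := congrArg (Measure.map (WithLp.ofLp : EuclideanSpace ℝ (Fin n) → _)) h1
  rw [Measure.map_map (by fun_prop) (by fun_prop),
    Measure.map_map (by fun_prop) (by fun_prop)] at h2
  have e1 : (WithLp.ofLp : EuclideanSpace ℝ (Fin n) → _) ∘ (WithLp.toLp 2) = id := rfl
  have e2 : (WithLp.ofLp : EuclideanSpace ℝ (Fin n) → _) ∘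
      (fun x : Fin n → ℝ => ∑ i, x i • hartleyBasis n i) = ofHartley n := by
    ext x i
    simp [ofHartley, hartleyBasis_apply]
  rw [e1, e2, Measure.map_id] at h2
  exact h2.symm

/-- The eigenvalues of the normalized interaction matrix. -/
def eigenvalue (n r : ℕ) (k : ℤ) : ℝ :=
  1 / r * ∑ j ∈ Finset.Icc 1 r, Real.cos (2 * Real.pi * k * j / n)

theorem sum_mul_ofHartley_add (n : ℕ) [NeZero n] (y : Fin n → ℝ) (j : ℕ) :
    ∑ i, ofHartley n y i * ofHartley n y (i + Fin.ofNat n j) =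
      ∑ k : Fin n, Real.cos (2 * Real.pi * k * j / n) * y k ^ 2 := by
  have h1 : ∑ i, ofHartley n y i * ofHartley n y (i + Fin.ofNat n j) =
      ∑ k, ∑ l, y k * y l * ∑ i, hartley n k i * hartley n l (i + Fin.ofNat n j) := by
    simp_rw [ofHartley, Finset.sum_mul_sum, Finset.mul_sum]
    rw [Finset.sum_comm]
    refine Finset.sum_congr rfl fun k _ => ?_
    rw [Finset.sum_comm]
    refine Finset.sum_congr rfl fun l _ => Finset.sum_congr rfl fun i _ => by ring
  rw [h1]
  simp_rw [sum_hartley_mul_hartley_add, mul_add, Finset.sum_add_distrib]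
  have h2 : ∑ k : Fin n, ∑ l : Fin n, y k * y l *
      (if (n : ℤ) ∣ (k : ℕ) + (l : ℕ) then Real.sin (2 * Real.pi * l * j / n) else 0) = 0 := by
    -- If `n` divides `k + l`, the sines at `l` and `k` are opposite, so exchanging `k` and `l`
    -- negates the double sum.
    have hanti : ∑ k : Fin n, ∑ l : Fin n, y k * y l *
        (if (n : ℤ) ∣ (k : ℕ) + (l : ℕ) then Real.sin (2 * Real.pi * l * j / n) else 0) =
        -∑ k : Fin n, ∑ l : Fin n, y k * y l *
        (if (n : ℤ) ∣ (k : ℕ) + (l : ℕ) then Real.sin (2 * Real.pi * l * j / n) else 0) := by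
      conv_lhs => rw [Finset.sum_comm]
      rw [← Finset.sum_neg_distrib]
      refine Finset.sum_congr rfl fun l _ => ?_
      rw [← Finset.sum_neg_distrib]
      refine Finset.sum_congr rfl fun k _ => ?_
      rw [add_comm ((k : ℕ) : ℤ) ((l : ℕ) : ℤ)]
      split_ifs with hd
      · obtain ⟨c, hc⟩ := hd
        have hn : (n : ℝ) ≠ 0 := Nat.cast_ne_zero.2 (NeZero.ne n)
        have hc' : ((l : ℕ) : ℝ) + ((k : ℕ) : ℝ) = n * c := by exact_mod_cast hc
        have : 2 * Real.pi * l * j / n =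
            ((c * j : ℤ) : ℝ) * (2 * Real.pi) - 2 * Real.pi * k * j / n := by
          rw [eq_sub_iff_add_eq, ← add_div, div_eq_iff hn]
          push_cast
          linear_combination 2 * Real.pi * j * hc'
        rw [this, Real.sin_int_mul_two_pi_sub]
        ring
      · simp
    linarith
  rw [h2, add_zero]
  refine Finset.sum_congr rfl fun k _ => ?_
  simp only [mul_ite, mul_zero, Finset.sum_ite_eq, Finset.mem_univ, if_true]
  ring

theorem hamiltonian_ofHartley (n r : ℕ) [NeZero n] (y : Fin n → ℝ) :
    hamiltonian n r (ofHartley n y) = -(1 / 2) * ∑ k : Fin n, eigenvalue n r (k : ℕ) * y k ^ 2 := by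
  unfold hamiltonian
  rw [Finset.sum_comm]
  simp_rw [sum_mul_ofHartley_add]
  rw [Finset.sum_comm]
  rw [Finset.mul_sum, Finset.mul_sum]
  refine Finset.sum_congr rfl fun k _ => ?_
  rw [eigenvalue, ← Finset.sum_mul]
  push_cast
  ring

theorem temperature_ofHartley (n : ℕ) [NeZero n] (y : Fin n → ℝ) :
    temperature n (ofHartley n y) = (∑ k, y k ^ 2) / n := by
  -- The shift `j = 0` is Parseval's identity.
  have h := sum_mul_ofHartley_add n y 0
  have h0 : (Fin.ofNat n 0 : Fin n) = 0 := rfl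
  simp only [h0, add_zero, Nat.cast_zero, mul_zero, zero_div, Real.cos_zero, one_mul] at h
  rw [temperature, ← h]
  simp_rw [pow_two]

theorem magnetization_ofHartley (n : ℕ) [NeZero n] (y : Fin n → ℝ) :
    magnetization n (ofHartley n y) = √n * y 0 := by
  have hn : 0 < √(n : ℝ) := Real.sqrt_pos.2 (Nat.cast_pos.2 (NeZero.pos n))
  have h1 : ∀ k, ∑ i, hartley n k i = √n * if k = 0 then 1 else 0 := by
    intro k
    rw [← sum_hartley_mul_hartley, Finset.mul_sum]
    refine Finset.sum_congr rfl fun i _ => ?_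
    have : hartley n 0 i = 1 / √n := by simp [hartley]
    rw [this]
    field_simp
  unfold magnetization ofHartley
  rw [Finset.sum_comm]
  simp_rw [← Finset.mul_sum, h1]
  simp [mul_comm]

/-! ### Conical coordinates and the law of the magnetization -/

/-- The substitution `y = √(a t² - q)`. With `q` the squared norm of the other coordinates, it
replaces the constant mode by the normalized radius `t`. -/
theorem lintegral_Ioi_eq_lintegral_sqrt {a q : ℝ} (ha : 0 < a) (hq : 0 ≤ q) (G : ℝ → ℝ≥0∞) :
    ∫⁻ y in Set.Ioi 0, G y = ∫⁻ t in Set.Ioi 0 ∩ {t | q < a * t ^ 2},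
      ENNReal.ofReal (a * t / √(a * t ^ 2 - q)) * G (√(a * t ^ 2 - q)) := by
  set s : Set ℝ := Set.Ioi 0 ∩ {t | q < a * t ^ 2} with hs
  have hms : MeasurableSet s :=
    measurableSet_Ioi.inter (measurableSet_lt measurable_const (by fun_prop))
  have himg : (fun t => √(a * t ^ 2 - q)) '' s = Set.Ioi 0 := by
    ext y
    simp only [Set.mem_image, Set.mem_Ioi, hs, Set.mem_inter_iff, Set.mem_ofPred_eq]
    constructor
    · rintro ⟨t, ⟨_, h2⟩, rfl⟩
      exact Real.sqrt_pos.2 (by linarith)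
    · intro hy
      have hpos : 0 < (y ^ 2 + q) / a := by positivity
      have hsq : a * √((y ^ 2 + q) / a) ^ 2 = y ^ 2 + q := by
        rw [Real.sq_sqrt hpos.le]; field_simp
      refine ⟨√((y ^ 2 + q) / a), ⟨Real.sqrt_pos.2 hpos, ?_⟩, ?_⟩
      · rw [hsq]; nlinarith
      · rw [hsq, add_sub_cancel_right, Real.sqrt_sq hy.le]
  have hder : ∀ t ∈ s, HasDerivWithinAt (fun t => √(a * t ^ 2 - q))
      (a * t / √(a * t ^ 2 - q)) s t := by
    rintro t ⟨_, h2⟩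
    have h2' : q < a * t ^ 2 := h2
    have h3 : HasDerivAt (fun t : ℝ => a * t ^ 2 - q) (a * (2 * t)) t := by
      simpa using (((hasDerivAt_id t).pow 2).const_mul a).sub_const q
    have h4 := (h3.sqrt (by linarith : 0 < a * t ^ 2 - q).ne').hasDerivWithinAt (s := s)
    refine h4.congr_deriv ?_
    rw [show a * (2 * t) = 2 * (a * t) by ring, mul_div_mul_left _ _ two_ne_zero]
  have hinj : Set.InjOn (fun t => √(a * t ^ 2 - q)) s := by
    rintro t ⟨ht, ht2⟩ u ⟨hu, hu2⟩ h
    have ht2' : q < a * t ^ 2 := ht2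
    have hu2' : q < a * u ^ 2 := hu2
    have h1 := (Real.sqrt_inj (by linarith) (by linarith)).1 h
    have h2 : t ^ 2 = u ^ 2 := by
      have : a * t ^ 2 = a * u ^ 2 := by linarith
      exact mul_left_cancel₀ ha.ne' this
    exact (pow_left_inj₀ (le_of_lt ht) (le_of_lt hu) two_ne_zero).1 h2
  rw [← himg, lintegral_image_eq_lintegral_abs_deriv_mul hms hder hinj]
  refine setLIntegral_congr_fun hms fun t ht => ?_
  have ht0 : 0 < t := ht.1
  rw [abs_of_nonneg (by positivity)]

theorem lintegral_comp_smul_fin (m : ℕ) {t : ℝ} (ht : 0 < t) (G : (Fin m → ℝ) → ℝ≥0∞) :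
    ∫⁻ y, G y = ENNReal.ofReal (t ^ m) * ∫⁻ z, G (t • z) := by
  have h := Measure.map_addHaar_smul (volume : Measure (Fin m → ℝ)) ht.ne'
  have h2 : ∫⁻ z, G (t • z) = ∫⁻ y, G y ∂(Measure.map (t • ·) volume) := by
    rw [MeasurableEmbedding.lintegral_map]
    exact (Homeomorph.smulOfNeZero t ht.ne').measurableEmbedding
  rw [h2, h, lintegral_smul_measure, smul_eq_mul, ← mul_assoc, ← ENNReal.ofReal_mul (by positivity)]
  rw [Module.finrank_fin_fun, abs_of_pos (by positivity), mul_inv_cancel₀ (by positivity)]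
  simp

/-- The projection of the half-sphere on its equator, in conical coordinates. -/
theorem lintegral_lintegral_Ioi_eq (m : ℕ) {a : ℝ} (ha : 0 < a) (F : ℝ → (Fin m → ℝ) → ℝ≥0∞)
    (hF : Measurable (Function.uncurry F)) :
    ∫⁻ y, ∫⁻ s in Set.Ioi 0, F s y = ∫⁻ t in Set.Ioi 0, ENNReal.ofReal (t ^ m) *
      ∫⁻ z in {z : Fin m → ℝ | ∑ i, z i ^ 2 < a}, ENNReal.ofReal (a / √(a - ∑ i, z i ^ 2)) *
        F (t * √(a - ∑ i, z i ^ 2)) (t • z) := by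
  have hq0 : ∀ z : Fin m → ℝ, 0 ≤ ∑ i, z i ^ 2 := fun z => Finset.sum_nonneg fun i _ => sq_nonneg _
  have hset : ∀ y : Fin m → ℝ,
      MeasurableSet {t : ℝ | ∑ i, y i ^ 2 < a * t ^ 2} := fun y =>
    measurableSet_lt measurable_const (by fun_prop)
  -- The domain depends on both variables; as an indicator inside the integrand it does not obstruct
  -- Tonelli's theorem.
  let K : (Fin m → ℝ) → ℝ → ℝ≥0∞ := fun y t =>
    {p : (Fin m → ℝ) × ℝ | ∑ i, p.1 i ^ 2 < a * p.2 ^ 2}.indicator (fun p =>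
      ENNReal.ofReal (a * p.2 / √(a * p.2 ^ 2 - ∑ i, p.1 i ^ 2)) *
        F (√(a * p.2 ^ 2 - ∑ i, p.1 i ^ 2)) p.1) (y, t)
  have hK : Measurable (Function.uncurry K) := by
    refine Measurable.indicator ?_ (measurableSet_lt (by fun_prop) (by fun_prop))
    refine Measurable.mul (by fun_prop) ?_
    exact hF.comp (g := Function.uncurry F) (f := fun p : (Fin m → ℝ) × ℝ =>
      (√(a * p.2 ^ 2 - ∑ i, p.1 i ^ 2), p.1)) (by fun_prop)
  have h1 : ∀ y, ∫⁻ s in Set.Ioi 0, F s y = ∫⁻ t in Set.Ioi 0, K y t := by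
    intro y
    rw [lintegral_Ioi_eq_lintegral_sqrt ha (hq0 y), Set.inter_comm,
      ← Measure.restrict_restrict (hset y), ← lintegral_indicator (hset y)]
    rfl
  simp_rw [h1]
  rw [lintegral_lintegral_swap hK.aemeasurable]
  refine setLIntegral_congr_fun measurableSet_Ioi fun t ht => ?_
  have ht0 : 0 < t := ht
  have hsetz : MeasurableSet {z : Fin m → ℝ | ∑ i, z i ^ 2 < a} :=
    measurableSet_lt (by fun_prop) measurable_const
  -- After the exchange `t` is fixed, and the dilation `y = t z` produces the factor `t ^ m`.
  rw [lintegral_comp_smul_fin m ht0, ← lintegral_indicator hsetz]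
  congr 1
  refine lintegral_congr fun z => ?_
  have hsum : ∑ i, (t • z) i ^ 2 = t ^ 2 * ∑ i, z i ^ 2 := by
    simp [mul_pow, Finset.mul_sum]
  have hiff : ∑ i, (t • z) i ^ 2 < a * t ^ 2 ↔ ∑ i, z i ^ 2 < a := by
    rw [hsum, mul_comm]
    exact mul_lt_mul_iff_left₀ (by positivity)
  by_cases hz : ∑ i, z i ^ 2 < a
  · rw [Set.indicator_of_mem (show z ∈ {z : Fin m → ℝ | ∑ i, z i ^ 2 < a} from hz)]
    simp only [K]
    rw [Set.indicator_of_mem (show (t • z, t) ∈ {p : (Fin m → ℝ) × ℝ |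
      ∑ i, p.1 i ^ 2 < a * p.2 ^ 2} from hiff.2 hz)]
    have hsq : √(a * t ^ 2 - ∑ i, (t • z) i ^ 2) = t * √(a - ∑ i, z i ^ 2) := by
      rw [hsum, show a * t ^ 2 - t ^ 2 * ∑ i, z i ^ 2 = t ^ 2 * (a - ∑ i, z i ^ 2) by ring,
        Real.sqrt_mul (by positivity), Real.sqrt_sq ht0.le]
    change ENNReal.ofReal (a * t / √(a * t ^ 2 - ∑ i, (t • z) i ^ 2)) *
      F (√(a * t ^ 2 - ∑ i, (t • z) i ^ 2)) (t • z) = _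
    rw [hsq, mul_comm a t, mul_div_mul_left _ _ ht0.ne']
  · rw [Set.indicator_of_notMem (show z ∉ {z : Fin m → ℝ | ∑ i, z i ^ 2 < a} from hz)]
    simp only [K]
    rw [Set.indicator_of_notMem (show (t • z, t) ∉ {p : (Fin m → ℝ) × ℝ |
      ∑ i, p.1 i ^ 2 < a * p.2 ^ 2} from fun h => hz (hiff.1 h))]

theorem lintegral_eq_lintegral_Ioi_add (G : ℝ → ℝ≥0∞) (hG : Measurable G) :
    ∫⁻ s, G s = ∫⁻ s in Set.Ioi 0, (G s + G (-s)) := by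
  have h1 : ∫⁻ s in Set.Iio 0, G s = ∫⁻ s in Set.Ioi 0, G (-s) := by
    have h := (Measure.measurePreserving_neg (volume : Measure ℝ)).setLIntegral_comp_preimage
      (s := Set.Iio 0) measurableSet_Iio hG
    rw [← h]
    simp
  rw [lintegral_add_left hG, ← h1, ← lintegral_add_compl G (measurableSet_Ioi (a := (0 : ℝ))),
    Set.compl_Ioi, setLIntegral_congr Iio_ae_eq_Iic]

theorem pi_gaussianReal_eq_withDensity (m : ℕ) (v : Fin m → NNReal) (hv : ∀ i, v i ≠ 0) :
    Measure.pi (fun i => gaussianReal 0 (v i)) =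
      (volume : Measure (Fin m → ℝ)).withDensity fun z => ∏ i, gaussianPDF 0 (v i) (z i) := by
  refine Measure.pi_eq fun s hs => ?_
  rw [withDensity_apply _ (MeasurableSet.univ_pi hs), ← lintegral_indicator (MeasurableSet.univ_pi hs)]
  have h0 : ∀ i x, 0 ≤ (s i).indicator (gaussianPDFReal 0 (v i)) x := fun i x =>
    Set.indicator_nonneg (fun x _ => gaussianPDFReal_nonneg _ _ _) _
  have hint : ∀ i, Integrable ((s i).indicator (gaussianPDFReal 0 (v i))) := fun i =>
    (integrable_gaussianPDFReal 0 (v i)).indicator (hs i)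
  have h1 : ∀ z : Fin m → ℝ, (Set.univ.pi s).indicator (fun z => ∏ i, gaussianPDF 0 (v i) (z i)) z =
      ENNReal.ofReal (∏ i, (s i).indicator (gaussianPDFReal 0 (v i)) (z i)) := by
    intro z
    rw [ENNReal.ofReal_prod_of_nonneg fun i _ => h0 i _]
    by_cases hz : z ∈ Set.univ.pi s
    · rw [Set.indicator_of_mem hz]
      refine Finset.prod_congr rfl fun i _ => ?_
      rw [Set.indicator_of_mem (hz i trivial)]
      rfl
    · rw [Set.indicator_of_notMem hz]
      obtain ⟨i, hi⟩ : ∃ i, z i ∉ s i := by simpa using hz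
      symm
      refine Finset.prod_eq_zero (Finset.mem_univ i) ?_
      simp [Set.indicator_of_notMem hi]
  simp_rw [h1]
  rw [← ofReal_integral_eq_lintegral_ofReal (μ := (volume : Measure (Fin m → ℝ)))
    (Integrable.fintype_prod hint)
    (ae_of_all _ fun z => Finset.prod_nonneg fun i _ => h0 i _),
    volume_pi, integral_fintype_prod_eq_prod, ENNReal.ofReal_prod_of_nonneg
      fun i _ => integral_nonneg (h0 i)]
  refine Finset.prod_congr rfl fun i _ => ?_
  rw [integral_indicator (hs i), gaussianReal_apply_eq_integral _ (hv i)]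

theorem prod_gaussianPDF (m : ℕ) (v : Fin m → NNReal) (z : Fin m → ℝ) :
    ∏ i, gaussianPDF 0 (v i) (z i) = ENNReal.ofReal (∏ i, (√(2 * Real.pi * v i))⁻¹) *
      ENNReal.ofReal (Real.exp (-(1 / 2) * ∑ i, z i ^ 2 / v i)) := by
  rw [← ENNReal.ofReal_mul (by positivity), Finset.mul_sum, Real.exp_sum, ← Finset.prod_mul_distrib,
    ENNReal.ofReal_prod_of_nonneg fun i _ => by positivity]
  refine Finset.prod_congr rfl fun i _ => ?_
  rw [gaussianPDF, gaussianPDFReal]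
  congr 3
  rw [sub_zero]
  ring

/-- The law of the magnetization: the half-sphere is projected on the orthogonal complement of the
constants, where the density of the model becomes Gaussian. -/
theorem exists_lintegral_weight_mul (m r : ℕ) (v : Fin m → NNReal) (hv0 : ∀ i, v i ≠ 0)
    (hv : ∀ i : Fin m, 1 / (v i : ℝ) = 1 - eigenvalue (m + 1) r ((i.succ : Fin (m + 1)) : ℕ))
    (hr : 0 < r) :
    ∃ C : ℝ≥0∞, C ≠ 0 ∧ C ≠ ∞ ∧ ∀ G : ℝ → ℝ≥0∞, Measurable G →
      ∫⁻ x, weight (m + 1) r x * G (magnetization (m + 1) x) ∂gaussianSpins (m + 1) =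
        C * ∫⁻ t in Set.Ioi 0, ENNReal.ofReal (t ^ m * Real.exp (-((m + 1 : ℕ) : ℝ) * t ^ 2 / 2)) *
          ∫⁻ z in {z : Fin m → ℝ | ∑ i, z i ^ 2 < (m + 1 : ℕ)},
            ENNReal.ofReal (1 / √((m + 1 : ℕ) - ∑ i, z i ^ 2)) *
            (G (√(m + 1 : ℕ) * (t * √((m + 1 : ℕ) - ∑ i, z i ^ 2))) +
              G (-(√(m + 1 : ℕ) * (t * √((m + 1 : ℕ) - ∑ i, z i ^ 2)))))
            ∂(Measure.pi fun i => gaussianReal 0 (v i)) := by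
  set n : ℕ := m + 1 with hn
  have hn0 : (0 : ℝ) < (n : ℝ) := by rw [hn]; positivity
  set lam : Fin m → ℝ := fun i => eigenvalue n r ((i.succ : Fin (m + 1)) : ℕ) with hlam
  have hlam0 : eigenvalue n r 0 = 1 := by
    have : (r : ℝ) ≠ 0 := by positivity
    simp [eigenvalue, this]
  set c0 : ℝ := ∏ _i : Fin (m + 1), (√(2 * Real.pi * ((1 : NNReal) : ℝ)))⁻¹ with hc0
  set c1 : ℝ := ∏ i, (√(2 * Real.pi * (v i : ℝ)))⁻¹ with hc1
  have hc0pos : 0 < c0 := Finset.prod_pos fun i _ => by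
    have := Real.pi_pos
    simp only [NNReal.coe_one]
    positivity
  have hc1pos : 0 < c1 := Finset.prod_pos fun i _ => by
    have := Real.pi_pos
    have : (0 : ℝ) < v i := by have := hv0 i; positivity
    positivity
  -- The constant gathers the normalizations `c0` of the standard Gaussian and `c1` of the Gaussian
  -- with variances `v`, the constant part `n / 2` of the exponent, and the numerator `n` of the
  -- Jacobian.
  refine ⟨ENNReal.ofReal (c0 * Real.exp (n / 2) * n / c1), by
    rw [Ne, ENNReal.ofReal_eq_zero, not_le]; positivity, ENNReal.ofReal_ne_top, fun G hG => ?_⟩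
  -- the density in Hartley coordinates
  let E : ℝ → (Fin m → ℝ) → ℝ := fun s y => Real.exp (-(1 / 2) * (s ^ 2 + ∑ i, y i ^ 2) +
    n / 2 * (s ^ 2 + ∑ i, lam i * y i ^ 2) / (s ^ 2 + ∑ i, y i ^ 2))
  have hEm : Measurable (Function.uncurry E) := by
    simp only [E, Function.uncurry_def]
    fun_prop
  let F : ℝ → (Fin m → ℝ) → ℝ≥0∞ := fun s y =>
    ENNReal.ofReal (c0 * E s y) * (G (√n * s) + G (-(√n * s)))
  have hF : Measurable (Function.uncurry F) := by
    have h1 : Measurable fun p : ℝ × (Fin m → ℝ) => G (√n * p.1) := hG.comp (by fun_prop)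
    have h2 : Measurable fun p : ℝ × (Fin m → ℝ) => G (-(√n * p.1)) := hG.comp (by fun_prop)
    have h3 : Measurable fun p : ℝ × (Fin m → ℝ) => ENNReal.ofReal (c0 * E p.1 p.2) :=
      (hEm.const_mul c0).ennreal_ofReal
    exact h3.mul (h1.add h2)
  have hwm : Measurable fun x => weight n r x * G (magnetization n x) :=
    (measurable_weight n r).mul (hG.comp (by unfold magnetization; fun_prop))
  let Φ : (Fin (m + 1) → ℝ) → ℝ≥0∞ := fun y =>
    (∏ i, gaussianPDF 0 1 (y i)) * (weight n r (ofHartley n y) * G (magnetization n (ofHartley n y)))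
  have hpdfm : Measurable fun y : Fin (m + 1) → ℝ => ∏ i, gaussianPDF 0 1 (y i) :=
    Finset.measurable_prod _ fun i _ => (measurable_gaussianPDF 0 1).comp (measurable_pi_apply i)
  have hΦm : Measurable Φ := hpdfm.mul (hwm.comp (measurable_ofHartley n))
  -- A nonzero constant mode ensures that the temperature is positive, so the indicator in the
  -- weight equals one.
  have hΦ : ∀ s : ℝ, s ≠ 0 → ∀ y : Fin m → ℝ,
      Φ (Fin.cons s y) = ENNReal.ofReal (c0 * E s y) * G (√n * s) := by
    intro s hs y
    have hq : 0 ≤ ∑ i, y i ^ 2 := Finset.sum_nonneg fun i _ => sq_nonneg _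
    have hs2 : 0 < s ^ 2 := by positivity
    have hT : temperature n (ofHartley n (Fin.cons s y : Fin (m + 1) → ℝ)) =
        (s ^ 2 + ∑ i, y i ^ 2) / n := by
      rw [temperature_ofHartley, Fin.sum_univ_succ]
      simp
    have hTpos : 0 < temperature n (ofHartley n (Fin.cons s y : Fin (m + 1) → ℝ)) := by
      rw [hT]; positivity
    simp only [Φ]
    rw [prod_gaussianPDF, weight, Set.indicator_of_mem (show _ ∈ {x | 0 < temperature n x} from hTpos),
      hT, hamiltonian_ofHartley, magnetization_ofHartley, ← mul_assoc, ← hc0,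
      ← ENNReal.ofReal_mul hc0pos.le, ← ENNReal.ofReal_mul (by positivity), mul_assoc,
      ← Real.exp_add]
    simp only [E]
    congr 4
    rw [Fin.sum_univ_succ, Fin.sum_univ_succ]
    simp only [Fin.cons_zero, Fin.cons_succ, NNReal.coe_one, div_one, Fin.val_zero, Nat.cast_zero,
      hlam0, one_mul]
    simp only [hlam]
    have hne : s ^ 2 + ∑ i, y i ^ 2 ≠ 0 := by positivity
    field_simp
    ring
  have hsplit : ∫⁻ x, weight n r x * G (magnetization n x) ∂gaussianSpins n =
      ∫⁻ y : Fin m → ℝ, ∫⁻ s in Set.Ioi 0, F s y := by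
    rw [← (measurePreserving_ofHartley n).lintegral_comp hwm, gaussianSpins,
      pi_gaussianReal_eq_withDensity n (fun _ => 1) (fun _ => one_ne_zero)]
    refine (lintegral_withDensity_eq_lintegral_mul _ hpdfm
      (hwm.comp (measurable_ofHartley n))).trans ?_
    change ∫⁻ y, Φ y = _
    have hmp := volume_preserving_piFinSuccAbove (fun _ : Fin (m + 1) => ℝ) 0
    rw [← hmp.symm.lintegral_comp hΦm, Measure.volume_eq_prod]
    refine (lintegral_prod_symm' _ (hΦm.comp (MeasurableEquiv.measurable _))).trans
      (lintegral_congr fun y => ?_)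
    simp only [Function.comp_apply]
    have hsy : ∀ s : ℝ, (MeasurableEquiv.piFinSuccAbove (fun _ : Fin (m + 1) => ℝ) 0).symm (s, y) =
        Fin.cons s y := by
      intro s
      simp [MeasurableEquiv.piFinSuccAbove, Fin.insertNthEquiv]
    simp_rw [hsy]
    have hcons : Measurable fun s : ℝ => (Fin.cons s y : Fin (m + 1) → ℝ) := by
      refine measurable_pi_iff.2 fun i => ?_
      refine Fin.cases ?_ (fun j => ?_) i
      · simpa using measurable_id'
      · simp
    refine (lintegral_eq_lintegral_Ioi_add _ (hΦm.comp hcons)).trans ?_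
    refine setLIntegral_congr_fun measurableSet_Ioi fun s hs => ?_
    have hs0 : s ≠ 0 := ne_of_gt hs
    change Φ (Fin.cons s y) + Φ (Fin.cons (-s) y) = F s y
    rw [hΦ s hs0, hΦ (-s) (neg_ne_zero.2 hs0)]
    simp only [F, E, neg_sq, mul_neg]
    exact (mul_add _ _ _).symm
  rw [hsplit, lintegral_lintegral_Ioi_eq m hn0 F hF, ← lintegral_const_mul' _ _ ENNReal.ofReal_ne_top]
  refine setLIntegral_congr_fun measurableSet_Ioi fun t ht => ?_
  have ht0 : 0 < t := ht
  have hsetz : MeasurableSet {z : Fin m → ℝ | ∑ i, z i ^ 2 < n} :=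
    measurableSet_lt (by fun_prop) measurable_const
  rw [pi_gaussianReal_eq_withDensity m v hv0, ← lintegral_indicator hsetz, ← lintegral_indicator hsetz,
    lintegral_withDensity_eq_lintegral_mul₀]
  rotate_left
  · exact (Finset.measurable_prod _ fun i _ =>
      (measurable_gaussianPDF 0 (v i)).comp (measurable_pi_apply i)).aemeasurable
  · refine (Measurable.indicator ?_ hsetz).aemeasurable
    have h1 : Measurable fun z : Fin m → ℝ => G (√n * (t * √(n - ∑ i, z i ^ 2))) :=
      hG.comp (by fun_prop)
    have h2 : Measurable fun z : Fin m → ℝ => G (-(√n * (t * √(n - ∑ i, z i ^ 2)))) :=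
      hG.comp (by fun_prop)
    exact Measurable.mul (by fun_prop) (h1.add h2)
  rw [← mul_assoc, ← ENNReal.ofReal_mul (by positivity), ← lintegral_const_mul' _ _ ENNReal.ofReal_ne_top,
    ← lintegral_const_mul' _ _ ENNReal.ofReal_ne_top]
  refine lintegral_congr fun z => ?_
  by_cases hz : ∑ i, z i ^ 2 < n
  swap
  · have hz' : z ∉ {z : Fin m → ℝ | ∑ i, z i ^ 2 < n} := hz
    rw [Pi.mul_apply, Set.indicator_of_notMem hz', Set.indicator_of_notMem hz']
    simp
  have hz' : z ∈ {z : Fin m → ℝ | ∑ i, z i ^ 2 < n} := hz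
  rw [Pi.mul_apply, Set.indicator_of_mem hz', Set.indicator_of_mem hz', prod_gaussianPDF]
  simp only [F]
  set g := G (√n * (t * √(n - ∑ i, z i ^ 2))) + G (-(√n * (t * √(n - ∑ i, z i ^ 2))))
  -- Here the squared norm is `n t²`, so the quotient in the exponent is free of `t`. The coordinate
  -- `s` has eigenvalue one, and eliminating it through `n - ∑ z_i²` leaves the form with
  -- coefficients `1 - lam i`, which are the inverse variances.
  have hE : E (t * √(n - ∑ i, z i ^ 2)) (t • z) = Real.exp (n / 2) *
      Real.exp (-(n : ℝ) * t ^ 2 / 2) * Real.exp (-(1 / 2) * ∑ i, z i ^ 2 / v i) := by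
    simp only [E]
    rw [← Real.exp_add, ← Real.exp_add]
    congr 1
    have e1 : (t * √(n - ∑ i, z i ^ 2)) ^ 2 = t ^ 2 * (n - ∑ i, z i ^ 2) := by
      rw [mul_pow, Real.sq_sqrt (by linarith)]
    have e2 : ∑ i, (t • z) i ^ 2 = t ^ 2 * ∑ i, z i ^ 2 := by simp [mul_pow, Finset.mul_sum]
    have e3 : ∑ i, lam i * (t • z) i ^ 2 = t ^ 2 * ∑ i, lam i * z i ^ 2 := by
      rw [Finset.mul_sum]
      refine Finset.sum_congr rfl fun i _ => ?_
      simp only [Pi.smul_apply, smul_eq_mul]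
      ring
    have e4 : ∑ i, z i ^ 2 / v i = ∑ i, z i ^ 2 - ∑ i, lam i * z i ^ 2 := by
      rw [← Finset.sum_sub_distrib]
      refine Finset.sum_congr rfl fun i _ => ?_
      rw [div_eq_mul_one_div, hv i]
      simp only [hlam]
      ring
    rw [e1, e2, e3, e4]
    generalize ∑ i, z i ^ 2 = S
    generalize ∑ i, lam i * z i ^ 2 = L
    rw [← mul_add, ← mul_add, sub_add_cancel]
    field_simp
    ring
  rw [hE]
  have hcalc : ENNReal.ofReal (t ^ m) * (ENNReal.ofReal (n / √(n - ∑ i, z i ^ 2)) *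
      ENNReal.ofReal (c0 * (Real.exp (n / 2) * Real.exp (-(n : ℝ) * t ^ 2 / 2) *
        Real.exp (-(1 / 2) * ∑ i, z i ^ 2 / v i)))) =
      ENNReal.ofReal (c0 * Real.exp (n / 2) * n / c1 * (t ^ m * Real.exp (-(n : ℝ) * t ^ 2 / 2))) *
        (ENNReal.ofReal c1 * ENNReal.ofReal (Real.exp (-(1 / 2) * ∑ i, z i ^ 2 / v i)) *
          ENNReal.ofReal (1 / √(n - ∑ i, z i ^ 2))) := by
    rw [← ENNReal.ofReal_mul (by positivity), ← ENNReal.ofReal_mul (by positivity),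
      ← ENNReal.ofReal_mul (by positivity), ← ENNReal.ofReal_mul (by positivity),
      ← ENNReal.ofReal_mul (by positivity)]
    congr 1
    field_simp
  calc _ = ENNReal.ofReal (t ^ m) * (ENNReal.ofReal (n / √(n - ∑ i, z i ^ 2)) *
      ENNReal.ofReal (c0 * (Real.exp (n / 2) * Real.exp (-(n : ℝ) * t ^ 2 / 2) *
        Real.exp (-(1 / 2) * ∑ i, z i ^ 2 / v i)))) * g := by ring
    _ = _ := by rw [hcalc]; ring

/-! ### Bounded densities and the inverse square root tilt -/

/-- Shrinking open intervals gives the bound on half-open ones. Lebesgue measure comes from the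
largest outer measure below the interval lengths, so a bound on intervals extends to all sets. -/
theorem le_smul_volume_of_Ioo {κ : Measure ℝ} {C : ℝ≥0∞} (hC0 : C ≠ 0) (hC : C ≠ ∞)
    (h : ∀ a b, κ (Set.Ioo a b) ≤ C * ENNReal.ofReal (b - a)) : κ ≤ C • volume := by
  have hIoc : ∀ a b, κ (Set.Ioc a b) ≤ C * ENNReal.ofReal (b - a) := by
    intro a b
    have h1 : ∀ k : ℕ, κ (Set.Ioc a b) ≤ C * ENNReal.ofReal (b + 1 / ((k : ℝ) + 1) - a) := fun k =>
      (measure_mono (Set.Ioc_subset_Ioo_right (by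
        have : 0 < 1 / ((k : ℝ) + 1) := by positivity
        linarith))).trans (h a _)
    have h2 : Tendsto (fun k : ℕ => C * ENNReal.ofReal (b + 1 / ((k : ℝ) + 1) - a)) atTop
        (𝓝 (C * ENNReal.ofReal (b + 0 - a))) :=
      ENNReal.Tendsto.const_mul (ENNReal.tendsto_ofReal
        ((tendsto_const_nhds.add tendsto_one_div_add_atTop_nhds_zero_nat).sub_const a)) (Or.inr hC)
    rw [add_zero] at h2
    exact ge_of_tendsto' h2 h1
  have hle : κ.toOuterMeasure ≤ C • StieltjesFunction.id.outer := by
    rw [StieltjesFunction.outer, OuterMeasure.smul_ofFunction hC, OuterMeasure.le_ofFunction]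
    intro s
    rw [Pi.smul_apply, smul_eq_mul, StieltjesFunction.length_eq]
    simp_rw [ENNReal.mul_iInf_of_ne hC0 hC]
    refine le_iInf fun a => le_iInf fun b => le_iInf fun hs => ?_
    refine (measure_mono ?_).trans (hIoc a b)
    intro x hx
    -- The Stieltjes length leaves out least elements of the order; the real line has none.
    exact hs ⟨hx, notMem_botSet_of_lt (sub_one_lt x)⟩
  refine Measure.le_iff'.2 fun s => ?_
  refine (hle s).trans_eq ?_
  rw [Measure.smul_apply, Real.volume_eq_stieltjes_id, StieltjesFunction.measure]
  rfl

/-- By the portmanteau theorem the bound on open intervals survives the weak limit, and such bounds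
determine domination by Lebesgue measure. -/
theorem le_smul_volume_of_tendsto {κs : ℕ → ProbabilityMeasure ℝ} {κ : ProbabilityMeasure ℝ}
    {C : ℝ≥0∞} (hC0 : C ≠ 0) (hC : C ≠ ∞) (hκ : Tendsto κs atTop (𝓝 κ))
    (h : ∀ᶠ n in atTop, (κs n : Measure ℝ) ≤ C • volume) : (κ : Measure ℝ) ≤ C • volume := by
  refine le_smul_volume_of_Ioo hC0 hC fun a b => ?_
  refine (ProbabilityMeasure.le_liminf_measure_open_of_tendsto hκ isOpen_Ioo).trans ?_
  refine liminf_le_of_frequently_le' (Eventually.frequently ?_)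
  filter_upwards [h] with n hn
  refine (hn _).trans ?_
  simp

/-- The part of a measure on the positive half-line, tilted by the inverse square root. -/
def invSqrtTilt (κ : Measure ℝ) : Measure ℝ :=
  (κ.restrict (Set.Ioi 0)).withDensity fun w => ENNReal.ofReal (1 / √w)

/-- The tilted mass near the singularity is `O(√ε)` with a constant that depends only on the density
bound, hence uniform along a sequence. -/
theorem setLIntegral_inv_sqrt_le {κ : Measure ℝ} {C : ℝ≥0∞} (hκ : κ ≤ C • volume) {ε : ℝ}
    (hε : 0 < ε) :
    ∫⁻ w in Set.Ioc 0 ε, ENNReal.ofReal (1 / √w) ∂κ ≤ C * ENNReal.ofReal (2 * √ε) := by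
  have h1 : ∫⁻ w in Set.Ioc 0 ε, ENNReal.ofReal (1 / √w) ∂κ ≤
      C * ∫⁻ w in Set.Ioc 0 ε, ENNReal.ofReal (1 / √w) := by
    rw [← smul_eq_mul, ← lintegral_smul_measure, ← Measure.restrict_smul]
    exact lintegral_mono' (Measure.restrict_mono le_rfl hκ) le_rfl
  refine h1.trans_eq ?_
  congr 1
  have hfun : Set.EqOn (fun w : ℝ => 1 / √w) (fun w => w ^ (-(1 / 2) : ℝ)) (Set.Ioc 0 ε) := by
    intro w hw
    have hw0 : 0 < w := hw.1
    simp only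
    rw [Real.rpow_neg hw0.le, Real.sqrt_eq_rpow, one_div]
  have hint : IntegrableOn (fun w : ℝ => w ^ (-(1 / 2) : ℝ)) (Set.Ioc 0 ε) :=
    (intervalIntegrable_iff_integrableOn_Ioc_of_le hε.le).1
      (intervalIntegral.intervalIntegrable_rpow' (by norm_num))
  rw [setLIntegral_congr_fun measurableSet_Ioc fun w hw => congrArg ENNReal.ofReal (hfun hw),
    ← ofReal_integral_eq_lintegral_ofReal hint]
  · rw [← intervalIntegral.integral_of_le hε.le, integral_rpow (Or.inl (by norm_num)),
      Real.sqrt_eq_rpow]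
    congr 1
    norm_num [Real.zero_rpow]
    ring
  · filter_upwards [ae_restrict_mem measurableSet_Ioc] with w hw
    exact Real.rpow_nonneg hw.1.le _

theorem isFiniteMeasure_invSqrtTilt {κ : Measure ℝ} [IsFiniteMeasure κ] {C : ℝ≥0∞} (hC : C ≠ ∞)
    (hκ : κ ≤ C • volume) : IsFiniteMeasure (invSqrtTilt κ) := by
  constructor
  rw [invSqrtTilt, withDensity_apply _ MeasurableSet.univ, Measure.restrict_univ,
    ← Set.Ioc_union_Ioi_eq_Ioi zero_le_one]
  refine (lintegral_union_le _ _ _).trans_lt (ENNReal.add_lt_top.2 ⟨?_, ?_⟩)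
  · exact (setLIntegral_inv_sqrt_le hκ one_pos).trans_lt
      (ENNReal.mul_lt_top hC.lt_top ENNReal.ofReal_lt_top)
  · have h1 : ∫⁻ w in Set.Ioi 1, ENNReal.ofReal (1 / √w) ∂κ ≤ ∫⁻ w in Set.Ioi 1, 1 ∂κ := by
      refine setLIntegral_mono measurable_const fun w hw => ?_
      rw [← ENNReal.ofReal_one]
      refine ENNReal.ofReal_le_ofReal ?_
      have hw1 : (1 : ℝ) < w := hw
      rw [div_le_one (Real.sqrt_pos.2 (by linarith))]
      exact Real.one_le_sqrt.2 hw1.le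
    refine h1.trans_lt ?_
    simp

/-- A continuous truncation of the inverse square root on the positive half-line. -/
def truncInvSqrt (ε w : ℝ) : ℝ := 1 / √(max w ε) * min 1 (max w 0 / ε)

theorem continuous_truncInvSqrt {ε : ℝ} (hε : 0 < ε) : Continuous (truncInvSqrt ε) := by
  unfold truncInvSqrt
  refine Continuous.mul (Continuous.div continuous_const (by fun_prop) fun w => ?_) (by fun_prop)
  have : 0 < max w ε := lt_max_of_lt_right hε
  positivity

theorem truncInvSqrt_nonneg {ε : ℝ} (hε : 0 < ε) (w : ℝ) : 0 ≤ truncInvSqrt ε w := by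
  unfold truncInvSqrt; positivity

theorem truncInvSqrt_le_inv_sqrt {ε : ℝ} (hε : 0 < ε) (w : ℝ) : truncInvSqrt ε w ≤ 1 / √ε := by
  unfold truncInvSqrt
  have h1 : 1 / √(max w ε) ≤ 1 / √ε :=
    one_div_le_one_div_of_le (by positivity) (Real.sqrt_le_sqrt (le_max_right _ _))
  have h2 : min 1 (max w 0 / ε) ≤ 1 := min_le_left _ _
  calc _ ≤ 1 / √(max w ε) * 1 := mul_le_mul_of_nonneg_left h2 (by positivity)
    _ ≤ _ := by rw [mul_one]; exact h1

theorem truncInvSqrt_of_nonpos {ε w : ℝ} (hw : w ≤ 0) : truncInvSqrt ε w = 0 := by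
  simp [truncInvSqrt, max_eq_right hw]

theorem truncInvSqrt_of_le {ε w : ℝ} (hε : 0 < ε) (hw : ε ≤ w) : truncInvSqrt ε w = 1 / √w := by
  have h1 : 1 ≤ max w 0 / ε := by
    rw [le_div_iff₀ hε, one_mul]; exact hw.trans (le_max_left _ _)
  simp [truncInvSqrt, max_eq_left hw, min_eq_left h1]

theorem truncInvSqrt_le {ε w : ℝ} (hw : 0 < w) : truncInvSqrt ε w ≤ 1 / √w := by
  unfold truncInvSqrt
  have h1 : 1 / √(max w ε) ≤ 1 / √w :=
    one_div_le_one_div_of_le (by positivity) (Real.sqrt_le_sqrt (le_max_left _ _))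
  have h2 : min 1 (max w 0 / ε) ≤ 1 := min_le_left _ _
  calc _ ≤ 1 / √(max w ε) * 1 := mul_le_mul_of_nonneg_left h2 (by positivity)
    _ ≤ _ := by rw [mul_one]; exact h1

theorem integral_invSqrtTilt (κ : Measure ℝ) (ψ : ℝ → ℝ) :
    ∫ w, ψ w ∂invSqrtTilt κ = ∫ w in Set.Ioi 0, 1 / √w * ψ w ∂κ := by
  rw [invSqrtTilt, integral_withDensity_eq_integral_toReal_smul (by fun_prop) (by simp)]
  refine integral_congr_ae (ae_of_all _ fun w => ?_)
  simp only [smul_eq_mul]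
  rw [ENNReal.toReal_ofReal (by positivity)]

/-- The truncation equals the inverse square root beyond `ε` and stays between zero and it on `(0,
ε]`, so the error is carried by this interval. -/
theorem abs_integral_invSqrtTilt_sub_le {κ : Measure ℝ} [IsProbabilityMeasure κ] {C : ℝ≥0∞}
    (hC : C ≠ ∞) (hκ : κ ≤ C • volume) {ψ : ℝ → ℝ} (hψ : Continuous ψ) {B : ℝ}
    (hB : ∀ w, |ψ w| ≤ B) {ε : ℝ} (hε : 0 < ε) :
    |∫ w, ψ w ∂invSqrtTilt κ - ∫ w, truncInvSqrt ε w * ψ w ∂κ| ≤ B * (C.toReal * (2 * √ε)) := by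
  have hB0 : 0 ≤ B := (abs_nonneg _).trans (hB 0)
  have hfin := isFiniteMeasure_invSqrtTilt hC hκ
  have hint1 : IntegrableOn (fun w => 1 / √w) (Set.Ioi 0) κ := by
    refine ⟨Measurable.aestronglyMeasurable (by fun_prop), ?_⟩
    rw [hasFiniteIntegral_iff_ofReal (ae_of_all _ fun w => by positivity)]
    have := hfin.measure_univ_lt_top
    rwa [invSqrtTilt, withDensity_apply _ MeasurableSet.univ, Measure.restrict_univ] at this
  have hint2 : IntegrableOn (fun w => 1 / √w * ψ w) (Set.Ioi 0) κ :=
    hint1.mul_bdd (c := B) hψ.aestronglyMeasurable (ae_of_all _ fun w => hB w)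
  have hcont : Continuous fun w => truncInvSqrt ε w * ψ w := (continuous_truncInvSqrt hε).mul hψ
  have hint3 : Integrable (fun w => truncInvSqrt ε w * ψ w) κ := by
    refine Integrable.of_bound hcont.aestronglyMeasurable (1 / √ε * B) (ae_of_all _ fun w => ?_)
    rw [norm_mul, Real.norm_of_nonneg (truncInvSqrt_nonneg hε w)]
    exact mul_le_mul (truncInvSqrt_le_inv_sqrt hε w) (hB w) (abs_nonneg _) (by positivity)
  have h0 : ∫ w, truncInvSqrt ε w * ψ w ∂κ = ∫ w in Set.Ioi 0, truncInvSqrt ε w * ψ w ∂κ := by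
    symm
    refine setIntegral_eq_integral_of_forall_compl_eq_zero fun w hw => ?_
    rw [truncInvSqrt_of_nonpos (not_lt.1 hw), zero_mul]
  rw [integral_invSqrtTilt, h0, ← integral_sub hint2 hint3.integrableOn]
  have hint4 : IntegrableOn (fun w => (Set.Ioc 0 ε).indicator (fun w => 1 / √w * B) w)
      (Set.Ioi 0) κ := (hint1.mul_const B).indicator measurableSet_Ioc
  have h1 : |∫ w in Set.Ioi 0, (1 / √w * ψ w - truncInvSqrt ε w * ψ w) ∂κ| ≤
      ∫ w in Set.Ioi 0, (Set.Ioc 0 ε).indicator (fun w => 1 / √w * B) w ∂κ := by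
    rw [← Real.norm_eq_abs]
    refine norm_integral_le_of_norm_le hint4 ?_
    filter_upwards [ae_restrict_mem measurableSet_Ioi] with w hw
    have hw0 : 0 < w := hw
    rw [← sub_mul, norm_mul, Real.norm_of_nonneg (sub_nonneg.2 (truncInvSqrt_le hw0))]
    by_cases hwε : w ≤ ε
    · rw [Set.indicator_of_mem (Set.mem_Ioc.2 ⟨hw0, hwε⟩)]
      refine mul_le_mul ?_ (hB w) (abs_nonneg _) (by positivity)
      linarith [truncInvSqrt_nonneg hε w]
    · rw [truncInvSqrt_of_le hε (not_le.1 hwε).le, sub_self, zero_mul]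
      exact Set.indicator_nonneg (fun w _ => by positivity) _
  refine h1.trans ?_
  rw [integral_indicator measurableSet_Ioc, Measure.restrict_restrict measurableSet_Ioc,
    Set.inter_eq_left.2 Set.Ioc_subset_Ioi_self, integral_mul_const, mul_comm]
  refine mul_le_mul_of_nonneg_left ?_ hB0
  rw [integral_eq_lintegral_of_nonneg_ae (ae_of_all _ fun w => by positivity)
    (Measurable.aestronglyMeasurable (by fun_prop))]
  have h2 := ENNReal.toReal_mono (ENNReal.mul_ne_top hC ENNReal.ofReal_ne_top)
    (setLIntegral_inv_sqrt_le hκ hε)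
  rwa [ENNReal.toReal_mul, ENNReal.toReal_ofReal (by positivity)] at h2

/-- Weak convergence handles the bounded continuous truncation, and the uniform density bound
handles what the truncation removes, for the sequence and for its limit. -/
theorem tendsto_integral_invSqrtTilt {κs : ℕ → ProbabilityMeasure ℝ} {κ : ProbabilityMeasure ℝ}
    {C : ℝ≥0∞} (hC0 : C ≠ 0) (hC : C ≠ ∞) (hκ : Tendsto κs atTop (𝓝 κ))
    (h : ∀ᶠ n in atTop, (κs n : Measure ℝ) ≤ C • volume) {ψ : ℝ → ℝ} (hψ : Continuous ψ) {B : ℝ}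
    (hB : ∀ w, |ψ w| ≤ B) :
    Tendsto (fun n => ∫ w, ψ w ∂invSqrtTilt (κs n)) atTop (𝓝 (∫ w, ψ w ∂invSqrtTilt κ)) := by
  have hκC := le_smul_volume_of_tendsto hC0 hC hκ h
  have hB0 : 0 ≤ B := (abs_nonneg _).trans (hB 0)
  rw [Metric.tendsto_atTop']
  intro δ hδ
  set D : ℝ := B * (C.toReal * 2) with hD
  have hD0 : 0 ≤ D := by positivity
  -- Chosen so that each truncation error `D √ε` is at most `δ / 4`; `D + 1` avoids a division by
  -- zero. The three errors then add up to less than `δ`.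
  set ε : ℝ := (δ / (4 * (D + 1))) ^ 2 with hεdef
  have hε : 0 < ε := by positivity
  have hsε : √ε = δ / (4 * (D + 1)) := Real.sqrt_sq (by positivity)
  have hbound : B * (C.toReal * (2 * √ε)) ≤ δ / 4 := by
    rw [hsε, show B * (C.toReal * (2 * (δ / (4 * (D + 1))))) = D * (δ / (4 * (D + 1))) by
      rw [hD]; ring, mul_div_assoc', div_le_div_iff₀ (by positivity) (by positivity)]
    nlinarith
  let g : BoundedContinuousFunction ℝ ℝ := BoundedContinuousFunction.ofNormedAddCommGroup
    (fun w => truncInvSqrt ε w * ψ w) ((continuous_truncInvSqrt hε).mul hψ) (1 / √ε * B) fun w => by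
      rw [norm_mul, Real.norm_of_nonneg (truncInvSqrt_nonneg hε w)]
      exact mul_le_mul (truncInvSqrt_le_inv_sqrt hε w) (hB w) (abs_nonneg _) (by positivity)
  have hg := (ProbabilityMeasure.tendsto_iff_forall_integral_tendsto.1 hκ) g
  have hev := (Metric.tendsto_nhds.1 hg) (δ / 4) (by positivity)
  obtain ⟨N, hN⟩ := eventually_atTop.1 (hev.and h)
  refine ⟨N, fun n hn => ?_⟩
  obtain ⟨h1, h2⟩ := hN n hn.le
  have e1 := abs_integral_invSqrtTilt_sub_le hC h2 hψ hB hε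
  have e2 := abs_integral_invSqrtTilt_sub_le hC hκC hψ hB hε
  rw [Real.dist_eq] at h1 ⊢
  change |∫ w, truncInvSqrt ε w * ψ w ∂(κs n : Measure ℝ) -
    ∫ w, truncInvSqrt ε w * ψ w ∂(κ : Measure ℝ)| < δ / 4 at h1
  rw [abs_lt] at h1 ⊢
  rw [abs_le] at e1 e2
  constructor <;> linarith [e1.1, e1.2, e2.1, e2.2, h1.1, h1.2]

/-! ### Concentration of the radial part at one -/

/-- The moments of the radial part of a Gaussian vector of variance `1 / n`. -/
def radialMoment (n : ℝ) (p : ℕ) : ℝ := ∫ t in Set.Ioi 0, t ^ p * Real.exp (-n * t ^ 2 / 2)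

theorem integrableOn_pow_mul_exp {n : ℝ} (hn : 0 < n) (p : ℕ) :
    IntegrableOn (fun t : ℝ => t ^ p * Real.exp (-n * t ^ 2 / 2)) (Set.Ioi 0) := by
  have h := integrableOn_rpow_mul_exp_neg_mul_sq (b := n / 2) (by positivity) (s := p)
    (by have : (0 : ℝ) ≤ p := Nat.cast_nonneg p
        linarith)
  refine h.congr_fun (fun t _ => ?_) measurableSet_Ioi
  simp only [Real.rpow_natCast]
  congr 2
  ring

theorem radialMoment_eq {n : ℝ} (hn : 0 < n) (p : ℕ) :
    radialMoment n p = (n / 2) ^ (-((p : ℝ) + 1) / 2) * (1 / 2) * Real.Gamma (((p : ℝ) + 1) / 2) := by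
  have hp : (-1 : ℝ) < p := by
    have : (0 : ℝ) ≤ p := Nat.cast_nonneg p
    linarith
  rw [← integral_rpow_mul_exp_neg_mul_rpow two_pos hp (by positivity : 0 < n / 2), radialMoment]
  refine setIntegral_congr_fun measurableSet_Ioi fun t _ => ?_
  simp only [Real.rpow_natCast, Real.rpow_ofNat]
  congr 2
  ring

theorem radialMoment_pos {n : ℝ} (hn : 0 < n) (p : ℕ) : 0 < radialMoment n p := by
  rw [radialMoment_eq hn]
  have := Real.Gamma_pos_of_pos (by positivity : 0 < ((p : ℝ) + 1) / 2)
  positivity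

theorem radialMoment_add_two {n : ℝ} (hn : 0 < n) (p : ℕ) :
    radialMoment n (p + 2) = (p + 1) / n * radialMoment n p := by
  rw [radialMoment_eq hn, radialMoment_eq hn]
  have h1 : (((p + 2 : ℕ) : ℝ) + 1) / 2 = ((p : ℝ) + 1) / 2 + 1 := by push_cast; ring
  have h2 : -(((p + 2 : ℕ) : ℝ) + 1) / 2 = -((p : ℝ) + 1) / 2 - 1 := by push_cast; ring
  rw [h1, h2, Real.Gamma_add_one (by positivity), Real.rpow_sub_one (by positivity)]
  field_simp

/-- The radial part of the model, not normalized. -/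
def radialMeasure (m : ℕ) : Measure ℝ := (volume.restrict (Set.Ioi 0)).withDensity fun t =>
  ENNReal.ofReal (t ^ m * Real.exp (-((m + 1 : ℕ) : ℝ) * t ^ 2 / 2))

theorem radialMeasure_univ (m : ℕ) :
    radialMeasure m Set.univ = ENNReal.ofReal (radialMoment (m + 1 : ℕ) m) := by
  rw [radialMeasure, withDensity_apply _ MeasurableSet.univ, Measure.restrict_univ, radialMoment,
    ofReal_integral_eq_lintegral_ofReal (integrableOn_pow_mul_exp (by positivity) m)]
  filter_upwards [ae_restrict_mem measurableSet_Ioi] with t ht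
  have : (0 : ℝ) < t := ht
  positivity

theorem radialMeasure_univ_ne_zero (m : ℕ) : radialMeasure m Set.univ ≠ 0 := by
  rw [radialMeasure_univ, Ne, ENNReal.ofReal_eq_zero, not_le]
  exact radialMoment_pos (by positivity) m

theorem radialMeasure_univ_ne_top (m : ℕ) : radialMeasure m Set.univ ≠ ∞ := by
  rw [radialMeasure_univ]; exact ENNReal.ofReal_ne_top

/-- The law of the radial part of the model. -/
def radialLaw (m : ℕ) : Measure ℝ := (radialMeasure m Set.univ)⁻¹ • radialMeasure m

instance (m : ℕ) : IsProbabilityMeasure (radialLaw m) := by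
  constructor
  rw [radialLaw, Measure.smul_apply, smul_eq_mul]
  exact ENNReal.inv_mul_cancel (radialMeasure_univ_ne_zero m) (radialMeasure_univ_ne_top m)

theorem integral_radialLaw (m : ℕ) (g : ℝ → ℝ) : ∫ t, g t ∂radialLaw m =
    (radialMoment (m + 1 : ℕ) m)⁻¹ *
      ∫ t in Set.Ioi 0, t ^ m * Real.exp (-((m + 1 : ℕ) : ℝ) * t ^ 2 / 2) * g t := by
  rw [radialLaw, integral_smul_measure, smul_eq_mul, radialMeasure_univ, ENNReal.toReal_inv,
    ENNReal.toReal_ofReal (radialMoment_pos (by positivity) m).le, radialMeasure,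
    integral_withDensity_eq_integral_toReal_smul (by fun_prop) (by simp)]
  congr 1
  refine setIntegral_congr_fun measurableSet_Ioi fun t ht => ?_
  have ht0 : (0 : ℝ) < t := ht
  simp only [smul_eq_mul]
  rw [ENNReal.toReal_ofReal (by positivity)]

theorem integrable_radialLaw {m : ℕ} {g : ℝ → ℝ}
    (hg : IntegrableOn (fun t => t ^ m * Real.exp (-((m + 1 : ℕ) : ℝ) * t ^ 2 / 2) * g t)
      (Set.Ioi 0)) : Integrable g (radialLaw m) := by
  refine Integrable.smul_measure ?_ (ENNReal.inv_ne_top.2 (radialMeasure_univ_ne_zero m))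
  rw [radialMeasure, integrable_withDensity_iff_integrable_smul' (by fun_prop) (by simp)]
  refine hg.congr_fun (fun t ht => ?_) measurableSet_Ioi
  have ht0 : (0 : ℝ) < t := ht
  simp only [smul_eq_mul]
  rw [ENNReal.toReal_ofReal (by positivity)]

theorem integrable_abs_sub_one_radialLaw (m : ℕ) :
    Integrable (fun t => |t - 1|) (radialLaw m) := by
  refine Integrable.abs (integrable_radialLaw ?_)
  have h := (integrableOn_pow_mul_exp (n := (m + 1 : ℕ)) (by positivity) (m + 1)).sub
    (integrableOn_pow_mul_exp (n := (m + 1 : ℕ)) (by positivity) m)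
  refine h.congr_fun (fun t _ => ?_) measurableSet_Ioi
  simp only [Pi.sub_apply]
  ring

/-- For `t > 0`, `|t - 1| ≤ |t² - 1| ≤ (√n / 2) (t² - 1)² + 1 / (2 √n)`. The moment recursion gives
mean `1` for `t²` and `1 + 2 / n` for `t⁴`, so `(t² - 1)²` has mean `2 / n`. -/
theorem integral_abs_sub_one_radialLaw_le (m : ℕ) :
    ∫ t, |t - 1| ∂radialLaw m ≤ 3 / (2 * √(m + 1 : ℕ)) := by
  set n : ℝ := ((m + 1 : ℕ) : ℝ) with hn
  have hn0 : 0 < n := by rw [hn]; positivity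
  have hsn : 0 < √n := Real.sqrt_pos.2 hn0
  have hJ := radialMoment_pos hn0 m
  have i0 := integrableOn_pow_mul_exp hn0 m
  have i2 := integrableOn_pow_mul_exp hn0 (m + 2)
  have i4 := integrableOn_pow_mul_exp hn0 (m + 4)
  rw [integral_radialLaw, ← hn, inv_mul_le_iff₀ hJ]
  have h1 : ∫ t in Set.Ioi 0, t ^ m * Real.exp (-n * t ^ 2 / 2) * |t - 1| ≤
      ∫ t in Set.Ioi 0, (√n / 2 * (t ^ (m + 4) * Real.exp (-n * t ^ 2 / 2)) -
        √n * (t ^ (m + 2) * Real.exp (-n * t ^ 2 / 2)) +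
        (√n / 2 + 1 / (2 * √n)) * (t ^ m * Real.exp (-n * t ^ 2 / 2))) := by
    refine setIntegral_mono_on ?_ (((i4.const_mul _).sub (i2.const_mul _)).add (i0.const_mul _))
      measurableSet_Ioi fun t ht => ?_
    · have h := ((integrableOn_pow_mul_exp hn0 (m + 1)).sub i0).abs
      refine IntegrableOn.congr_fun h (fun t ht => ?_) measurableSet_Ioi
      have ht0 : (0 : ℝ) < t := ht
      simp only [Pi.sub_apply]
      rw [pow_succ, show t ^ m * t * Real.exp (-n * t ^ 2 / 2) - t ^ m * Real.exp (-n * t ^ 2 / 2) =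
        t ^ m * Real.exp (-n * t ^ 2 / 2) * (t - 1) by ring, abs_mul, abs_of_nonneg (by positivity)]
    · have ht0 : (0 : ℝ) < t := ht
      have hkey : |t - 1| ≤ √n / 2 * (t ^ 2 - 1) ^ 2 + 1 / (2 * √n) := by
        have ha : |t - 1| ≤ |t ^ 2 - 1| := by
          rw [show t ^ 2 - 1 = (t - 1) * (t + 1) by ring, abs_mul, abs_of_pos (by linarith : 0 < t + 1)]
          nlinarith [abs_nonneg (t - 1)]
        refine ha.trans ?_
        rw [← sq_abs (t ^ 2 - 1)]
        set b := |t ^ 2 - 1|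
        have : 0 ≤ (√n * b - 1) ^ 2 / (2 * √n) := by positivity
        have e : (√n * b - 1) ^ 2 / (2 * √n) = √n / 2 * b ^ 2 + 1 / (2 * √n) - b := by
          field_simp
          ring
        linarith
      calc t ^ m * Real.exp (-n * t ^ 2 / 2) * |t - 1|
          ≤ t ^ m * Real.exp (-n * t ^ 2 / 2) * (√n / 2 * (t ^ 2 - 1) ^ 2 + 1 / (2 * √n)) :=
            mul_le_mul_of_nonneg_left hkey (by positivity)
        _ = _ := by ring
  refine h1.trans_eq ?_
  refine (integral_add ((i4.const_mul _).sub (i2.const_mul _)) (i0.const_mul _)).trans ?_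
  simp only [Pi.sub_apply]
  rw [integral_sub (i4.const_mul _) (i2.const_mul _), integral_const_mul, integral_const_mul,
    integral_const_mul]
  change √n / 2 * radialMoment n (m + 2 + 2) - √n * radialMoment n (m + 2) +
    (√n / 2 + 1 / (2 * √n)) * radialMoment n m = _
  rw [radialMoment_add_two hn0, radialMoment_add_two hn0]
  have hm1 : (m : ℝ) + 1 = n := by rw [hn]; push_cast; ring
  have hm3 : ((m + 2 : ℕ) : ℝ) + 1 = n + 2 := by rw [hn]; push_cast; ring
  rw [hm1, hm3, div_self hn0.ne']
  have hsq : √n ^ 2 = n := Real.sq_sqrt hn0.le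
  have : √n / 2 * ((n + 2) / n * (1 * radialMoment n m)) = √n / 2 * radialMoment n m +
      1 / √n * radialMoment n m := by
    rw [show (n + 2) / n = 1 + 2 / √n ^ 2 by rw [hsq]; field_simp]
    field_simp
  rw [this]
  field_simp
  ring

/-! ### The symmetric law of `± t √w` and its limit -/

/-- The symmetric law of `± t √w` with `t` and `w` independent, `η` being normalized. -/
def scaledSqrtLaw (ρ η : Measure ℝ) : Measure ℝ := (2 * η Set.univ)⁻¹ •
  ((ρ.prod η).map (fun p => p.1 * √p.2) + (ρ.prod η).map fun p => -(p.1 * √p.2))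

theorem integral_scaledSqrtLaw (ρ η : Measure ℝ) [IsProbabilityMeasure ρ] [IsFiniteMeasure η]
    {φ : ℝ → ℝ} (hφ : Continuous φ) {B : ℝ} (hB : ∀ x, |φ x| ≤ B) :
    ∫ x, φ x ∂scaledSqrtLaw ρ η = (2 * η.real Set.univ)⁻¹ *
      ∫ p, (φ (p.1 * √p.2) + φ (-(p.1 * √p.2))) ∂ρ.prod η := by
  have hint : ∀ (μ : Measure ℝ) [IsFiniteMeasure μ], Integrable φ μ := fun μ _ =>
    Integrable.of_bound hφ.aestronglyMeasurable B (ae_of_all _ hB)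
  have hc1 : Continuous fun p : ℝ × ℝ => φ (p.1 * √p.2) := by fun_prop
  have hc2 : Continuous fun p : ℝ × ℝ => φ (-(p.1 * √p.2)) := by fun_prop
  rw [scaledSqrtLaw, integral_smul_measure, integral_add_measure (hint _) (hint _),
    integral_map (by fun_prop) hφ.aestronglyMeasurable,
    integral_map (by fun_prop) hφ.aestronglyMeasurable, integral_add, smul_eq_mul]
  · simp [Measure.real]
  · exact Integrable.of_bound hc1.aestronglyMeasurable B (ae_of_all _ fun p => hB _)
  · exact Integrable.of_bound hc2.aestronglyMeasurable B (ae_of_all _ fun p => hB _)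

/-- The Lipschitz bound is `L |t - 1| √w`. The factor `√w` cancels the tilt, so its integral is the
`κ`-mass of the positive half-line, at most one. -/
theorem abs_integral_scale_sub_le {ρ κ : Measure ℝ} [IsProbabilityMeasure ρ]
    [IsProbabilityMeasure κ] {C : ℝ≥0∞} (hC : C ≠ ∞) (hκ : κ ≤ C • volume)
    (hρ : Integrable (fun t => |t - 1|) ρ)
    {φ : ℝ → ℝ} {L : NNReal} (hφ : LipschitzWith L φ) {B : ℝ} (hB : ∀ x, |φ x| ≤ B) :
    |∫ p, φ (p.1 * √p.2) ∂ρ.prod (invSqrtTilt κ) - ∫ w, φ (√w) ∂invSqrtTilt κ| ≤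
      L * ∫ t, |t - 1| ∂ρ := by
  have hfin := isFiniteMeasure_invSqrtTilt hC hκ
  have hc := hφ.continuous
  have hc1 : Continuous fun p : ℝ × ℝ => φ (p.1 * √p.2) := by fun_prop
  have hc2 : Continuous fun p : ℝ × ℝ => φ (√p.2) := by fun_prop
  have e1 : ∫ w, φ (√w) ∂invSqrtTilt κ = ∫ p, φ (√p.2) ∂ρ.prod (invSqrtTilt κ) := by
    rw [integral_fun_snd (fun w => φ (√w))]
    simp
  have hsqrt : Integrable (fun w => √w) (invSqrtTilt κ) ∧ ∫ w, √w ∂invSqrtTilt κ ≤ 1 := by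
    have heq : Set.EqOn (fun w : ℝ => (ENNReal.ofReal (1 / √w)).toReal • √w) (fun _ => 1)
        (Set.Ioi 0) := by
      intro w hw
      have hw0 : 0 < √w := Real.sqrt_pos.2 hw
      simp only [smul_eq_mul]
      rw [ENNReal.toReal_ofReal (by positivity)]
      field_simp
    constructor
    · rw [invSqrtTilt, integrable_withDensity_iff_integrable_smul' (by fun_prop) (by simp)]
      exact IntegrableOn.congr_fun (f := fun _ => (1 : ℝ)) (by simp) heq.symm measurableSet_Ioi
    · rw [invSqrtTilt, integral_withDensity_eq_integral_toReal_smul (by fun_prop) (by simp),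
        setIntegral_congr_fun measurableSet_Ioi heq]
      simp only [integral_const, smul_eq_mul, mul_one]
      simp [measureReal_le_one]
  have hprod : Integrable (fun p : ℝ × ℝ => |p.1 - 1| * √p.2) (ρ.prod (invSqrtTilt κ)) :=
    hρ.mul_prod hsqrt.1
  rw [e1, ← integral_sub]
  rotate_left
  · exact Integrable.of_bound hc1.aestronglyMeasurable B (ae_of_all _ fun p => hB _)
  · exact Integrable.of_bound hc2.aestronglyMeasurable B (ae_of_all _ fun p => hB _)
  rw [← Real.norm_eq_abs]
  refine (norm_integral_le_of_norm_le (hprod.const_mul L) (ae_of_all _ fun p => ?_)).trans ?_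
  · have h := hφ.dist_le_mul (p.1 * √p.2) (√p.2)
    rw [Real.dist_eq, Real.dist_eq, show p.1 * √p.2 - √p.2 = (p.1 - 1) * √p.2 by ring, abs_mul,
      abs_of_nonneg (Real.sqrt_nonneg p.2)] at h
    exact h
  · rw [integral_const_mul, integral_prod_mul (fun t => |t - 1|) fun w => √w]
    refine mul_le_mul_of_nonneg_left ?_ L.2
    exact mul_le_of_le_one_right (integral_nonneg fun t => abs_nonneg _) hsqrt.2

/-- Bounded Lipschitz test functions suffice. For them `t` may be replaced by `1` at a cost that
tends to zero, and the tilted integrals converge. The normalization also converges because the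
limiting tilted mass is not zero. -/
theorem tendsto_scaledSqrtLaw {κs : ℕ → ProbabilityMeasure ℝ} {κ : ProbabilityMeasure ℝ}
    {C : ℝ≥0∞} (hC0 : C ≠ 0) (hC : C ≠ ∞) (hκ : Tendsto κs atTop (𝓝 κ))
    (h : ∀ᶠ n in atTop, (κs n : Measure ℝ) ≤ C • volume)
    (hpos : invSqrtTilt κ Set.univ ≠ 0)
    {ρ : ℕ → Measure ℝ} [∀ n, IsProbabilityMeasure (ρ n)]
    (hρ : ∀ n, Integrable (fun t => |t - 1|) (ρ n))
    (hρ0 : Tendsto (fun n => ∫ t, |t - 1| ∂ρ n) atTop (𝓝 0))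
    {μs : ℕ → ProbabilityMeasure ℝ} {μ : ProbabilityMeasure ℝ}
    (hμs : ∀ᶠ n in atTop, (μs n : Measure ℝ) = scaledSqrtLaw (ρ n) (invSqrtTilt (κs n)))
    (hμ : (μ : Measure ℝ) = scaledSqrtLaw (Measure.dirac 1) (invSqrtTilt κ)) :
    Tendsto μs atTop (𝓝 μ) := by
  rw [tendsto_iff_forall_lipschitz_integral_tendsto]
  rintro φ ⟨M, hM⟩ ⟨L, hL⟩
  have hκC := le_smul_volume_of_tendsto hC0 hC hκ h
  have hfinκ := isFiniteMeasure_invSqrtTilt hC hκC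
  have hφ := hL.continuous
  set B := M + |φ 0| with hBdef
  have hB : ∀ x, |φ x| ≤ B := by
    intro x
    have := hM x 0
    rw [Real.dist_eq] at this
    have h2 := abs_sub_abs_le_abs_sub (φ x) (φ 0)
    linarith
  have hnL : LipschitzWith L fun x => φ (-x) := by
    intro x y
    simpa using hL (-x) (-y)
  have hmass : Tendsto (fun n => (2 * (invSqrtTilt (κs n)).real Set.univ)⁻¹) atTop
      (𝓝 (2 * (invSqrtTilt κ).real Set.univ)⁻¹) := by
    have h1 := tendsto_integral_invSqrtTilt hC0 hC hκ h (continuous_const (y := (1 : ℝ))) (B := 1)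
      (by simp)
    simp only [integral_const, smul_eq_mul, mul_one] at h1
    refine (h1.const_mul 2).inv₀ ?_
    have : (invSqrtTilt κ).real Set.univ ≠ 0 := by
      rw [Measure.real, ENNReal.toReal_ne_zero]
      exact ⟨hpos, measure_ne_top _ _⟩
    positivity
  have hmain : ∀ ψ : ℝ → ℝ, LipschitzWith L ψ → (∀ x, |ψ x| ≤ B) →
      Tendsto (fun n => ∫ p, ψ (p.1 * √p.2) ∂(ρ n).prod (invSqrtTilt (κs n))) atTop
        (𝓝 (∫ w, ψ (√w) ∂invSqrtTilt κ)) := by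
    intro ψ hψL hψB
    have h1 := tendsto_integral_invSqrtTilt hC0 hC hκ h (ψ := fun w => ψ (√w))
      (by have := hψL.continuous; fun_prop) (fun w => hψB _)
    have h2 : Tendsto (fun n => ∫ p, ψ (p.1 * √p.2) ∂(ρ n).prod (invSqrtTilt (κs n)) -
        ∫ w, ψ (√w) ∂invSqrtTilt (κs n)) atTop (𝓝 0) := by
      refine squeeze_zero_norm' ?_ (by simpa using hρ0.const_mul (L : ℝ))
      filter_upwards [h] with n hn
      exact abs_integral_scale_sub_le hC hn (hρ n) hψL hψB
    simpa using h2.add h1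
  have hsum : ∀ (ρ' η : Measure ℝ) [IsProbabilityMeasure ρ'] [IsFiniteMeasure η],
      ∫ p, (φ (p.1 * √p.2) + φ (-(p.1 * √p.2))) ∂ρ'.prod η =
      ∫ p, φ (p.1 * √p.2) ∂ρ'.prod η + ∫ p, φ (-(p.1 * √p.2)) ∂ρ'.prod η := by
    intro ρ' η _ _
    have hc1 : Continuous fun p : ℝ × ℝ => φ (p.1 * √p.2) := by fun_prop
    have hc2 : Continuous fun p : ℝ × ℝ => φ (-(p.1 * √p.2)) := by fun_prop
    exact integral_add
      (Integrable.of_bound hc1.aestronglyMeasurable B (ae_of_all _ fun p => hB _))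
      (Integrable.of_bound hc2.aestronglyMeasurable B (ae_of_all _ fun p => hB _))
  have hlim : ∫ x, φ x ∂(μ : Measure ℝ) = (2 * (invSqrtTilt κ).real Set.univ)⁻¹ *
      (∫ w, φ (√w) ∂invSqrtTilt κ + ∫ w, φ (-√w) ∂invSqrtTilt κ) := by
    rw [hμ, integral_scaledSqrtLaw _ _ hφ hB, hsum, Measure.dirac_prod,
      integral_map (by fun_prop)
        (Continuous.aestronglyMeasurable (by fun_prop)), integral_map (by fun_prop)
        (Continuous.aestronglyMeasurable (by fun_prop))]
    simp only [one_mul]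
  rw [hlim]
  refine (hmass.mul ((hmain φ hL hB).add (hmain (fun x => φ (-x)) hnL fun x => hB _))).congr' ?_
  filter_upwards [h, hμs] with n hn hμn
  have hfin := isFiniteMeasure_invSqrtTilt hC hn
  rw [hμn, integral_scaledSqrtLaw _ _ hφ hB, hsum]

theorem lintegral_invSqrtTilt (κ : Measure ℝ) {H : ℝ → ℝ≥0∞} (hH : Measurable H) :
    ∫⁻ w, H w ∂invSqrtTilt κ = ∫⁻ w in Set.Ioi 0, ENNReal.ofReal (1 / √w) * H w ∂κ := by
  rw [invSqrtTilt, lintegral_withDensity_eq_lintegral_mul _ (by fun_prop) hH]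
  rfl

/-- On each half-line `|t| = √w` gives `dt = dw / (2 √w)`: the inverse square root tilt is exactly
the Jacobian that turns the density `f` into `f (t²)`. -/
theorem lintegral_comp_sq_mul {f : ℝ → ℝ} (hf : Measurable f) {κ : Measure ℝ}
    (hκ : κ = volume.withDensity fun x => ENNReal.ofReal (f x)) {G : ℝ → ℝ≥0∞} (hG : Measurable G) :
    ∫⁻ t, ENNReal.ofReal (f (t ^ 2)) * G t =
      2⁻¹ * ∫⁻ w, (G (√w) + G (-√w)) ∂invSqrtTilt κ := by
  have hf' : Measurable fun t => ENNReal.ofReal (f (t ^ 2)) := (hf.comp (by fun_prop)).ennreal_ofReal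
  have hG1 : Measurable fun w => G (√w) := hG.comp (by fun_prop)
  have hG2 : Measurable fun w => G (-√w) := hG.comp (by fun_prop)
  refine (lintegral_eq_lintegral_Ioi_add _ (hf'.mul hG)).trans ?_
  have himg : (fun w => √w) '' Set.Ioi 0 = Set.Ioi 0 := by
    ext y
    constructor
    · rintro ⟨w, hw, rfl⟩; exact Real.sqrt_pos.2 hw
    · intro hy
      exact ⟨y ^ 2, pow_pos (Set.mem_Ioi.1 hy) 2, Real.sqrt_sq (le_of_lt hy)⟩
  have hinj : Set.InjOn (fun w => √w) (Set.Ioi 0) := fun a ha b hb h =>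
    (Real.sqrt_inj (le_of_lt ha) (le_of_lt hb)).1 h
  have hder : ∀ w ∈ Set.Ioi (0 : ℝ), HasDerivWithinAt (fun w => √w) (1 / (2 * √w)) (Set.Ioi 0) w :=
    fun w hw => (Real.hasDerivAt_sqrt (ne_of_gt hw)).hasDerivWithinAt
  conv_lhs => rw [← himg]
  have hH : Measurable fun w => ENNReal.ofReal (1 / √w) * (G (√w) + G (-√w)) :=
    Measurable.mul (by fun_prop) (hG1.add hG2)
  rw [lintegral_image_eq_lintegral_abs_deriv_mul measurableSet_Ioi hder hinj,
    lintegral_invSqrtTilt κ (H := fun w => G (√w) + G (-√w)) (hG1.add hG2), hκ,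
    setLIntegral_withDensity_eq_setLIntegral_mul _ hf.ennreal_ofReal hH measurableSet_Ioi,
    ← lintegral_const_mul' _ _ (by simp)]
  refine setLIntegral_congr_fun measurableSet_Ioi fun w hw => ?_
  have hw0 : (0 : ℝ) < w := hw
  have hs0 : 0 < √w := Real.sqrt_pos.2 hw0
  simp only [Pi.mul_apply, neg_sq, Real.sq_sqrt hw0.le]
  rw [abs_of_pos (by positivity)]
  have e : ENNReal.ofReal (1 / (2 * √w)) = 2⁻¹ * ENNReal.ofReal (1 / √w) := by
    rw [show (2 : ℝ≥0∞)⁻¹ = ENNReal.ofReal (2⁻¹) by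
      rw [ENNReal.ofReal_inv_of_pos two_pos]; simp, ← ENNReal.ofReal_mul (by positivity)]
    congr 1
    field_simp
  rw [e]
  ring

theorem lintegral_comp_sq {f : ℝ → ℝ} (hf : Measurable f) {κ : Measure ℝ}
    (hκ : κ = volume.withDensity fun x => ENNReal.ofReal (f x)) :
    ∫⁻ t, ENNReal.ofReal (f (t ^ 2)) = invSqrtTilt κ Set.univ := by
  have h := lintegral_comp_sq_mul hf hκ (G := fun _ => 1) measurable_const
  simp only [mul_one, lintegral_const] at h
  rw [h, one_add_one_eq_two, ← mul_assoc, ENNReal.inv_mul_cancel (by simp) (by simp), one_mul]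

theorem squareLaw_eq {f : ℝ → ℝ} (hf : Measurable f) {κ : Measure ℝ} [IsFiniteMeasure (invSqrtTilt κ)]
    (hκ : κ = volume.withDensity fun x => ENNReal.ofReal (f x)) :
    squareLaw f = scaledSqrtLaw (Measure.dirac 1) (invSqrtTilt κ) := by
  ext s hs
  have h := lintegral_comp_sq_mul hf hκ (G := s.indicator 1) (measurable_one.indicator hs)
  have h1 : ∫⁻ t in s, ENNReal.ofReal (f (t ^ 2)) =
      ∫⁻ t, ENNReal.ofReal (f (t ^ 2)) * s.indicator 1 t := by
    rw [← lintegral_indicator hs]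
    refine lintegral_congr fun t => ?_
    by_cases ht : t ∈ s <;> simp [ht]
  rw [squareLaw, scaledSqrtLaw, Measure.smul_apply, Measure.smul_apply, withDensity_apply _ hs, h1, h,
    lintegral_comp_sq hf hκ, Measure.add_apply, Measure.map_apply (by fun_prop) hs,
    Measure.map_apply (by fun_prop) hs, Measure.dirac_prod,
    Measure.map_apply (by fun_prop) (by exact (by fun_prop : Measurable fun p : ℝ × ℝ => p.1 * √p.2) hs),
    Measure.map_apply (by fun_prop) (by exact (by fun_prop : Measurable fun p : ℝ × ℝ => -(p.1 * √p.2)) hs),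
    lintegral_add_left (f := fun w => s.indicator 1 (√w)) ((measurable_one.indicator hs).comp
      (g := s.indicator (1 : ℝ → ℝ≥0∞)) (by fun_prop : Measurable fun w : ℝ => √w)),
    smul_eq_mul, smul_eq_mul, ENNReal.mul_inv (by simp) (by simp)]
  have e1 : ∫⁻ w, s.indicator 1 (√w) ∂invSqrtTilt κ = invSqrtTilt κ ((fun w => √w) ⁻¹' s) := by
    rw [← lintegral_indicator_one ((by fun_prop : Measurable fun w : ℝ => √w) hs)]
    rfl
  have e2 : ∫⁻ w, s.indicator 1 (-√w) ∂invSqrtTilt κ = invSqrtTilt κ ((fun w => -√w) ⁻¹' s) := by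
    rw [← lintegral_indicator_one ((by fun_prop : Measurable fun w : ℝ => -√w) hs)]
    rfl
  rw [e1, e2]
  have e3 : (fun y : ℝ => ((1 : ℝ), y)) ⁻¹' ((fun p : ℝ × ℝ => p.1 * √p.2) ⁻¹' s) =
      (fun w => √w) ⁻¹' s := by ext w; simp
  have e4 : (fun y : ℝ => ((1 : ℝ), y)) ⁻¹' ((fun p : ℝ × ℝ => -(p.1 * √p.2)) ⁻¹' s) =
      (fun w => -√w) ⁻¹' s := by ext w; simp
  rw [e3, e4]
  ring

/-! ### The rescaled magnetization as a scaled square root -/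

instance (κ : Measure ℝ) [SFinite κ] : SFinite (invSqrtTilt κ) := by
  unfold invSqrtTilt; infer_instance

/-- The centered and normalized energy of a Gaussian vector with variances `v`. -/
def energyLaw (m : ℕ) (v : Fin m → NNReal) : Measure ℝ :=
  (Measure.pi fun i => gaussianReal 0 (v i)).map
    fun z => ((m + 1 : ℕ) - ∑ i, z i ^ 2) / √(m + 1 : ℕ)

instance (m : ℕ) (v : Fin m → NNReal) : IsProbabilityMeasure (energyLaw m v) :=
  Measure.isProbabilityMeasure_map (Measurable.aemeasurable (by fun_prop))

theorem rpow_three_fourths {x : ℝ} (hx : 0 ≤ x) : x ^ (3 / 4 : ℝ) = √x * √(√x) := by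
  rw [Real.sqrt_eq_rpow, Real.sqrt_eq_rpow, ← Real.rpow_mul hx,
    ← Real.rpow_add_of_nonneg hx (by norm_num) (by norm_num)]
  norm_num

/-- With `w = (n - |z|²) / √n`, the magnetization `± √n t √(n - |z|²)` divided by `n^{3/4}` is `± t
√w`, and the Jacobian is a constant times `1 / √w`. It is enough to identify the law up to a
constant, since the left side has mass one. -/
theorem map_model_eq_scaledSqrtLaw (m r : ℕ) (v : Fin m → NNReal) (hv0 : ∀ i, v i ≠ 0)
    (hv : ∀ i : Fin m, 1 / (v i : ℝ) = 1 - eigenvalue (m + 1) r ((i.succ : Fin (m + 1)) : ℕ))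
    (hr : 0 < r) :
    (model (m + 1) r).map
        (fun x => magnetization (m + 1) x / ((m + 1 : ℕ) : ℝ) ^ (3 / 4 : ℝ)) =
      scaledSqrtLaw (radialLaw m) (invSqrtTilt (energyLaw m v)) := by
  obtain ⟨C, hC0, hC, hCG⟩ := exists_lintegral_weight_mul m r v hv0 hv hr
  set n : ℕ := m + 1 with hn
  have hn0 : (0 : ℝ) < (n : ℝ) := by rw [hn]; positivity
  set η := invSqrtTilt (energyLaw m v) with hη
  set ρ := radialLaw m with hρ
  have hX : Measurable fun x : Fin n → ℝ => magnetization n x / (n : ℝ) ^ (3 / 4 : ℝ) := by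
    unfold magnetization; fun_prop
  have hm1 : Measurable fun p : ℝ × ℝ => p.1 * √p.2 := by fun_prop
  have hm2 : Measurable fun p : ℝ × ℝ => -(p.1 * √p.2) := by fun_prop
  set ν := (ρ.prod η).map (fun p => p.1 * √p.2) + (ρ.prod η).map fun p => -(p.1 * √p.2) with hν
  have hkey : (model n r).map (fun x => magnetization n x / (n : ℝ) ^ (3 / 4 : ℝ)) =
      ((partitionFunction n r)⁻¹ * (C * (radialMeasure m Set.univ *
        ENNReal.ofReal (1 / √(√(n : ℝ)))))) • ν := by
    ext s hs
    have hsm : Measurable (s.indicator (1 : ℝ → ℝ≥0∞)) := measurable_one.indicator hs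
    let K : ℝ → ℝ≥0∞ := fun t => ∫⁻ w, (s.indicator 1 (t * √w) + s.indicator 1 (-(t * √w))) ∂η
    have hK2 : Measurable fun p : ℝ × ℝ =>
        s.indicator (1 : ℝ → ℝ≥0∞) (p.1 * √p.2) + s.indicator (1 : ℝ → ℝ≥0∞) (-(p.1 * √p.2)) :=
      (hsm.comp hm1).add (hsm.comp hm2)
    have hKm : Measurable K := hK2.lintegral_prod_right'
    have hνs : ν s = ∫⁻ t, K t ∂ρ := by
      simp only [K]
      rw [← lintegral_prod _ hK2.aemeasurable, lintegral_add_left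
        (f := fun p : ℝ × ℝ => s.indicator (1 : ℝ → ℝ≥0∞) (p.1 * √p.2)) (hsm.comp hm1), hν,
        Measure.add_apply, Measure.map_apply hm1 hs, Measure.map_apply hm2 hs,
        ← lintegral_indicator_one (hm1 hs), ← lintegral_indicator_one (hm2 hs)]
      rfl
    have hρK : radialMeasure m Set.univ * ∫⁻ t, K t ∂ρ =
        ∫⁻ t in Set.Ioi 0, ENNReal.ofReal (t ^ m * Real.exp (-(n : ℝ) * t ^ 2 / 2)) * K t := by
      rw [hρ, radialLaw, lintegral_smul_measure, smul_eq_mul, ← mul_assoc,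
        ENNReal.mul_inv_cancel (radialMeasure_univ_ne_zero m) (radialMeasure_univ_ne_top m), one_mul,
        radialMeasure, lintegral_withDensity_eq_lintegral_mul _ (by fun_prop) hKm]
      rfl
    have hG := hCG (fun u => s.indicator 1 (u / (n : ℝ) ^ (3 / 4 : ℝ))) (hsm.comp (by fun_prop))
    have hleft : (model n r).map (fun x => magnetization n x / (n : ℝ) ^ (3 / 4 : ℝ)) s =
        (partitionFunction n r)⁻¹ * ∫⁻ x, weight n r x *
          s.indicator 1 (magnetization n x / (n : ℝ) ^ (3 / 4 : ℝ)) ∂gaussianSpins n := by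
      rw [Measure.map_apply hX hs, model, Measure.smul_apply, withDensity_apply _ (hX hs),
        smul_eq_mul, ← lintegral_indicator (hX hs)]
      congr 1
      refine lintegral_congr fun x => ?_
      by_cases hx : magnetization n x / (n : ℝ) ^ (3 / 4 : ℝ) ∈ s
      · rw [Set.indicator_of_mem hx, Set.indicator_of_mem (by exact hx), Pi.one_apply, mul_one]
      · rw [Set.indicator_of_notMem hx, Set.indicator_of_notMem (by exact hx), mul_zero]
    rw [hleft, hG, Measure.smul_apply, smul_eq_mul, hνs]
    have hinner : ∀ t : ℝ, ∫⁻ z in {z : Fin m → ℝ | ∑ i, z i ^ 2 < n},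
        ENNReal.ofReal (1 / √(n - ∑ i, z i ^ 2)) *
          (s.indicator 1 (√n * (t * √(n - ∑ i, z i ^ 2)) / (n : ℝ) ^ (3 / 4 : ℝ)) +
            s.indicator 1 (-(√n * (t * √(n - ∑ i, z i ^ 2))) / (n : ℝ) ^ (3 / 4 : ℝ)))
          ∂(Measure.pi fun i => gaussianReal 0 (v i)) = ENNReal.ofReal (1 / √(√(n : ℝ))) * K t := by
      intro t
      have hH : Measurable fun w : ℝ => s.indicator (1 : ℝ → ℝ≥0∞) (t * √w) +
          s.indicator (1 : ℝ → ℝ≥0∞) (-(t * √w)) :=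
        (hsm.comp (by fun_prop)).add (hsm.comp (by fun_prop))
      have hH' : Measurable fun w : ℝ => ENNReal.ofReal (1 / √w) *
          (s.indicator (1 : ℝ → ℝ≥0∞) (t * √w) + s.indicator (1 : ℝ → ℝ≥0∞) (-(t * √w))) :=
        Measurable.mul (by fun_prop) hH
      have hW : Measurable fun z : Fin m → ℝ => ((n : ℝ) - ∑ i, z i ^ 2) / √(n : ℝ) := by fun_prop
      have hsn : 0 < √(n : ℝ) := Real.sqrt_pos.2 hn0
      have hpre : (fun z : Fin m → ℝ => ((n : ℝ) - ∑ i, z i ^ 2) / √(n : ℝ)) ⁻¹' Set.Ioi 0 =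
          {z : Fin m → ℝ | ∑ i, z i ^ 2 < n} := by
        ext z
        simp only [Set.mem_preimage, Set.mem_Ioi, Set.mem_ofPred_eq]
        rw [div_pos_iff_of_pos_right hsn, sub_pos]
      simp only [K]
      rw [hη, lintegral_invSqrtTilt _ hH, energyLaw, setLIntegral_map measurableSet_Ioi hH' hW, ← lintegral_const_mul' _ _ ENNReal.ofReal_ne_top, hpre]
      have hsetz : MeasurableSet {z : Fin m → ℝ | ∑ i, z i ^ 2 < n} :=
        measurableSet_lt (by fun_prop) measurable_const
      refine setLIntegral_congr_fun hsetz fun z hz => ?_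
      have hz' : ∑ i, z i ^ 2 < n := hz
      have hssn : 0 < √(√(n : ℝ)) := Real.sqrt_pos.2 hsn
      have e1 : √((n - ∑ i, z i ^ 2) / √(n : ℝ)) = √(n - ∑ i, z i ^ 2) / √(√(n : ℝ)) :=
        Real.sqrt_div (by linarith) _
      have e2 : √n * (t * √(n - ∑ i, z i ^ 2)) / (n : ℝ) ^ (3 / 4 : ℝ) =
          t * (√(n - ∑ i, z i ^ 2) / √(√(n : ℝ))) := by
        rw [rpow_three_fourths hn0.le]
        field_simp
      simp only [neg_div]
      rw [e1, e2, ← mul_assoc, ← ENNReal.ofReal_mul (by positivity)]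
      congr 2
      field_simp
    rw [lintegral_congr fun t => by rw [hinner t]]
    have e : ∀ t, ENNReal.ofReal (t ^ m * Real.exp (-(n : ℝ) * t ^ 2 / 2)) *
        (ENNReal.ofReal (1 / √(√(n : ℝ))) * K t) = ENNReal.ofReal (1 / √(√(n : ℝ))) *
        (ENNReal.ofReal (t ^ m * Real.exp (-(n : ℝ) * t ^ 2 / 2)) * K t) := fun t => by ring
    rw [lintegral_congr e]
    rw [lintegral_const_mul' _ _ ENNReal.ofReal_ne_top, ← hρK]
    ring
  have hνu : ν Set.univ = 2 * η Set.univ := by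
    rw [hν, Measure.add_apply, Measure.map_apply hm1 MeasurableSet.univ,
      Measure.map_apply hm2 MeasurableSet.univ, Set.preimage_univ, Set.preimage_univ,
      ← Set.univ_prod_univ, Measure.prod_prod, measure_univ, one_mul, two_mul]
  have hprob : IsProbabilityMeasure
      ((model n r).map (fun x => magnetization n x / (n : ℝ) ^ (3 / 4 : ℝ))) :=
    Measure.isProbabilityMeasure_map hX.aemeasurable
  have h1 := hprob.measure_univ
  rw [hkey, Measure.smul_apply, smul_eq_mul, hνu] at h1
  -- Total mass one forces the proportionality constant to be the inverse of `2 * η Set.univ`,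
  -- without computing `C` or the partition function.
  rw [hkey, scaledSqrtLaw, ← hν, ENNReal.eq_inv_of_mul_eq_one_left h1]

/-! ### Bounds and asymptotics of the eigenvalues -/

theorem eigenvalue_sub_natCast (n r : ℕ) [NeZero n] (k : ℤ) :
    eigenvalue n r (k - n) = eigenvalue n r k := by
  have hn : (n : ℝ) ≠ 0 := Nat.cast_ne_zero.2 (NeZero.ne n)
  unfold eigenvalue
  congr 1
  refine Finset.sum_congr rfl fun j _ => ?_
  rw [← Real.cos_add_nat_mul_two_pi _ j]
  congr 1
  push_cast
  field_simp
  ring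

theorem one_sub_eigenvalue {r : ℕ} (hr : 0 < r) (n : ℕ) (k : ℤ) :
    1 - eigenvalue n r k =
      1 / r * ∑ j ∈ Finset.Icc 1 r, (1 - Real.cos (2 * Real.pi * k * j / n)) := by
  have : (r : ℝ) ≠ 0 := by positivity
  rw [Finset.sum_sub_distrib, eigenvalue, mul_sub]
  simp [this]

theorem abs_eigenvalue_le_one {r : ℕ} (hr : 0 < r) (n : ℕ) (k : ℤ) : |eigenvalue n r k| ≤ 1 := by
  have hr' : (0 : ℝ) < r := by positivity
  rw [eigenvalue, abs_mul, abs_of_pos (by positivity)]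
  have h : |∑ j ∈ Finset.Icc 1 r, Real.cos (2 * Real.pi * k * j / n)| ≤ r := by
    refine (Finset.abs_sum_le_sum_abs _ _).trans ?_
    refine (Finset.sum_le_sum fun j _ => Real.abs_cos_le_one _).trans ?_
    simp
  calc 1 / (r : ℝ) * _ ≤ 1 / r * r := mul_le_mul_of_nonneg_left h (by positivity)
    _ = 1 := by field_simp

theorem eigenvalue_lt_one {n r : ℕ} [NeZero n] (hr : 0 < r) {k : ℤ} (hk : ¬(n : ℤ) ∣ k) :
    eigenvalue n r k < 1 := by
  have hn : (n : ℝ) ≠ 0 := Nat.cast_ne_zero.2 (NeZero.ne n)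
  rw [← sub_pos, one_sub_eigenvalue hr]
  have hr' : (0 : ℝ) < r := by positivity
  refine mul_pos (by positivity) (Finset.sum_pos' (fun j _ => sub_nonneg.2 (Real.cos_le_one _))
    ⟨1, Finset.mem_Icc.2 ⟨le_rfl, hr⟩, ?_⟩)
  rw [sub_pos]
  refine lt_of_le_of_ne (Real.cos_le_one _) fun h => hk ?_
  rw [Real.cos_eq_one_iff] at h
  obtain ⟨d, hd⟩ := h
  refine ⟨d, ?_⟩
  have h2 : (k : ℝ) = n * d := by
    have hpi := Real.pi_pos.ne'
    field_simp at hd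
    push_cast at hd
    linarith
  exact_mod_cast h2

theorem cube_div_three_le_sum_sq (J : ℕ) :
    (J : ℝ) ^ 3 / 3 ≤ ∑ j ∈ Finset.Icc 1 J, (j : ℝ) ^ 2 := by
  induction J with
  | zero => simp
  | succ J ih =>
    rw [Finset.sum_Icc_succ_top (by omega)]
    push_cast
    nlinarith [(Nat.cast_nonneg J : (0 : ℝ) ≤ J)]

theorem sum_sq_Icc (J : ℕ) :
    ∑ j ∈ Finset.Icc 1 J, (j : ℝ) ^ 2 = J * (J + 1) * (2 * J + 1) / 6 := by
  induction J with
  | zero => simp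
  | succ J ih =>
    rw [Finset.sum_Icc_succ_top (by omega), ih]
    push_cast
    ring

/-- The bound `cos x ≤ 1 - 2 x² / π²` holds for `|x| ≤ π`, which covers only about half of the range
of `j`. The remaining terms are nonnegative and are dropped. -/
theorem le_one_sub_eigenvalue {n r : ℕ} [NeZero n] (hr : 0 < r) {k : ℤ}
    (hk : 2 * |(k : ℝ)| ≤ n) (hkr : r * |(k : ℝ)| ≤ n) :
    (k : ℝ) ^ 2 * r ^ 2 / (12 * n ^ 2) ≤ 1 - eigenvalue n r k := by
  have hn : (0 : ℝ) < n := Nat.cast_pos.2 (NeZero.pos n)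
  have hr' : (0 : ℝ) < r := by positivity
  -- `J = r / 2`, except that `r = 1` would give zero and needs `J = 1`. The bound `r ≤ 3 J` for the
  -- integer quotient is sharp at `r = 3`.
  obtain ⟨J, hJr, hJ3, hJk⟩ : ∃ J : ℕ, J ≤ r ∧ (r : ℝ) ≤ 3 * J ∧ 2 * (J * |(k : ℝ)|) ≤ n := by
    by_cases h1 : r = 1
    · refine ⟨1, h1.ge, by rw [h1]; norm_num, by simpa using hk⟩
    · refine ⟨r / 2, by omega, ?_, ?_⟩
      · have : r ≤ 3 * (r / 2) := by omega
        exact_mod_cast this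
      · have : 2 * (r / 2) ≤ r := by omega
        have h2 : 2 * ((r / 2 : ℕ) : ℝ) ≤ r := by exact_mod_cast this
        nlinarith [abs_nonneg (k : ℝ)]
  rw [one_sub_eigenvalue hr]
  have hterm : ∀ j ∈ Finset.Icc 1 J, 8 * (k : ℝ) ^ 2 / n ^ 2 * (j : ℝ) ^ 2 ≤
      1 - Real.cos (2 * Real.pi * k * j / n) := by
    intro j hj
    have hjJ : (j : ℝ) ≤ J := by exact_mod_cast (Finset.mem_Icc.1 hj).2
    have hpi := Real.pi_pos
    have hx : |2 * Real.pi * k * j / n| ≤ Real.pi := by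
      rw [abs_div, abs_mul, abs_mul, abs_of_pos (by positivity : 0 < 2 * Real.pi),
        abs_of_nonneg (Nat.cast_nonneg j : (0 : ℝ) ≤ j), abs_of_pos hn, div_le_iff₀ hn]
      have : 2 * (|(k : ℝ)| * j) ≤ n := by nlinarith [abs_nonneg (k : ℝ)]
      nlinarith
    have h := Real.cos_le_one_sub_mul_cos_sq hx
    have e : 2 / Real.pi ^ 2 * (2 * Real.pi * k * j / n) ^ 2 = 8 * (k : ℝ) ^ 2 / n ^ 2 * (j : ℝ) ^ 2 := by
      field_simp
      ring
    linarith
  have hsub : Finset.Icc 1 J ⊆ Finset.Icc 1 r := Finset.Icc_subset_Icc_right hJr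
  have h1 : 8 * (k : ℝ) ^ 2 / n ^ 2 * ((J : ℝ) ^ 3 / 3) ≤
      ∑ j ∈ Finset.Icc 1 r, (1 - Real.cos (2 * Real.pi * k * j / n)) := by
    calc _ ≤ 8 * (k : ℝ) ^ 2 / n ^ 2 * ∑ j ∈ Finset.Icc 1 J, (j : ℝ) ^ 2 :=
          mul_le_mul_of_nonneg_left (cube_div_three_le_sum_sq J) (by positivity)
      _ ≤ ∑ j ∈ Finset.Icc 1 J, (1 - Real.cos (2 * Real.pi * k * j / n)) := by
          rw [Finset.mul_sum]; exact Finset.sum_le_sum hterm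
      _ ≤ _ := Finset.sum_le_sum_of_subset_of_nonneg hsub fun j _ _ =>
          sub_nonneg.2 (Real.cos_le_one _)
  have h2 : (r : ℝ) ^ 3 ≤ (3 * J) ^ 3 := pow_le_pow_left₀ hr'.le hJ3 3
  have h3 : (k : ℝ) ^ 2 * r ^ 2 / (12 * n ^ 2) = 1 / r * ((k : ℝ) ^ 2 / n ^ 2 * (r ^ 3 / 12)) := by
    field_simp
  rw [h3]
  refine mul_le_mul_of_nonneg_left (le_trans ?_ h1) (by positivity)
  have h4 : (k : ℝ) ^ 2 / n ^ 2 * (r ^ 3 / 12) ≤ (k : ℝ) ^ 2 / n ^ 2 * ((3 * J) ^ 3 / 12) :=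
    mul_le_mul_of_nonneg_left (by linarith) (by positivity)
  refine h4.trans ?_
  have hJ0 : (0 : ℝ) ≤ J := Nat.cast_nonneg J
  have h5 : 8 * (k : ℝ) ^ 2 / n ^ 2 * ((J : ℝ) ^ 3 / 3) -
    (k : ℝ) ^ 2 / n ^ 2 * ((3 * J) ^ 3 / 12) = (k : ℝ) ^ 2 / n ^ 2 * (J ^ 3 * (5 / 12)) := by ring
  have h6 : 0 ≤ (k : ℝ) ^ 2 / n ^ 2 * ((J : ℝ) ^ 3 * (5 / 12)) := by positivity
  linarith

/-- The telescoping form of the Dirichlet kernel. -/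
theorem sin_half_mul_sum_cos (r : ℕ) (a : ℝ) :
    2 * Real.sin (a / 2) * ∑ j ∈ Finset.Icc 1 r, Real.cos (a * j) =
      Real.sin (a * r + a / 2) - Real.sin (a / 2) := by
  induction r with
  | zero => simp
  | succ r ih =>
    rw [Finset.sum_Icc_succ_top (by omega), mul_add, ih]
    have e1 : a * r + a / 2 = a * (r + 1 : ℕ) - a / 2 := by push_cast; ring
    rw [e1, Real.sin_sub, Real.sin_add]
    ring

/-- The Dirichlet kernel bounds the sum of cosines by `1 / |sin (π k / n)|`, and Jordan's inequality
gives `|sin (π k / n)| ≥ 2 |k| / n`. -/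
theorem abs_eigenvalue_le {n r : ℕ} [NeZero n] (hr : 0 < r) {k : ℤ} (hk0 : k ≠ 0)
    (hk : 2 * |(k : ℝ)| ≤ n) : |eigenvalue n r k| ≤ n / (2 * |(k : ℝ)| * r) := by
  have hn : (0 : ℝ) < n := Nat.cast_pos.2 (NeZero.pos n)
  have hr' : (0 : ℝ) < r := by positivity
  have hkpos : 0 < |(k : ℝ)| := abs_pos.2 (by exact_mod_cast hk0)
  have hpi := Real.pi_pos
  have hsin : 2 * |(k : ℝ)| / n ≤ |Real.sin (2 * Real.pi * k / n / 2)| := by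
    have h := Real.mul_le_sin (x := Real.pi * |(k : ℝ)| / n) (by positivity)
      (by rw [div_le_div_iff₀ hn two_pos]; nlinarith)
    have e : 2 / Real.pi * (Real.pi * |(k : ℝ)| / n) = 2 * |(k : ℝ)| / n := by field_simp
    rw [e] at h
    refine h.trans ?_
    have e2 : 2 * Real.pi * k / n / 2 = Real.pi * k / n := by ring
    rw [e2]
    rcases abs_cases (k : ℝ) with ⟨h1, _⟩ | ⟨h1, _⟩
    · rw [h1]; exact le_abs_self _
    · rw [h1, mul_neg, neg_div, Real.sin_neg]; exact neg_le_abs _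
  have hsum : |∑ j ∈ Finset.Icc 1 r, Real.cos (2 * Real.pi * k * j / n)| ≤ n / (2 * |(k : ℝ)|) := by
    have h := sin_half_mul_sum_cos r (2 * Real.pi * k / n)
    have e : ∀ j : ℕ, 2 * Real.pi * k / n * j = 2 * Real.pi * k * j / n := fun j => by ring
    simp_rw [e] at h
    set S := ∑ j ∈ Finset.Icc 1 r, Real.cos (2 * Real.pi * k * j / n)
    have h2 : 2 * |Real.sin (2 * Real.pi * k / n / 2)| * |S| ≤ 2 := by
      have := congrArg abs h
      rw [abs_mul, abs_mul, abs_two] at this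
      rw [this]
      refine (abs_sub _ _).trans ?_
      linarith [Real.abs_sin_le_one (2 * Real.pi * k * r / n + 2 * Real.pi * k / n / 2),
        Real.abs_sin_le_one (2 * Real.pi * k / n / 2)]
    rw [le_div_iff₀ (by positivity)]
    have h3 : 2 * |(k : ℝ)| / n * |S| ≤ |Real.sin (2 * Real.pi * k / n / 2)| * |S| :=
      mul_le_mul_of_nonneg_right hsin (abs_nonneg _)
    have h4 : 2 * |(k : ℝ)| / n * |S| ≤ 1 := by linarith
    rw [div_mul_eq_mul_div, div_le_one hn] at h4
    linarith
  rw [eigenvalue, abs_mul, abs_of_pos (by positivity : 0 < 1 / (r : ℝ))]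
  calc _ ≤ 1 / (r : ℝ) * (n / (2 * |(k : ℝ)|)) := mul_le_mul_of_nonneg_left hsum (by positivity)
    _ = _ := by field_simp

/-- The excess variance of a mode, in the scale of the fluctuations. -/
def modeWeight (n r : ℕ) (k : ℤ) : ℝ := (1 / (1 - eigenvalue n r k) - 1) / √n

/-- This summable bound is the domination for the series. If `r |k| ≤ n`, the quadratic lower bound
on `1 - λ_k` gives `12 / (lo² k²)`. Otherwise `|λ_k| ≤ n / (2 |k| r) ≤ 1/2`, and the weight is at
most `1 / (lo |k| n^{1/4})`; then `|k| ≤ n` turns `n^{1/4}` into `|k|^{1/4}`, whence the exponent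
`5/4`. -/
theorem abs_modeWeight_le {n r : ℕ} [NeZero n] {lo : ℝ} (hlo : 0 < lo) (hr0 : 0 < r)
    (hr : lo * (n : ℝ) ^ (3 / 4 : ℝ) ≤ r) {k : ℤ} (hk0 : k ≠ 0) (hk : 2 * |(k : ℝ)| ≤ n) :
    |modeWeight n r k| ≤ (12 / lo ^ 2 + 1 / lo) * |(k : ℝ)| ^ (-(5 / 4) : ℝ) := by
  have hn : (0 : ℝ) < n := Nat.cast_pos.2 (NeZero.pos n)
  have hr' : (0 : ℝ) < r := by positivity
  rw [rpow_three_fourths hn.le] at hr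
  have ha1 : 1 ≤ |(k : ℝ)| := by exact_mod_cast Int.one_le_abs hk0
  set a := |(k : ℝ)| with ha
  have ha0 : 0 < a := by linarith
  set s := √(√(n : ℝ)) with hs
  have hs0 : 0 < s := Real.sqrt_pos.2 (Real.sqrt_pos.2 hn)
  have hs2 : √(n : ℝ) = s ^ 2 := (Real.sq_sqrt (Real.sqrt_nonneg _)).symm
  have hs4 : (n : ℝ) = s ^ 4 := by
    rw [show s ^ 4 = (s ^ 2) ^ 2 by ring, ← hs2, Real.sq_sqrt hn.le]
  have hpow : 0 < a ^ (-(5 / 4) : ℝ) := Real.rpow_pos_of_pos ha0 _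
  rw [modeWeight, hs2]
  rw [hs2] at hr
  have hr3 : lo * s ^ 3 ≤ r := by linarith [show lo * (s ^ 2 * s) = lo * s ^ 3 by ring]
  have hsplit : (12 / lo ^ 2 + 1 / lo) * a ^ (-(5 / 4) : ℝ) =
    12 / lo ^ 2 * a ^ (-(5 / 4) : ℝ) + 1 / lo * a ^ (-(5 / 4) : ℝ) := by ring
  have hA : 0 ≤ 12 / lo ^ 2 * a ^ (-(5 / 4) : ℝ) := by positivity
  have hB : 0 ≤ 1 / lo * a ^ (-(5 / 4) : ℝ) := by positivity
  have hd : 1 / (1 - eigenvalue n r k) - 1 = eigenvalue n r k / (1 - eigenvalue n r k) ∨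
      1 - eigenvalue n r k = 0 := by
    by_cases h : 1 - eigenvalue n r k = 0
    · exact Or.inr h
    · left; field_simp; ring
  by_cases hkr : r * a ≤ n
  · have h1 := le_one_sub_eigenvalue hr0 hk hkr
    have hpos : 0 < (k : ℝ) ^ 2 * r ^ 2 / (12 * n ^ 2) := by
      have : (k : ℝ) ≠ 0 := by exact_mod_cast hk0
      positivity
    have hd0 : 0 < 1 - eigenvalue n r k := hpos.trans_le h1
    rw [hd.resolve_right hd0.ne', abs_div, abs_div, abs_of_pos hd0, abs_of_pos (by positivity : 0 < s ^ 2)]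
    have h2 : |eigenvalue n r k| / (1 - eigenvalue n r k) ≤ 1 / ((k : ℝ) ^ 2 * r ^ 2 / (12 * n ^ 2)) :=
      div_le_div₀ zero_le_one (abs_eigenvalue_le_one hr0 n k) hpos h1
    have h3 : |eigenvalue n r k| / (1 - eigenvalue n r k) / s ^ 2 ≤ 12 / lo ^ 2 * (a ^ 2)⁻¹ := by
      refine (div_le_div_of_nonneg_right h2 (by positivity)).trans ?_
      rw [← sq_abs (k : ℝ), ← ha, hs4]
      rw [show 1 / (a ^ 2 * (r : ℝ) ^ 2 / (12 * (s ^ 4) ^ 2)) / s ^ 2 =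
        12 * s ^ 6 / (a ^ 2 * r ^ 2) by field_simp]
      rw [show 12 / lo ^ 2 * (a ^ 2)⁻¹ = 12 * s ^ 6 / (a ^ 2 * (lo * s ^ 3) ^ 2) by field_simp]
      have : (lo * s ^ 3) ^ 2 ≤ (r : ℝ) ^ 2 := pow_le_pow_left₀ (by positivity) hr3 2
      gcongr
    have h4 : (a ^ 2)⁻¹ ≤ a ^ (-(5 / 4) : ℝ) := by
      rw [← Real.rpow_natCast, ← Real.rpow_neg ha0.le]
      exact Real.rpow_le_rpow_of_exponent_le ha1 (by norm_num)
    rw [hsplit]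
    have h5 : 12 / lo ^ 2 * (a ^ 2)⁻¹ ≤ 12 / lo ^ 2 * a ^ (-(5 / 4) : ℝ) :=
      mul_le_mul_of_nonneg_left h4 (by positivity)
    linarith
  · rw [not_le] at hkr
    have h1 := abs_eigenvalue_le hr0 hk0 hk
    rw [← ha] at h1
    have h2 : n / (2 * a * r) ≤ 1 / 2 := by
      rw [div_le_div_iff₀ (by positivity) two_pos]
      nlinarith
    have h3 : eigenvalue n r k ≤ 1 / 2 := (le_abs_self _).trans (h1.trans h2)
    have hd0 : 0 < 1 - eigenvalue n r k := by linarith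
    rw [hd.resolve_right hd0.ne', abs_div, abs_div, abs_of_pos hd0, abs_of_pos (by positivity : 0 < s ^ 2)]
    have h4 : |eigenvalue n r k| / (1 - eigenvalue n r k) ≤ n / (2 * a * r) / (1 / 2) :=
      div_le_div₀ (by positivity) h1 (by norm_num) (by linarith)
    have h5 : |eigenvalue n r k| / (1 - eigenvalue n r k) / s ^ 2 ≤ 1 / lo * (a * s)⁻¹ := by
      refine (div_le_div_of_nonneg_right h4 (by positivity)).trans ?_
      rw [hs4, show s ^ 4 / (2 * a * r) / (1 / 2) / s ^ 2 = s ^ 2 / (a * r) by field_simp,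
        show 1 / lo * (a * s)⁻¹ = s ^ 2 / (a * (lo * s ^ 3)) by field_simp]
      gcongr
    have h6 : (a * s)⁻¹ ≤ a ^ (-(5 / 4) : ℝ) := by
      rw [Real.rpow_neg ha0.le]
      refine inv_anti₀ (by positivity) ?_
      rw [show (5 / 4 : ℝ) = 1 + 1 / 4 by norm_num, Real.rpow_add ha0, Real.rpow_one]
      refine mul_le_mul_of_nonneg_left ?_ ha0.le
      have : s = (n : ℝ) ^ (1 / 4 : ℝ) := by
        rw [hs, Real.sqrt_eq_rpow, Real.sqrt_eq_rpow, ← Real.rpow_mul hn.le]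
        norm_num
      rw [this]
      exact Real.rpow_le_rpow ha0.le (by linarith) (by norm_num)
    rw [hsplit]
    have h7 : 1 / lo * (a * s)⁻¹ ≤ 1 / lo * a ^ (-(5 / 4) : ℝ) :=
      mul_le_mul_of_nonneg_left h6 (by positivity)
    linarith

/-- Second-order Taylor expansion of the cosine, summed by the formula for the sum of squares. The
hypothesis keeps all angles at most one, where the quartic remainder bound applies. -/
theorem abs_one_sub_eigenvalue_sub_le {n r : ℕ} [NeZero n] (hr : 0 < r) {k : ℤ}
    (hk : 2 * Real.pi * |(k : ℝ)| * r ≤ n) :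
    |1 - eigenvalue n r k - 2 * Real.pi ^ 2 * k ^ 2 / n ^ 2 * ((r + 1) * (2 * r + 1) / 6)| ≤
      (2 * Real.pi * |(k : ℝ)| * r / n) ^ 4 := by
  have hn : (0 : ℝ) < n := Nat.cast_pos.2 (NeZero.pos n)
  have hr' : (0 : ℝ) < r := by positivity
  have hpi := Real.pi_pos
  have hmain : 2 * Real.pi ^ 2 * (k : ℝ) ^ 2 / n ^ 2 * (((r : ℝ) + 1) * (2 * r + 1) / 6) =
      1 / r * ∑ j ∈ Finset.Icc 1 r, (2 * Real.pi * k * j / n) ^ 2 / 2 := by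
    have : ∀ j ∈ Finset.Icc 1 r, (2 * Real.pi * k * j / n) ^ 2 / 2 =
        2 * Real.pi ^ 2 * (k : ℝ) ^ 2 / n ^ 2 * (j : ℝ) ^ 2 := fun j _ => by ring
    rw [Finset.sum_congr rfl this, ← Finset.mul_sum, sum_sq_Icc]
    field_simp
  rw [hmain, one_sub_eigenvalue hr, ← mul_sub, ← Finset.sum_sub_distrib, abs_mul,
    abs_of_pos (by positivity : 0 < 1 / (r : ℝ))]
  have hterm : ∀ j ∈ Finset.Icc 1 r, |1 - Real.cos (2 * Real.pi * k * j / n) -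
      (2 * Real.pi * k * j / n) ^ 2 / 2| ≤ (2 * Real.pi * |(k : ℝ)| * r / n) ^ 4 := by
    intro j hj
    have hjr : (j : ℝ) ≤ r := by exact_mod_cast (Finset.mem_Icc.1 hj).2
    have hx : |2 * Real.pi * k * j / n| ≤ 2 * Real.pi * |(k : ℝ)| * r / n := by
      rw [abs_div, abs_mul, abs_mul, abs_of_pos (by positivity : 0 < 2 * Real.pi),
        abs_of_nonneg (Nat.cast_nonneg j : (0 : ℝ) ≤ j), abs_of_pos hn]
      gcongr
    have hx1 : |2 * Real.pi * k * j / n| ≤ 1 := hx.trans ((div_le_one hn).2 hk)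
    have h := Real.cos_bound hx1
    rw [← abs_neg] at h
    have e : -(Real.cos (2 * Real.pi * k * j / n) - (1 - (2 * Real.pi * k * j / n) ^ 2 / 2)) =
      1 - Real.cos (2 * Real.pi * k * j / n) - (2 * Real.pi * k * j / n) ^ 2 / 2 := by ring
    rw [e] at h
    refine h.trans ?_
    have h4 : |2 * Real.pi * k * j / n| ^ 4 ≤ (2 * Real.pi * |(k : ℝ)| * r / n) ^ 4 :=
      pow_le_pow_left₀ (abs_nonneg _) hx 4
    have h5 : 0 ≤ |2 * Real.pi * k * j / n| ^ 4 := by positivity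
    linarith
  have h := (Finset.abs_sum_le_sum_abs _ _).trans (Finset.sum_le_sum hterm)
  rw [Finset.sum_const, Nat.card_Icc, Nat.add_sub_cancel, nsmul_eq_mul] at h
  calc _ ≤ 1 / (r : ℝ) * (r * (2 * Real.pi * |(k : ℝ)| * r / n) ^ 4) :=
        mul_le_mul_of_nonneg_left h (by positivity)
    _ = _ := by field_simp

/-- In terms of `s = n^{1/4}` and `q = r / n^{3/4}`, the main term of `√n (1 - λ_k)` is a polynomial
in `q` and `1 / s`, and the Taylor error is `O(q⁴ / s²)`. Hence `√n (1 - λ_k)` tends to `2 π² k² λ²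
/ 3`; the weight is its inverse minus `1 / √n`. -/
theorem tendsto_modeWeight {lam : ℝ} (hlam : 0 < lam) {r : ℕ → ℕ}
    (hr : Tendsto (fun m => (r m : ℝ) / ((m + 1 : ℕ) : ℝ) ^ (3 / 4 : ℝ)) atTop (𝓝 lam))
    {k : ℤ} (hk : k ≠ 0) :
    Tendsto (fun m => modeWeight (m + 1) (r m) k) atTop
      (𝓝 (3 / (2 * lam ^ 2 * Real.pi ^ 2) / (k : ℝ) ^ 2)) := by
  have hpi := Real.pi_pos
  have hk' : (k : ℝ) ≠ 0 := by exact_mod_cast hk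
  have hka : 0 < |(k : ℝ)| := abs_pos.2 hk'
  set s : ℕ → ℝ := fun m => √(√((m + 1 : ℕ) : ℝ)) with hs
  have hs0 : ∀ m, 0 < s m := fun m => Real.sqrt_pos.2 (Real.sqrt_pos.2 (by positivity))
  have hs2 : ∀ m, √((m + 1 : ℕ) : ℝ) = s m ^ 2 := fun m => (Real.sq_sqrt (Real.sqrt_nonneg _)).symm
  have hs4 : ∀ m, ((m + 1 : ℕ) : ℝ) = s m ^ 4 := fun m => by
    rw [show s m ^ 4 = (s m ^ 2) ^ 2 by ring, ← hs2, Real.sq_sqrt (by positivity)]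
  have hs_lim : Tendsto s atTop atTop := Real.tendsto_sqrt_atTop.comp (Real.tendsto_sqrt_atTop.comp
    (tendsto_natCast_atTop_atTop.comp (tendsto_add_atTop_nat 1)))
  have hsinv : Tendsto (fun m => (s m)⁻¹) atTop (𝓝 0) := tendsto_inv_atTop_zero.comp hs_lim
  set q : ℕ → ℝ := fun m => (r m : ℝ) / ((m + 1 : ℕ) : ℝ) ^ (3 / 4 : ℝ) with hq
  have hrq : ∀ m, (r m : ℝ) = q m * s m ^ 3 := by
    intro m
    have := hs0 m
    simp only [hq]
    rw [rpow_three_fourths (by positivity)]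
    change (r m : ℝ) = r m / (√((m + 1 : ℕ) : ℝ) * s m) * s m ^ 3
    rw [hs2]
    field_simp
  have hqpos : ∀ᶠ m in atTop, 0 < q m := hr.eventually (lt_mem_nhds hlam)
  have hrpos : ∀ᶠ m in atTop, 0 < r m := by
    filter_upwards [hqpos] with m hm
    have : (0 : ℝ) < r m := by rw [hrq]; have := hs0 m; positivity
    exact_mod_cast this
  have hqs : Tendsto (fun m => 2 * Real.pi * |(k : ℝ)| * (q m * (s m)⁻¹)) atTop (𝓝 0) := by
    simpa using (hr.mul hsinv).const_mul (2 * Real.pi * |(k : ℝ)|)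
  -- the main term
  have hmain : Tendsto (fun m => √((m + 1 : ℕ) : ℝ) * (2 * Real.pi ^ 2 * k ^ 2 / ((m + 1 : ℕ) : ℝ) ^ 2 *
      (((r m : ℝ) + 1) * (2 * r m + 1) / 6))) atTop (𝓝 (2 * Real.pi ^ 2 * k ^ 2 * lam ^ 2 / 3)) := by
    have h1 : Tendsto (fun m => 2 * Real.pi ^ 2 * (k : ℝ) ^ 2 * ((q m + (s m)⁻¹ ^ 3) *
        (2 * q m + (s m)⁻¹ ^ 3) / 6)) atTop
        (𝓝 (2 * Real.pi ^ 2 * (k : ℝ) ^ 2 * ((lam + 0 ^ 3) * (2 * lam + 0 ^ 3) / 6))) :=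
      (((hr.add (hsinv.pow 3)).mul ((hr.const_mul 2).add (hsinv.pow 3))).div_const 6).const_mul _
    have e : 2 * Real.pi ^ 2 * (k : ℝ) ^ 2 * ((lam + 0 ^ 3) * (2 * lam + 0 ^ 3) / 6) =
      2 * Real.pi ^ 2 * k ^ 2 * lam ^ 2 / 3 := by ring
    rw [e] at h1
    refine h1.congr fun m => ?_
    have := hs0 m
    rw [hs2, hs4, hrq]
    field_simp
  have herr : Tendsto (fun m => √((m + 1 : ℕ) : ℝ) * (1 - eigenvalue (m + 1) (r m) k) -
      √((m + 1 : ℕ) : ℝ) * (2 * Real.pi ^ 2 * k ^ 2 / ((m + 1 : ℕ) : ℝ) ^ 2 *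
      (((r m : ℝ) + 1) * (2 * r m + 1) / 6))) atTop (𝓝 0) := by
    have hb : Tendsto (fun m => (2 * Real.pi * |(k : ℝ)|) ^ 4 * (q m ^ 4 * (s m)⁻¹ ^ 2)) atTop
        (𝓝 0) := by
      simpa using ((hr.pow 4).mul (hsinv.pow 2)).const_mul ((2 * Real.pi * |(k : ℝ)|) ^ 4)
    refine squeeze_zero_norm' ?_ hb
    filter_upwards [hrpos, hqs.eventually (ge_mem_nhds one_pos)] with m hm1 hm2
    have hsm := hs0 m
    have hle : 2 * Real.pi * |(k : ℝ)| * r m ≤ ((m + 1 : ℕ) : ℝ) := by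
      have : 2 * Real.pi * |(k : ℝ)| * r m = 2 * Real.pi * |(k : ℝ)| * (q m * (s m)⁻¹) * s m ^ 4 := by
        rw [hrq]; field_simp
      rw [this, hs4]
      exact mul_le_of_le_one_left (by positivity) hm2
    have h := abs_one_sub_eigenvalue_sub_le hm1 hle
    rw [← mul_sub, norm_mul, Real.norm_of_nonneg (Real.sqrt_nonneg _)]
    refine (mul_le_mul_of_nonneg_left h (Real.sqrt_nonneg _)).trans_eq ?_
    rw [hs2, hs4, hrq]
    field_simp
  have hprod : Tendsto (fun m => √((m + 1 : ℕ) : ℝ) * (1 - eigenvalue (m + 1) (r m) k)) atTop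
      (𝓝 (2 * Real.pi ^ 2 * k ^ 2 * lam ^ 2 / 3)) := by
    simpa using herr.add hmain
  have hsqinv : Tendsto (fun m : ℕ => (√((m + 1 : ℕ) : ℝ))⁻¹) atTop (𝓝 0) := by
    have := hsinv.pow 2
    rw [zero_pow two_ne_zero] at this
    refine this.congr fun m => ?_
    rw [hs2, inv_pow]
  have hfin := (hprod.inv₀ (by positivity)).sub hsqinv
  have e : (2 * Real.pi ^ 2 * (k : ℝ) ^ 2 * lam ^ 2 / 3)⁻¹ - 0 =
    3 / (2 * lam ^ 2 * Real.pi ^ 2) / (k : ℝ) ^ 2 := by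
    rw [sub_zero]; field_simp
  rw [e] at hfin
  refine hfin.congr fun m => ?_
  rw [modeWeight, mul_inv, sub_div]
  rw [one_div, one_div]
  ring

/-! ### Characteristic functions and a uniform density bound -/

/-- This is the Gaussian integral with complex parameter `b = 1 / (2 v) - i a t`. Taking norms
removes the choice of the square root. -/
theorem norm_charFun_gaussianReal_sq (v : NNReal) (hv : v ≠ 0) (a t : ℝ) :
    ‖charFun ((gaussianReal 0 v).map fun z => a * z ^ 2) t‖ =
      (1 + 4 * (v * a * t) ^ 2) ^ (-(1 / 4) : ℝ) := by
  have hv0 : (0 : ℝ) < v := by positivity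
  have hpi := Real.pi_pos
  set b : ℂ := ((1 / (2 * v) : ℝ) : ℂ) - ((t * a : ℝ) : ℂ) * Complex.I with hb
  have hbre : b.re = 1 / (2 * v) := by simp [hb]
  have hbpos : 0 < b.re := by rw [hbre]; positivity
  have hb0 : b ≠ 0 := fun h => by rw [h] at hbpos; simp at hbpos
  have h1 : charFun ((gaussianReal 0 v).map fun z => a * z ^ 2) t =
      ((√(2 * Real.pi * v))⁻¹ : ℝ) * (Real.pi / b) ^ (1 / 2 : ℂ) := by
    rw [charFun_apply_real, integral_map (by fun_prop) (by fun_prop),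
      integral_gaussianReal_eq_integral_smul hv, ← integral_gaussian_complex hbpos,
      ← integral_const_mul]
    refine integral_congr_ae (ae_of_all _ fun x => ?_)
    simp only [gaussianPDFReal, sub_zero, Complex.real_smul]
    rw [Complex.ofReal_mul, Complex.ofReal_exp, mul_assoc, ← Complex.exp_add]
    congr 2
    rw [hb]
    have : ((v : ℝ) : ℂ) ≠ 0 := by exact_mod_cast hv0.ne'
    push_cast
    field_simp
    ring
  have hbn : ‖b‖ = 1 / (2 * v) * √(1 + 4 * (v * a * t) ^ 2) := by
    have e : Complex.normSq b = (1 / (2 * v) * √(1 + 4 * (v * a * t) ^ 2)) ^ 2 := by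
      rw [mul_pow, Real.sq_sqrt (by positivity), Complex.normSq_apply, hbre]
      have : b.im = -(t * a) := by simp [hb]
      rw [this]
      field_simp
      ring
    rw [Complex.norm_def, e, Real.sqrt_sq (by positivity)]
  have hX : 0 < 1 + 4 * (v * a * t) ^ 2 := by positivity
  rw [h1, norm_mul, Complex.norm_real, Real.norm_of_nonneg (by positivity)]
  have h2 : ‖(Real.pi / b) ^ (1 / 2 : ℂ)‖ = ‖(Real.pi / b : ℂ)‖ ^ (1 / 2 : ℝ) := by
    have := Complex.norm_cpow_real (Real.pi / b : ℂ) (1 / 2)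
    push_cast at this
    exact this
  rw [h2, norm_div, Complex.norm_real, Real.norm_of_nonneg hpi.le, hbn, ← Real.sqrt_eq_rpow]
  have h3 : Real.pi / (1 / (2 * v) * √(1 + 4 * (v * a * t) ^ 2)) =
      2 * Real.pi * v / √(1 + 4 * (v * a * t) ^ 2) := by field_simp
  rw [h3, Real.sqrt_div (by positivity), Real.sqrt_eq_rpow (√_), Real.sqrt_eq_rpow (1 + _),
    ← Real.rpow_mul hX.le, Real.rpow_neg hX.le]
  have : 0 < √(2 * Real.pi * v) := Real.sqrt_pos.2 (by positivity)
  norm_num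
  field_simp

/-- A concentration inequality: a measure with an integrable characteristic function has a bounded
density on intervals. -/
theorem measure_Ioo_le_of_norm_charFun_le {μ : Measure ℝ} [IsProbabilityMeasure μ] {g : ℝ → ℝ}
    (hg : Integrable g) (h : ∀ t, ‖charFun μ t‖ ≤ g t) (a b : ℝ) :
    μ (Set.Ioo a b) ≤ ENNReal.ofReal (Real.exp (1 / 2) * ∫ t, g t) * ENNReal.ofReal (b - a) := by
  have hg0 : ∀ t, 0 ≤ g t := fun t => (norm_nonneg _).trans (h t)
  have hI : 0 ≤ ∫ t, g t := integral_nonneg hg0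
  rcases le_or_gt b a with hab | hab
  · simp [Set.Ioo_eq_empty (not_lt.2 hab)]
  set d : ℝ := (b - a) / 2 with hd
  have hd0 : 0 < d := by rw [hd]; linarith
  set x₀ : ℝ := (a + b) / 2 with hx₀
  -- With variance `1 / d²`, the characteristic function of the auxiliary Gaussian is a Gaussian
  -- kernel of width `d`, the half-length of the interval.
  set w : NNReal := ⟨(1 / d) ^ 2, by positivity⟩ with hw
  have hw0 : w ≠ 0 := by
    have h : (0 : ℝ) < (w : ℝ) := by
      change (0 : ℝ) < (1 / d) ^ 2
      positivity
    exact NNReal.coe_ne_zero.1 h.ne'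
  have hwv : (w : ℝ) = (1 / d) ^ 2 := rfl
  -- the Gaussian kernel as a characteristic function
  have hker : ∀ x : ℝ, (Real.exp (-((1 / d) ^ 2 * (x - x₀) ^ 2) / 2) : ℂ) =
      ∫ t, Complex.exp ((x - x₀) * t * Complex.I) ∂gaussianReal 0 w := by
    intro x
    have := charFun_gaussianReal (μ := 0) (v := w) (t := x - x₀)
    rw [charFun_apply_real] at this
    push_cast at this
    rw [this]
    push_cast
    have hwc : ((w : ℝ) : ℂ) = (1 / (d : ℂ)) ^ 2 := by rw [hwv]; push_cast; rfl
    rw [hwc]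
    congr 1
    ring
  have hF : Integrable (Function.uncurry fun (x t : ℝ) => Complex.exp ((x - x₀) * t * Complex.I))
      (μ.prod (gaussianReal 0 w)) := by
    refine Integrable.of_bound (Continuous.aestronglyMeasurable (by
      simp only [Function.uncurry_def]; fun_prop)) 1 (ae_of_all _ fun p => ?_)
    have : ((p.1 : ℂ) - x₀) * p.2 * Complex.I = (((p.1 - x₀) * p.2 : ℝ) : ℂ) * Complex.I := by
      push_cast; rfl
    simp only [Function.uncurry_def]
    rw [this, Complex.norm_exp_ofReal_mul_I]
  have hswap : ∫ x, (Real.exp (-((1 / d) ^ 2 * (x - x₀) ^ 2) / 2) : ℂ) ∂μ =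
      ∫ t, Complex.exp (-(x₀ * t * Complex.I)) * charFun μ t ∂gaussianReal 0 w := by
    rw [integral_congr_ae (ae_of_all _ hker), integral_integral_swap hF]
    refine integral_congr_ae (ae_of_all _ fun t => ?_)
    simp only
    rw [charFun_apply_real, ← integral_const_mul]
    refine integral_congr_ae (ae_of_all _ fun x => ?_)
    simp only
    rw [← Complex.exp_add]
    congr 1
    ring
  -- The maximum of this density is `d / √(2 π)`.
  have hpdf : ∀ t, gaussianPDFReal 0 w t ≤ d := by
    intro t
    rw [gaussianPDFReal]
    have h1 : Real.exp (-(t - 0) ^ 2 / (2 * w)) ≤ 1 := Real.exp_le_one_iff.2 (by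
      rw [neg_div, neg_nonpos]; positivity)
    have h2 : (√(2 * Real.pi * w))⁻¹ ≤ d := by
      refine inv_le_of_inv_le₀ hd0 (Real.le_sqrt_of_sq_le ?_)
      rw [hwv, one_div]
      have := Real.pi_gt_three
      have h3 : 0 < d⁻¹ ^ 2 := by positivity
      nlinarith
    calc _ ≤ (√(2 * Real.pi * w))⁻¹ * 1 := mul_le_mul_of_nonneg_left h1 (by positivity)
      _ ≤ d := by rw [mul_one]; exact h2
  have hbound : ∫ x, Real.exp (-((1 / d) ^ 2 * (x - x₀) ^ 2) / 2) ∂μ ≤ d * ∫ t, g t := by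
    have h1 : ((∫ x, Real.exp (-((1 / d) ^ 2 * (x - x₀) ^ 2) / 2) ∂μ : ℝ) : ℂ) =
        ∫ t, Complex.exp (-(x₀ * t * Complex.I)) * charFun μ t ∂gaussianReal 0 w := by
      rw [← hswap, integral_complex_ofReal]
    have h2 : ‖∫ t, Complex.exp (-(x₀ * t * Complex.I)) * charFun μ t ∂gaussianReal 0 w‖ ≤
        d * ∫ t, g t := by
      rw [integral_gaussianReal_eq_integral_smul hw0, ← integral_const_mul]
      refine norm_integral_le_of_norm_le (hg.const_mul d) (ae_of_all _ fun t => ?_)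
      have : -((x₀ : ℂ) * t * Complex.I) = ((-(x₀ * t) : ℝ) : ℂ) * Complex.I := by push_cast; ring
      rw [norm_smul, norm_mul, this, Complex.norm_exp_ofReal_mul_I, one_mul,
        Real.norm_of_nonneg (gaussianPDFReal_nonneg _ _ _)]
      exact mul_le_mul (hpdf t) (h t) (norm_nonneg _) hd0.le
    rw [← h1, Complex.norm_real] at h2
    exact (le_abs_self _).trans h2
  have hint : Integrable (fun x => Real.exp (-((1 / d) ^ 2 * (x - x₀) ^ 2) / 2)) μ := by
    refine Integrable.of_bound (Continuous.aestronglyMeasurable (by fun_prop)) 1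
      (ae_of_all _ fun x => ?_)
    rw [Real.norm_of_nonneg (Real.exp_pos _).le]
    exact Real.exp_le_one_iff.2 (by rw [neg_div, neg_nonpos]; positivity)
  -- The kernel is at least `exp (-1/2)` at distance at most `d` from the centre.
  have hle : Real.exp (-(1 / 2)) * μ.real (Set.Ioo a b) ≤
      ∫ x, Real.exp (-((1 / d) ^ 2 * (x - x₀) ^ 2) / 2) ∂μ := by
    have h1 : Real.exp (-(1 / 2)) * μ.real (Set.Ioo a b) =
        ∫ x in Set.Ioo a b, Real.exp (-(1 / 2)) ∂μ := by
      simp [mul_comm]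
    rw [h1]
    refine le_trans (setIntegral_mono_on (by simp) hint.integrableOn measurableSet_Ioo
      fun x hx => ?_) (setIntegral_le_integral hint (ae_of_all _ fun x => (Real.exp_pos _).le))
    rw [Real.exp_le_exp]
    have hx2 : (x - x₀) ^ 2 ≤ d ^ 2 := by
      obtain ⟨ha, hb⟩ := hx
      exact sq_le_sq' (by rw [hd, hx₀]; linarith) (by rw [hd, hx₀]; linarith)
    have : (1 / d) ^ 2 * (x - x₀) ^ 2 ≤ 1 := by
      rw [one_div, inv_pow, inv_mul_le_iff₀ (by positivity), mul_one]
      exact hx2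
    linarith
  have hfinal : μ.real (Set.Ioo a b) ≤ Real.exp (1 / 2) * (∫ t, g t) * (b - a) := by
    have h1 := hle.trans hbound
    have h2 : μ.real (Set.Ioo a b) ≤ Real.exp (1 / 2) * (d * ∫ t, g t) := by
      have h3 := mul_le_mul_of_nonneg_left h1 (Real.exp_pos (1 / 2)).le
      rw [← mul_assoc, ← Real.exp_add] at h3
      simpa using h3
    have h4 : 0 ≤ Real.exp (1 / 2) * ∫ t, g t := by positivity
    have h5 : d ≤ b - a := by rw [hd]; linarith
    nlinarith
  rw [← ENNReal.ofReal_mul (by positivity), ← ofReal_measureReal]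
  exact ENNReal.ofReal_le_ofReal hfinal

/-- By independence the norm is a product of `m` factors, each at most `(1 + t² / n)^{-1/4}` because
the variances are at least `1/2`. Bernoulli's inequality with exponent `m / 4` needs `m ≥ 4`, which
also gives `m / (4 n) ≥ 1/5`. -/
theorem norm_charFun_energyLaw_le {m : ℕ} (hm : 4 ≤ m) {v : Fin m → NNReal}
    (hv : ∀ i, (1 / 2 : ℝ) ≤ v i) (t : ℝ) :
    ‖charFun (energyLaw m v) t‖ ≤ 5 * (1 + t ^ 2)⁻¹ := by
  have hn : (0 : ℝ) < ((m + 1 : ℕ) : ℝ) := by positivity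
  set n : ℝ := ((m + 1 : ℕ) : ℝ) with hndef
  have hsn : 0 < √n := Real.sqrt_pos.2 hn
  set Q := Measure.pi fun i => gaussianReal 0 (v i) with hQ
  have hmap : energyLaw m v = (Q.map fun z => ∑ i, (-1 / √n) * z i ^ 2).map fun x => √n + x := by
    rw [energyLaw, Measure.map_map (by fun_prop) (by fun_prop)]
    congr 1
    ext z
    simp only [Function.comp_apply]
    rw [← Finset.mul_sum, sub_div, Real.div_sqrt]
    ring
  have hind : iIndepFun (fun i (z : Fin m → ℝ) => (-1 / √n) * z i ^ 2) Q :=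
    iIndepFun_pi (X := fun _ x => (-1 / √n) * x ^ 2) fun i => by fun_prop
  have hcf : ‖charFun (energyLaw m v) t‖ =
      ∏ i, ‖charFun ((gaussianReal 0 (v i)).map fun z => (-1 / √n) * z ^ 2) t‖ := by
    have hn1 : ‖Complex.exp (inner ℝ √n t * Complex.I)‖ = 1 := Complex.norm_exp_ofReal_mul_I _
    rw [hmap, charFun_map_const_add, norm_mul, hn1, mul_one,
      hind.charFun_map_fun_sum_eq_prod fun i => (Measurable.aemeasurable (by fun_prop)), Finset.prod_apply, norm_prod]
    refine Finset.prod_congr rfl fun i _ => ?_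
    have hev := (measurePreserving_eval (fun i => gaussianReal 0 (v i)) i).map_eq
    rw [← hev, Measure.map_map (by fun_prop) (by fun_prop)]
    rfl
  have hs : 0 ≤ t ^ 2 / n := by positivity
  have hfac : ∀ i, ‖charFun ((gaussianReal 0 (v i)).map fun z => (-1 / √n) * z ^ 2) t‖ ≤
      (1 + t ^ 2 / n) ^ (-(1 / 4) : ℝ) := by
    intro i
    have hvi := hv i
    rw [norm_charFun_gaussianReal_sq (v i) (fun h => by simp [h] at hvi; linarith)]
    refine Real.rpow_le_rpow_of_nonpos (by positivity) ?_ (by norm_num)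
    have h1 : (v i * (-1 / √n) * t) ^ 2 = (v i : ℝ) ^ 2 * (t ^ 2 / n) := by
      rw [mul_pow, mul_pow, div_pow, Real.sq_sqrt hn.le]
      ring
    have h2 : (1 / 2 : ℝ) ^ 2 ≤ (v i : ℝ) ^ 2 := pow_le_pow_left₀ (by norm_num) hvi 2
    rw [h1]
    nlinarith [mul_le_mul_of_nonneg_right h2 hs]
  have hm' : (4 : ℝ) ≤ m := by exact_mod_cast hm
  have hn' : n = m + 1 := by rw [hndef]; push_cast; rfl
  rw [hcf]
  calc _ ≤ ∏ _i : Fin m, (1 + t ^ 2 / n) ^ (-(1 / 4) : ℝ) :=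
        Finset.prod_le_prod (fun i _ => norm_nonneg _) fun i _ => hfac i
    _ = ((1 + t ^ 2 / n) ^ (m / 4 : ℝ))⁻¹ := by
        rw [Finset.prod_const, Finset.card_univ, Fintype.card_fin, ← Real.rpow_mul_natCast
          (by positivity), ← Real.rpow_neg (by positivity)]
        congr 1
        ring
    _ ≤ (1 + m / 4 * (t ^ 2 / n))⁻¹ := inv_anti₀ (by positivity)
        (one_add_mul_self_le_rpow_one_add (by linarith) (by linarith))
    _ ≤ (1 + t ^ 2 / 5)⁻¹ := by
        refine inv_anti₀ (by positivity) ?_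
        have : t ^ 2 / 5 ≤ m / 4 * (t ^ 2 / n) := by
          rw [div_mul_div_comm, div_le_div_iff₀ (by norm_num) (by positivity), hn']
          nlinarith [sq_nonneg t]
        linarith
    _ ≤ 5 * (1 + t ^ 2)⁻¹ := by
        rw [← div_eq_mul_inv, inv_eq_one_div, div_le_div_iff₀ (by positivity) (by positivity)]
        nlinarith [sq_nonneg t]

theorem exists_energyLaw_le : ∃ C : ℝ≥0∞, C ≠ 0 ∧ C ≠ ∞ ∧ ∀ (m : ℕ) (v : Fin m → NNReal), 4 ≤ m →
    (∀ i, (1 / 2 : ℝ) ≤ v i) → energyLaw m v ≤ C • volume := by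
  have hg : Integrable fun t : ℝ => 5 * (1 + t ^ 2)⁻¹ := integrable_inv_one_add_sq.const_mul 5
  have hpos : 0 < Real.exp (1 / 2) * ∫ t : ℝ, 5 * (1 + t ^ 2)⁻¹ := by
    rw [integral_const_mul, integral_univ_inv_one_add_sq]
    have := Real.pi_pos
    positivity
  refine ⟨ENNReal.ofReal (Real.exp (1 / 2) * ∫ t : ℝ, 5 * (1 + t ^ 2)⁻¹), ?_,
    ENNReal.ofReal_ne_top, fun m v hm hv => ?_⟩
  · rwa [Ne, ENNReal.ofReal_eq_zero, not_le]
  · refine le_smul_volume_of_Ioo ?_ ENNReal.ofReal_ne_top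
      (measure_Ioo_le_of_norm_charFun_le hg (norm_charFun_energyLaw_le hm hv))
    rwa [Ne, ENNReal.ofReal_eq_zero, not_le]

/-! ### Gaussian moments -/

theorem integral_pow_four_gaussianReal : ∫ x, x ^ 4 ∂gaussianReal 0 1 = 3 := by
  have hpi := Real.pi_pos
  have h1 : ∫ x in Set.Ioi (0 : ℝ), x ^ 4 * Real.exp (-x ^ 2 / 2) =
      √(2 * Real.pi) * 3 / 2 := by
    have h := integral_rpow_mul_exp_neg_mul_rpow (p := 2) (q := 4) (b := 1 / 2) (by norm_num)
      (by norm_num) (by norm_num)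
    have hg : Real.Gamma ((4 + 1) / 2) = 3 / 4 * √Real.pi := by
      have := Real.Gamma_nat_add_half 2
      norm_num [Nat.doubleFactorial] at this
      rw [show ((4 : ℝ) + 1) / 2 = 5 / 2 by norm_num, this]
      ring
    have hp : (1 / 2 : ℝ) ^ (-(4 + 1) / 2 : ℝ) = 4 * √2 := by
      rw [one_div, Real.inv_rpow (by norm_num), ← Real.rpow_neg (by norm_num),
        show -(-(4 + 1) / 2 : ℝ) = (2 : ℕ) + 1 / 2 by norm_num,
        Real.rpow_add (by norm_num), Real.rpow_natCast, ← Real.sqrt_eq_rpow]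
      norm_num
    rw [hg, hp] at h
    rw [Real.sqrt_mul (by norm_num), show √2 * √Real.pi * 3 / 2 = 4 * √2 * (1 / 2) *
      (3 / 4 * √Real.pi) by ring, ← h]
    refine setIntegral_congr_fun measurableSet_Ioi fun x _ => ?_
    rw [show (4 : ℝ) = (4 : ℕ) by norm_num, Real.rpow_natCast, show (2 : ℝ) = (2 : ℕ) by norm_num,
      Real.rpow_natCast]
    congr 2
    push_cast
    ring
  have h2 := integral_comp_abs (f := fun x => x ^ 4 * Real.exp (-x ^ 2 / 2))
  rw [h1] at h2
  rw [integral_gaussianReal_eq_integral_smul one_ne_zero]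
  have h3 : ∀ x : ℝ, gaussianPDFReal 0 1 x • x ^ 4 =
      (√(2 * Real.pi))⁻¹ * (|x| ^ 4 * Real.exp (-|x| ^ 2 / 2)) := by
    intro x
    rw [gaussianPDFReal, sq_abs, show |x| ^ 4 = x ^ 4 from Even.pow_abs (by decide) x]
    simp only [NNReal.coe_one, mul_one, sub_zero, smul_eq_mul]
    ring
  simp_rw [h3]
  rw [integral_const_mul, h2]
  have : 0 < √(2 * Real.pi) := Real.sqrt_pos.2 (by positivity)
  field_simp

theorem integral_sq_gaussianReal : ∫ x, x ^ 2 ∂gaussianReal 0 1 = 1 := by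
  have h := variance_id_gaussianReal (μ := 0) (v := 1)
  rw [variance_eq_sub (memLp_id_gaussianReal' 2 (by simp))] at h
  simpa [integral_id_gaussianReal] using h

theorem integrable_pow_gaussianReal (k : ℕ) : Integrable (fun x => x ^ k) (gaussianReal 0 1) := by
  have := (memLp_id_gaussianReal (μ := 0) (v := 1) k).integrable_norm_pow'
  refine (integrable_norm_iff (by fun_prop)).1 ?_
  simpa [norm_pow] using this

theorem lintegral_enorm_sq_gaussianReal : ∫⁻ x, ‖x ^ 2‖ₑ ∂gaussianReal 0 1 = 1 := by
  have h := ofReal_integral_eq_lintegral_ofReal (integrable_pow_gaussianReal 2)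
    (ae_of_all _ fun x => sq_nonneg x)
  rw [integral_sq_gaussianReal, ENNReal.ofReal_one] at h
  rw [h]
  refine lintegral_congr fun x => ?_
  rw [Real.enorm_of_nonneg (sq_nonneg x)]

theorem lintegral_enorm_one_sub_sq_gaussianReal_le :
    ∫⁻ x, ‖1 - x ^ 2‖ₑ ∂gaussianReal 0 1 ≤ 2 := by
  calc _ ≤ ∫⁻ x, (1 + ‖x ^ 2‖ₑ) ∂gaussianReal 0 1 :=
        lintegral_mono fun x => (enorm_sub_le).trans (by simp)
    _ = 2 := by
        rw [lintegral_add_left measurable_const, lintegral_enorm_sq_gaussianReal, lintegral_const,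
          measure_univ]
        norm_num

theorem integral_one_sub_sq_div_gaussianReal :
    ∫ x, (1 - x ^ 2) / √2 ∂gaussianReal 0 1 = 0 := by
  rw [integral_div, integral_sub (integrable_const _) (integrable_pow_gaussianReal 2),
    integral_sq_gaussianReal]
  simp

theorem integral_one_sub_sq_div_sq_gaussianReal :
    ∫ x, ((1 - x ^ 2) / √2) ^ 2 ∂gaussianReal 0 1 = 1 := by
  have : ∀ x : ℝ, ((1 - x ^ 2) / √2) ^ 2 = (1 - 2 * x ^ 2 + x ^ 4) / 2 := by
    intro x
    rw [div_pow, Real.sq_sqrt (by norm_num)]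
    ring
  simp_rw [this]
  have h2 := (integrable_pow_gaussianReal 2).const_mul 2
  have h1 : Integrable (fun x : ℝ => 1 - 2 * x ^ 2) (gaussianReal 0 1) := (integrable_const _).sub h2
  rw [integral_div, integral_add h1 (integrable_pow_gaussianReal 4), integral_sub (integrable_const _) h2, integral_const_mul, integral_sq_gaussianReal,
    integral_pow_four_gaussianReal]
  norm_num

/-! ### Diagonal quadratic forms and comparison in `L¹` -/

section

variable {Ω : Type*} [MeasurableSpace Ω] {P : Measure Ω} [IsProbabilityMeasure P]

/-- From `|exp (i x) - 1| ≤ |x|`. Thus a perturbation small in `L¹` does not affect limits of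
characteristic functions, whatever the dependence between the variables. -/
theorem enorm_charFun_map_sub_le {X X' : Ω → ℝ} (hX : AEMeasurable X P) (hX' : AEMeasurable X' P)
    (t : ℝ) : ‖charFun (P.map X) t - charFun (P.map X') t‖ₑ ≤
      ‖t‖ₑ * ∫⁻ ω, ‖X ω - X' ω‖ₑ ∂P := by
  have hi : ∀ {Z : Ω → ℝ}, AEMeasurable Z P →
      Integrable (fun ω => Complex.exp (t * Z ω * Complex.I)) P := by
    intro Z hZ
    refine Integrable.of_bound (AEMeasurable.aestronglyMeasurable (by fun_prop)) 1
      (ae_of_all _ fun ω => ?_)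
    have : (t : ℂ) * Z ω * Complex.I = ((t * Z ω : ℝ) : ℂ) * Complex.I := by push_cast; rfl
    rw [this, Complex.norm_exp_ofReal_mul_I]
  rw [charFun_apply_real, charFun_apply_real, integral_map hX (by fun_prop),
    integral_map hX' (by fun_prop), ← integral_sub (hi hX) (hi hX')]
  refine (enorm_integral_le_lintegral_enorm _).trans ?_
  rw [← lintegral_const_mul' _ _ enorm_ne_top]
  refine lintegral_mono fun ω => ?_
  have : Complex.exp (t * X ω * Complex.I) - Complex.exp (t * X' ω * Complex.I) =
      Complex.exp ((t * X' ω : ℝ) * Complex.I) *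
        (Complex.exp (Complex.I * (t * (X ω - X' ω) : ℝ)) - 1) := by
    rw [mul_sub, ← Complex.exp_add, mul_one]
    push_cast
    congr 2
    ring
  rw [this, enorm_mul, ← enorm_mul t]
  have h1 : ‖Complex.exp ((t * X' ω : ℝ) * Complex.I)‖ₑ = 1 := by
    rw [← ofReal_norm, Complex.norm_exp_ofReal_mul_I, ENNReal.ofReal_one]
  rw [h1, one_mul]
  exact Real.enorm_exp_I_mul_ofReal_sub_one_le

theorem tendsto_charFun_map_of_lintegral_sub {X X' : ℕ → Ω → ℝ} (hX : ∀ n, AEMeasurable (X n) P)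
    (hX' : ∀ n, AEMeasurable (X' n) P)
    (h : Tendsto (fun n => ∫⁻ ω, ‖X n ω - X' n ω‖ₑ ∂P) atTop (𝓝 0)) {t : ℝ} {z : ℂ}
    (hz : Tendsto (fun n => charFun (P.map (X n)) t) atTop (𝓝 z)) :
    Tendsto (fun n => charFun (P.map (X' n)) t) atTop (𝓝 z) := by
  have h0 : Tendsto (fun n => charFun (P.map (X n)) t - charFun (P.map (X' n)) t) atTop (𝓝 0) := by
    rw [tendsto_zero_iff_enorm_tendsto_zero]
    refine tendsto_of_tendsto_of_tendsto_of_le_of_le tendsto_const_nhds ?_ (fun _ => zero_le)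
      fun n => enorm_charFun_map_sub_le (hX n) (hX' n) t
    simpa using ENNReal.Tendsto.const_mul h (Or.inr (enorm_ne_top (x := t)))
  simpa using hz.sub h0

/-- A quadratic form that is diagonal in the coordinates. -/
def weightedSquares (w x : ℤ → ℝ) : ℝ := ∑' k, w k * x k ^ 2

theorem measurable_weightedSquares (w : ℤ → ℝ) : Measurable (weightedSquares w) := by
  unfold weightedSquares
  exact Measurable.tsum fun k => by fun_prop

end

section

variable {Ω : Type*} [MeasurableSpace Ω] {P : Measure Ω}

theorem lintegral_enorm_mul_sq {X : Ω → ℝ} (hX : HasLaw X (gaussianReal 0 1) P) (a : ℝ) :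
    ∫⁻ ω, ‖a * X ω ^ 2‖ₑ ∂P = ‖a‖ₑ := by
  simp_rw [enorm_mul]
  rw [lintegral_const_mul' _ _ enorm_ne_top, hX.lintegral_comp (f := fun x => ‖x ^ 2‖ₑ)
    (by fun_prop), lintegral_enorm_sq_gaussianReal, mul_one]

/-- Since `Y_k²` has mean one, the expected sum of absolute values is `∑ |w_k|`, which is finite. -/
theorem ae_summable_mul_sq {Y : ℤ → Ω → ℝ} (hY : ∀ j, HasLaw (Y j) (gaussianReal 0 1) P)
    {w : ℤ → ℝ} (hw : Summable w) : ∀ᵐ ω ∂P, Summable fun k => w k * Y k ω ^ 2 := by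
  have hYm := fun j => (hY j).aemeasurable
  have hw' : ∑' k, ‖w k‖ₑ ≠ ∞ := by
    simp_rw [enorm_eq_nnnorm]
    rw [ENNReal.tsum_coe_ne_top_iff_summable]
    exact NNReal.summable_coe.1 (by simpa using hw.abs)
  have h : ∫⁻ ω, ∑' k, ‖w k * Y k ω ^ 2‖ₑ ∂P ≠ ∞ := by
    rw [lintegral_tsum fun k => by fun_prop]
    simp_rw [lintegral_enorm_mul_sq (hY _)]
    exact hw'
  filter_upwards [ae_lt_top' (AEMeasurable.tsum fun k => by fun_prop) h] with ω hω
  have h2 := hω.ne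
  simp_rw [enorm_eq_nnnorm] at h2
  rw [ENNReal.tsum_coe_ne_top_iff_summable] at h2
  exact h2.of_nnnorm

theorem lintegral_enorm_weightedSquares_sub_le {Y : ℤ → Ω → ℝ}
    (hY : ∀ j, HasLaw (Y j) (gaussianReal 0 1) P) {w w' : ℤ → ℝ} (hw : Summable w)
    (hw' : Summable w') :
    ∫⁻ ω, ‖weightedSquares w (fun k => Y k ω) - weightedSquares w' (fun k => Y k ω)‖ₑ ∂P ≤
      ENNReal.ofReal (∑' k, |w k - w' k|) := by
  have hYm := fun j => (hY j).aemeasurable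
  rw [ENNReal.ofReal_tsum_of_nonneg (fun k => abs_nonneg _) (hw.sub hw').abs]
  simp_rw [← Real.enorm_eq_ofReal_abs, ← fun k => lintegral_enorm_mul_sq (hY k) (w k - w' k)]
  rw [← lintegral_tsum fun k => by fun_prop]
  refine lintegral_mono_ae ?_
  filter_upwards [ae_summable_mul_sq hY hw, ae_summable_mul_sq hY hw'] with ω h1 h2
  rw [weightedSquares, weightedSquares, ← h1.tsum_sub h2]
  refine (enorm_tsum_le_tsum_enorm).trans (le_of_eq (tsum_congr fun k => ?_))
  rw [sub_mul]

theorem charFun_map_sum_comp {Y : ℤ → Ω → ℝ} (hY : ∀ j, HasLaw (Y j) (gaussianReal 0 1) P)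
    (hind : iIndepFun Y P) {g : ℤ → ℝ → ℝ} (hg : ∀ k, Measurable (g k)) (S : Finset ℤ) (t : ℝ) :
    charFun (P.map fun ω => ∑ k ∈ S, g k (Y k ω)) t =
      ∏ k ∈ S, charFun ((gaussianReal 0 1).map (g k)) t := by
  have hYm := fun j => (hY j).aemeasurable
  have hind' : iIndepFun (fun k ω => g k (Y k ω)) P := hind.comp g hg
  rw [iIndepFun.charFun_map_fun_finsetSum_eq_prod (X := fun k ω => g k (Y k ω))
    (fun k _ => (hg k).comp_aemeasurable (hYm k)) (hind'.restrict _), Finset.prod_apply]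
  refine Finset.prod_congr rfl fun k _ => ?_
  rw [← (hY k).map_eq, AEMeasurable.map_map_of_aemeasurable (hg k).aemeasurable (hYm k)]
  rfl

end

/-! ### Central limit theorem for the squares -/

theorem norm_pow_sub_one_le {z : ℂ} (hz : ‖z‖ ≤ 1) (q : ℕ) : ‖z ^ q - 1‖ ≤ q * ‖z - 1‖ := by
  induction q with
  | zero => simp
  | succ q ih =>
    calc ‖z ^ (q + 1) - 1‖ = ‖z * (z ^ q - 1) + (z - 1)‖ := by congr 1; ring
      _ ≤ ‖z‖ * ‖z ^ q - 1‖ + ‖z - 1‖ := (norm_add_le _ _).trans (by rw [norm_mul])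
      _ ≤ 1 * (q * ‖z - 1‖) + ‖z - 1‖ := by gcongr
      _ = (q + 1 : ℕ) * ‖z - 1‖ := by push_cast; ring

theorem norm_charFun_one_sub_sq_sub_one_le {s : ℝ} (hs : 0 < s) (t : ℝ) :
    ‖charFun ((gaussianReal 0 1).map fun x => (1 - x ^ 2) / s) t - 1‖ ≤ 2 * |t| / s := by
  have h := enorm_charFun_map_sub_le (P := gaussianReal 0 1) (X := fun x => (1 - x ^ 2) / s)
    (X' := fun _ => 0) (by fun_prop) (by fun_prop) t
  have h1 : charFun ((gaussianReal 0 1).map fun _ => (0 : ℝ)) t = 1 := by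
    rw [Measure.map_const, measure_univ, one_smul, charFun_dirac]
    simp
  have h2 : ∫⁻ x, ‖(1 - x ^ 2) / s - 0‖ₑ ∂gaussianReal 0 1 ≤ ENNReal.ofReal (2 / s) := by
    have : ∀ x : ℝ, ‖(1 - x ^ 2) / s - 0‖ₑ = ‖s⁻¹‖ₑ * ‖1 - x ^ 2‖ₑ := by
      intro x
      rw [sub_zero, div_eq_inv_mul, enorm_mul]
    simp_rw [this]
    rw [lintegral_const_mul' _ _ enorm_ne_top, Real.enorm_of_nonneg (by positivity),
      div_eq_inv_mul, ENNReal.ofReal_mul (by positivity)]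
    gcongr
    simpa using lintegral_enorm_one_sub_sq_gaussianReal_le
  rw [h1] at h
  have h3 : ‖charFun ((gaussianReal 0 1).map fun x => (1 - x ^ 2) / s) t - 1‖ₑ ≤
      ENNReal.ofReal (2 * |t| / s) := by
    refine h.trans ((mul_le_mul_right h2 _).trans (le_of_eq ?_))
    rw [Real.enorm_eq_ofReal_abs, ← ENNReal.ofReal_mul (abs_nonneg _)]
    congr 1
    ring
  rw [← ofReal_norm] at h3
  exact (ENNReal.ofReal_le_ofReal_iff (by positivity)).1 h3

/-- The central limit theorem for `(1 - x²) / √2`, of mean zero and variance one, gives the limit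
for `n` summands. Removing `n - p n` of them costs at most `2 |t| (n - p n) / √n`. -/
theorem tendsto_charFun_one_sub_sq_pow {p : ℕ → ℕ} (hp : ∀ n, p n ≤ n)
    (h : Tendsto (fun n => ((n - p n : ℕ) : ℝ) / √n) atTop (𝓝 0)) (t : ℝ) :
    Tendsto (fun n : ℕ => charFun ((gaussianReal 0 1).map fun x => (1 - x ^ 2) / √n) t ^ p n) atTop
      (𝓝 (Complex.exp (-t ^ 2))) := by
  have h1 : Tendsto (fun n : ℕ => charFun ((gaussianReal 0 1).map fun x => (1 - x ^ 2) / √n) t ^ n)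
      atTop (𝓝 (Complex.exp (-t ^ 2))) := by
    have := tendsto_charFun_inv_sqrt_mul_pow (P := gaussianReal 0 1)
      (X := fun x => (1 - x ^ 2) / √2) (by fun_prop) integral_one_sub_sq_div_gaussianReal
      integral_one_sub_sq_div_sq_gaussianReal (√2 * t)
    have e : (-(((√2 * t : ℝ) : ℂ)) ^ 2 / 2) = -t ^ 2 := by
      rw [← Complex.ofReal_pow, mul_pow, Real.sq_sqrt (by norm_num)]
      push_cast
      ring
    rw [e] at this
    refine this.congr fun n => ?_
    congr 1
    rw [show (√(n : ℝ))⁻¹ * (√2 * t) = ((√(n : ℝ))⁻¹ * √2) * t by ring, ← charFun_map_mul_comp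
      (by fun_prop)]
    congr 2
    ext x
    have : √(2 : ℝ) ≠ 0 := by positivity
    field_simp
  have h0 : Tendsto (fun n : ℕ =>
      charFun ((gaussianReal 0 1).map fun x => (1 - x ^ 2) / √n) t ^ n -
      charFun ((gaussianReal 0 1).map fun x => (1 - x ^ 2) / √n) t ^ p n) atTop (𝓝 0) := by
    have hl : Tendsto (fun n : ℕ => ((n - p n : ℕ) : ℝ) / √n * (2 * |t|)) atTop (𝓝 0) := by
      simpa using h.mul_const (2 * |t|)
    refine squeeze_zero_norm' ?_ hl
    filter_upwards [eventually_gt_atTop 0] with n hn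
    have hs : 0 < √(n : ℝ) := Real.sqrt_pos.2 (by exact_mod_cast hn)
    have hprob : IsProbabilityMeasure ((gaussianReal 0 1).map fun x => (1 - x ^ 2) / √(n : ℝ)) :=
      Measure.isProbabilityMeasure_map (by fun_prop)
    set z := charFun ((gaussianReal 0 1).map fun x => (1 - x ^ 2) / √(n : ℝ)) t with hz
    have hz1 : ‖z‖ ≤ 1 := norm_charFun_le_one t
    have e : z ^ n - z ^ p n = z ^ p n * (z ^ (n - p n) - 1) := by
      rw [mul_sub, ← pow_add, Nat.add_sub_cancel' (hp n), mul_one]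
    rw [e, norm_mul, norm_pow]
    calc ‖z‖ ^ p n * ‖z ^ (n - p n) - 1‖ ≤ 1 * (((n - p n : ℕ) : ℝ) * (2 * |t| / √n)) := by
          refine mul_le_mul (pow_le_one₀ (norm_nonneg _) hz1) ?_ (norm_nonneg _) zero_le_one
          exact (norm_pow_sub_one_le hz1 _).trans (mul_le_mul_of_nonneg_left
            (norm_charFun_one_sub_sq_sub_one_le hs t) (Nat.cast_nonneg _))
      _ = _ := by ring
  simpa using h1.sub h0

/-! ### Signed frequencies of the nonconstant modes -/

/-- The signed frequency, in `(-(m + 1) / 2, (m + 1) / 2]`, of the nonconstant mode `i + 1`. -/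
def signedMode (m : ℕ) (i : Fin m) : ℤ := if 2 * ((i : ℤ) + 1) ≤ m + 1 then i + 1 else i - m

theorem signedMode_injective (m : ℕ) : Function.Injective (signedMode m) := by
  intro i j h
  have hi := i.2
  have hj := j.2
  unfold signedMode at h
  ext
  split_ifs at h <;> omega

theorem signedMode_ne_zero (m : ℕ) (i : Fin m) : signedMode m i ≠ 0 := by
  have hi := i.2
  unfold signedMode
  split_ifs <;> omega

theorem two_mul_abs_signedMode_le (m : ℕ) (i : Fin m) : 2 * |(signedMode m i)| ≤ m + 1 := by
  have hi := i.2
  unfold signedMode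
  split_ifs
  · rw [abs_of_nonneg (by omega)]; omega
  · rw [abs_of_nonpos (by omega)]; omega

theorem eigenvalue_signedMode (m r : ℕ) (i : Fin m) :
    eigenvalue (m + 1) r (signedMode m i) =
      eigenvalue (m + 1) r ((i.succ : Fin (m + 1)) : ℕ) := by
  unfold signedMode
  split_ifs
  · simp
  · rw [← eigenvalue_sub_natCast (m + 1) r ((i.succ : Fin (m + 1)) : ℕ)]
    congr 1
    simp

/-- The set of signed frequencies of the nonconstant modes. -/
def modes (m : ℕ) : Finset ℤ := Finset.univ.map ⟨signedMode m, signedMode_injective m⟩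

theorem card_modes (m : ℕ) : (modes m).card = m := by simp [modes]

theorem mem_modes {m : ℕ} {k : ℤ} (hk : k ≠ 0) (h : 2 * |k| ≤ m) : k ∈ modes m := by
  simp only [modes, Finset.mem_map, Finset.mem_univ, true_and, Function.Embedding.coeFn_mk]
  rcases lt_or_gt_of_ne hk with h0 | h0
  · rw [abs_of_neg h0] at h
    refine ⟨⟨(k + m).toNat, by omega⟩, ?_⟩
    simp only [signedMode]
    rw [if_neg (by omega)]
    omega
  · rw [abs_of_pos h0] at h
    refine ⟨⟨(k - 1).toNat, by omega⟩, ?_⟩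
    simp only [signedMode]
    rw [if_pos (by omega)]
    omega

theorem sum_modes (m : ℕ) (f : ℤ → ℝ) : ∑ k ∈ modes m, f k = ∑ i, f (signedMode m i) := by
  simp [modes]

theorem weightedSquares_indicator (S : Finset ℤ) (w x : ℤ → ℝ) :
    weightedSquares ((S : Set ℤ).indicator w) x = ∑ k ∈ S, w k * x k ^ 2 := by
  rw [weightedSquares, tsum_eq_sum (s := S) fun k hk => by
    rw [Set.indicator_of_notMem (by simpa using hk), zero_mul]]
  exact Finset.sum_congr rfl fun k hk => by rw [Set.indicator_of_mem (by simpa using hk)]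

theorem summable_indicator_finset (S : Finset ℤ) (w : ℤ → ℝ) :
    Summable ((S : Set ℤ).indicator w) :=
  summable_of_ne_finset_zero (s := S) fun k hk => Set.indicator_of_notMem (by simpa using hk) _

theorem charFun_gaussianReal_sqrt_two_mul (t : ℝ) :
    charFun ((gaussianReal 0 1).map fun x => √2 * x) t = Complex.exp (-t ^ 2) := by
  rw [charFun_map_mul, charFun_gaussianReal]
  congr 1
  have : ((√2 : ℝ) : ℂ) ^ 2 = 2 := by
    rw [← Complex.ofReal_pow, Real.sq_sqrt (by norm_num)]
    simp
  push_cast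
  rw [mul_pow, this]
  ring

section

variable {Ω : Type*} [MeasurableSpace Ω] {P : Measure Ω}

theorem tendsto_lintegral_weightedSquares_sub {Y : ℤ → Ω → ℝ}
    (hY : ∀ j, HasLaw (Y j) (gaussianReal 0 1) P) {w w' : ℕ → ℤ → ℝ}
    (hw : ∀ m, Summable (w m)) (hw' : ∀ m, Summable (w' m)) {b : ℤ → ℝ} (hb : Summable b)
    (hwb : ∀ᶠ m in atTop, ∀ k, |w m k - w' m k| ≤ b k)
    (h : ∀ k, Tendsto (fun m => w m k - w' m k) atTop (𝓝 0)) :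
    Tendsto (fun m => ∫⁻ ω, ‖weightedSquares (w m) (fun k => Y k ω) -
      weightedSquares (w' m) (fun k => Y k ω)‖ₑ ∂P) atTop (𝓝 0) := by
  have h1 : Tendsto (fun m => ∑' k, |w m k - w' m k|) atTop (𝓝 0) := by
    have := tendsto_tsum_of_dominated_convergence (f := fun m k => |w m k - w' m k|)
      (g := fun _ => 0) hb (fun k => by simpa using (h k).abs)
      (hwb.mono fun m hm k => by simpa using hm k)
    simpa using this
  have h2 := ENNReal.tendsto_ofReal h1
  rw [ENNReal.ofReal_zero] at h2
  exact tendsto_of_tendsto_of_tendsto_of_le_of_le tendsto_const_nhds h2 (fun _ => zero_le)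
    fun m => lintegral_enorm_weightedSquares_sub_le hY (hw m) (hw' m)

theorem aemeasurable_weightedSquares {Y : ℤ → Ω → ℝ} (hY : ∀ j, AEMeasurable (Y j) P)
    (w : ℤ → ℝ) : AEMeasurable (fun ω => weightedSquares w fun k => Y k ω) P :=
  (measurable_weightedSquares w).comp_aemeasurable (aemeasurable_pi_lambda _ hY)

variable [IsProbabilityMeasure P]

theorem tendsto_charFun_neg_weightedSquares {Y : ℤ → Ω → ℝ}
    (hY : ∀ j, HasLaw (Y j) (gaussianReal 0 1) P) {w : ℤ → ℝ} (hw : Summable w)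
    {S : ℕ → Finset ℤ} (hS : ∀ k, ∀ᶠ m in atTop, k ∈ S m) {U : Ω → ℝ} (hU : AEMeasurable U P)
    (t : ℝ) :
    Tendsto (fun m => charFun (P.map fun ω =>
        U ω - weightedSquares ((S m : Set ℤ).indicator w) fun k => Y k ω) t) atTop
      (𝓝 (charFun (P.map fun ω => U ω - weightedSquares w fun k => Y k ω) t)) := by
  have hYm := fun j => (hY j).aemeasurable
  have hD := fun w => aemeasurable_weightedSquares hYm w
  refine tendsto_charFun_map_of_lintegral_sub
    (X := fun _ ω => U ω - weightedSquares w fun k => Y k ω)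
    (X' := fun m ω => U ω - weightedSquares ((S m : Set ℤ).indicator w) fun k => Y k ω) (fun m => hU.sub (hD _))
    (fun m => hU.sub (hD _)) ?_ tendsto_const_nhds
  have := tendsto_lintegral_weightedSquares_sub hY (w := fun m => (S m : Set ℤ).indicator w)
    (w' := fun _ => w) (fun m => summable_indicator_finset _ _) (fun _ => hw) (b := fun k => |w k|)
    hw.abs (Eventually.of_forall fun m k => ?_) fun k => ?_
  · refine this.congr fun m => lintegral_congr fun ω => ?_
    congr 1
    ring
  · by_cases hk : k ∈ (S m : Set ℤ)
    · rw [Set.indicator_of_mem hk]; simp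
    · rw [Set.indicator_of_notMem hk]; simp
  · refine tendsto_const_nhds.congr' ?_
    filter_upwards [hS k] with m hm
    rw [Set.indicator_of_mem (by simpa using hm), sub_self]

/-- The condition `w 0 = 0` keeps `Y 0` out of the quadratic form, so the two parts are independent.
The product formula is obtained for finite truncations and passes to the limit. -/
theorem charFun_sqrt_two_mul_sub_weightedSquares {Y : ℤ → Ω → ℝ}
    (hY : ∀ j, HasLaw (Y j) (gaussianReal 0 1) P) (hind : iIndepFun Y P) {w : ℤ → ℝ}
    (hw : Summable w) (hw0 : w 0 = 0) (t : ℝ) :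
    charFun (P.map fun ω => √2 * Y 0 ω - weightedSquares w fun k => Y k ω) t =
      Complex.exp (-t ^ 2) * charFun (P.map fun ω => 0 - weightedSquares w fun k => Y k ω) t := by
  have hYm := fun j => (hY j).aemeasurable
  have hS : ∀ k, ∀ᶠ m : ℕ in atTop, k ∈ Finset.Icc (-(m : ℤ)) m := by
    intro k
    filter_upwards [eventually_ge_atTop k.natAbs] with m hm
    rw [Finset.mem_Icc]
    omega
  have h1 := tendsto_charFun_neg_weightedSquares hY hw hS (U := fun ω => √2 * Y 0 ω)
    ((hYm 0).const_mul _) t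
  have h2 := (tendsto_charFun_neg_weightedSquares hY hw hS (U := fun _ => 0)
    aemeasurable_const t).const_mul (Complex.exp (-t ^ 2))
  refine tendsto_nhds_unique h1 (h2.congr fun m => ?_)
  set S := Finset.Icc (-(m : ℤ)) m with hSdef
  have hmem : (0 : ℤ) ∈ S := by simp [hSdef]
  have e1 : charFun (P.map fun ω =>
      0 - weightedSquares ((S : Set ℤ).indicator w) fun k => Y k ω) t =
      ∏ k ∈ S, charFun ((gaussianReal 0 1).map fun x => -(w k * x ^ 2)) t := by
    rw [← charFun_map_sum_comp hY hind (g := fun k x => -(w k * x ^ 2)) (fun k => by fun_prop)]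
    congr 2
    ext ω
    rw [weightedSquares_indicator, zero_sub, Finset.sum_neg_distrib]
  have e2 : charFun (P.map fun ω =>
      √2 * Y 0 ω - weightedSquares ((S : Set ℤ).indicator w) fun k => Y k ω) t =
      ∏ k ∈ S, charFun ((gaussianReal 0 1).map
        fun x => if k = 0 then √2 * x else -(w k * x ^ 2)) t := by
    rw [← charFun_map_sum_comp hY hind (g := fun k x => if k = 0 then √2 * x else -(w k * x ^ 2))
      (fun k => by split_ifs <;> fun_prop)]
    congr 2
    ext ω
    rw [weightedSquares_indicator, ← Finset.add_sum_erase _ _ hmem,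
      ← Finset.add_sum_erase _ _ hmem, hw0, zero_mul, zero_add, sub_eq_add_neg]
    congr 1
    rw [← Finset.sum_neg_distrib]
    exact Finset.sum_congr rfl fun k hk => by simp [(Finset.mem_erase.1 hk).1]
  rw [e1, e2, ← Finset.mul_prod_erase _ _ hmem, ← Finset.mul_prod_erase _ _ hmem]
  have e3 : charFun ((gaussianReal 0 1).map fun x => -(w 0 * x ^ 2)) t = 1 := by
    simp [hw0, Measure.map_const, charFun_dirac]
  rw [e3, one_mul]
  congr 1
  · simp only [if_true]
    exact (charFun_gaussianReal_sqrt_two_mul t).symm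
  · refine Finset.prod_congr rfl fun k hk => ?_
    simp only [if_neg (Finset.mem_erase.1 hk).1]

end

/-! ### Decoupling of low and high frequencies -/

/-- The range of low frequencies that is asymptotically negligible in number. -/
def lowModes (m : ℕ) : Finset ℤ := Finset.Icc (-(Nat.sqrt (Nat.sqrt m) : ℤ)) (Nat.sqrt (Nat.sqrt m))

theorem eventually_mem_lowModes (k : ℤ) : ∀ᶠ m in atTop, k ∈ lowModes m := by
  filter_upwards [eventually_ge_atTop ((k.natAbs * k.natAbs) * (k.natAbs * k.natAbs))] with m hm
  have : k.natAbs ≤ Nat.sqrt (Nat.sqrt m) := Nat.le_sqrt.2 (Nat.le_sqrt.2 hm)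
  rw [lowModes, Finset.mem_Icc]
  omega

theorem card_lowModes_div_sqrt_le (m : ℕ) :
    ((lowModes m).card : ℝ) / √((m + 1 : ℕ) : ℝ) ≤ 3 / √(√((m + 1 : ℕ) : ℝ)) := by
  have hn : (1 : ℝ) ≤ ((m + 1 : ℕ) : ℝ) := by push_cast; linarith [(Nat.cast_nonneg m : (0:ℝ) ≤ m)]
  set n : ℝ := ((m + 1 : ℕ) : ℝ)
  have hs1 : 1 ≤ √n := Real.one_le_sqrt.2 hn
  have hs2 : 1 ≤ √(√n) := Real.one_le_sqrt.2 hs1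
  have hK : (Nat.sqrt (Nat.sqrt m) : ℝ) ≤ √(√n) := by
    refine Real.le_sqrt_of_sq_le (Real.le_sqrt_of_sq_le ?_)
    have h : Nat.sqrt (Nat.sqrt m) ^ 2 ^ 2 ≤ m + 1 := by
      have h1 := Nat.sqrt_le' m
      have h2 := Nat.sqrt_le' (Nat.sqrt m)
      have h3 := Nat.pow_le_pow_left h2 2
      rw [← pow_mul] at h3
      exact (h3.trans h1).trans (Nat.le_succ m)
    have h' : (Nat.sqrt (Nat.sqrt m) : ℝ) ^ 2 ^ 2 ≤ ((m + 1 : ℕ) : ℝ) := by exact_mod_cast h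
    rw [← pow_mul]
    exact h'
  have hc : ((lowModes m).card : ℝ) = 2 * Nat.sqrt (Nat.sqrt m) + 1 := by
    rw [lowModes, Int.card_Icc]
    have : ((Nat.sqrt (Nat.sqrt m) : ℤ) + 1 - -(Nat.sqrt (Nat.sqrt m) : ℤ)).toNat =
      2 * Nat.sqrt (Nat.sqrt m) + 1 := by omega
    rw [this]
    push_cast
    rfl
  rw [hc, div_le_div_iff₀ (by linarith) (by linarith)]
  have e : √n = √(√n) * √(√n) := (Real.mul_self_sqrt (by linarith)).symm
  nlinarith

theorem tendsto_inv_sqrt_sqrt_succ :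
    Tendsto (fun m : ℕ => 3 / √(√((m + 1 : ℕ) : ℝ))) atTop (𝓝 0) := by
  have h : Tendsto (fun m : ℕ => ((m + 1 : ℕ) : ℝ)) atTop atTop :=
    tendsto_natCast_atTop_atTop.comp (tendsto_add_atTop_nat 1)
  exact Tendsto.div_atTop tendsto_const_nhds
    (Real.tendsto_sqrt_atTop.comp (Real.tendsto_sqrt_atTop.comp h))

theorem tendsto_card_lowModes_div_sqrt :
    Tendsto (fun m : ℕ => ((lowModes m).card : ℝ) / √((m + 1 : ℕ) : ℝ)) atTop (𝓝 0) :=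
  squeeze_zero (fun m => by positivity) card_lowModes_div_sqrt_le tendsto_inv_sqrt_sqrt_succ

theorem one_le_card_lowModes (m : ℕ) : 1 ≤ (lowModes m).card :=
  Finset.card_pos.2 ⟨0, by simp [lowModes]⟩

theorem tendsto_charFun_highModes_pow (t : ℝ) :
    Tendsto (fun m : ℕ => charFun ((gaussianReal 0 1).map fun x => (1 - x ^ 2) / √((m + 1 : ℕ) : ℝ)) t
      ^ (modes m \ lowModes m).card) atTop (𝓝 (Complex.exp (-t ^ 2))) := by
  let p : ℕ → ℕ := fun n => (modes (n - 1) \ lowModes (n - 1)).card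
  have hp : ∀ n, p n ≤ n := fun n =>
    (Finset.card_le_card Finset.sdiff_subset).trans ((card_modes _).le.trans (Nat.sub_le _ _))
  have hlim : Tendsto (fun n => ((n - p n : ℕ) : ℝ) / √n) atTop (𝓝 0) := by
    rw [← tendsto_add_atTop_iff_nat 1]
    have h0 := tendsto_card_lowModes_div_sqrt.const_mul 2
    rw [mul_zero] at h0
    refine squeeze_zero (fun m => by positivity) (fun m => ?_) h0
    rw [← mul_div_assoc]
    refine div_le_div_of_nonneg_right ?_ (Real.sqrt_nonneg _)
    -- Among `m + 1` indices, only the constant mode and at most the low modes are missing, and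
    -- there is at least one low mode.
    have h1 : (m + 1) - p (m + 1) ≤ 2 * (lowModes m).card := by
      have h2 := Finset.le_card_sdiff (lowModes m) (modes m)
      rw [card_modes] at h2
      have h3 := one_le_card_lowModes m
      simp only [p, Nat.add_sub_cancel]
      omega
    exact_mod_cast h1
  exact (tendsto_charFun_one_sub_sq_pow hp hlim t).comp (tendsto_add_atTop_nat 1)

/-- In the comparison variable only the fluctuations `(1 - Y_k²) / √n` are kept at high frequencies
and only `w_k Y_k²` at low ones. The two groups use disjoint coordinates, so the characteristic
function factors, with limits from the central limit theorem and from the convergent series. What is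
discarded is small in `L¹`: the low fluctuations number `o(√n)`, and the weights converge in `ℓ¹` by
domination. -/
theorem tendsto_charFun_modes {Ω : Type*} [MeasurableSpace Ω] {P : Measure Ω}
    [IsProbabilityMeasure P] {Y : ℤ → Ω → ℝ}
    (hY : ∀ j, HasLaw (Y j) (gaussianReal 0 1) P) (hind : iIndepFun Y P) {w : ℤ → ℝ}
    (hw : Summable w) (hw0 : w 0 = 0) {a : ℕ → ℤ → ℝ} {b : ℤ → ℝ} (hb : Summable b)
    (hb0 : ∀ k, 0 ≤ b k) (hab : ∀ᶠ m in atTop, ∀ k ∈ modes m, |a m k| ≤ b k)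
    (ha : ∀ k, k ≠ 0 → Tendsto (fun m => a m k) atTop (𝓝 (w k))) (t : ℝ) :
    Tendsto (fun m => charFun (P.map fun ω => 1 / √((m + 1 : ℕ) : ℝ) +
        ∑ k ∈ modes m, ((1 - Y k ω ^ 2) / √((m + 1 : ℕ) : ℝ) - a m k * Y k ω ^ 2)) t) atTop
      (𝓝 (charFun (P.map fun ω => √2 * Y 0 ω - weightedSquares w fun k => Y k ω) t)) := by
  have hYm := fun j => (hY j).aemeasurable
  have hD := fun w => aemeasurable_weightedSquares hYm w
  have hzero : ∀ m, (0 : ℤ) ∉ modes m := fun m h => by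
    simp only [modes, Finset.mem_map, Finset.mem_univ, true_and, Function.Embedding.coeFn_mk] at h
    obtain ⟨i, hi⟩ := h
    exact signedMode_ne_zero m i hi
  have hmodes : ∀ k : ℤ, k ≠ 0 → ∀ᶠ m in atTop, k ∈ modes m := fun k hk => by
    filter_upwards [eventually_ge_atTop (2 * k.natAbs)] with m hm
    exact mem_modes hk (by rw [Int.abs_eq_natAbs]; omega)
  -- The domination passes to the limit weights, as each nonzero frequency is eventually a mode.
  have hwb : ∀ k, |w k| ≤ b k := fun k => by
    rcases eq_or_ne k 0 with rfl | hk
    · simpa [hw0] using hb0 0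
    · refine le_of_tendsto (ha k hk).abs ?_
      filter_upwards [hab, hmodes k hk] with m hm hkm using hm k hkm
  let U : ℕ → Ω → ℝ := fun m ω => ∑ k ∈ modes m \ lowModes m, (1 - Y k ω ^ 2) / √((m + 1 : ℕ) : ℝ)
  have hU : ∀ m, AEMeasurable (U m) P := fun m => by fun_prop
  -- decoupling of the low and the high frequencies
  have hV : Tendsto (fun m => charFun (P.map fun ω =>
      U m ω - weightedSquares ((lowModes m : Set ℤ).indicator w) fun k => Y k ω) t) atTop
      (𝓝 (charFun (P.map fun ω => √2 * Y 0 ω - weightedSquares w fun k => Y k ω) t)) := by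
    rw [charFun_sqrt_two_mul_sub_weightedSquares hY hind hw hw0]
    refine ((tendsto_charFun_highModes_pow t).mul (tendsto_charFun_neg_weightedSquares hY hw
      eventually_mem_lowModes (U := fun _ => 0) aemeasurable_const t)).congr fun m => ?_
    have hdisj : Disjoint (modes m \ lowModes m) (lowModes m) := Finset.sdiff_disjoint
    have e1 : charFun (P.map fun ω =>
        0 - weightedSquares ((lowModes m : Set ℤ).indicator w) fun k => Y k ω) t =
        ∏ k ∈ lowModes m, charFun ((gaussianReal 0 1).map fun x => -(w k * x ^ 2)) t := by
      rw [← charFun_map_sum_comp hY hind (g := fun k x => -(w k * x ^ 2)) (fun k => by fun_prop)]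
      congr 2
      ext ω
      rw [weightedSquares_indicator, zero_sub, Finset.sum_neg_distrib]
    have e2 : charFun (P.map fun ω =>
        U m ω - weightedSquares ((lowModes m : Set ℤ).indicator w) fun k => Y k ω) t =
        ∏ k ∈ modes m \ lowModes m ∪ lowModes m, charFun ((gaussianReal 0 1).map fun x =>
          if k ∈ lowModes m then -(w k * x ^ 2) else (1 - x ^ 2) / √((m + 1 : ℕ) : ℝ)) t := by
      rw [← charFun_map_sum_comp hY hind (g := fun k x =>
        if k ∈ lowModes m then -(w k * x ^ 2) else (1 - x ^ 2) / √((m + 1 : ℕ) : ℝ))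
        (fun k => by split_ifs <;> fun_prop)]
      congr 2
      ext ω
      rw [weightedSquares_indicator, Finset.sum_union hdisj, sub_eq_add_neg,
        ← Finset.sum_neg_distrib]
      congr 1
      · exact Finset.sum_congr rfl fun k hk => by rw [if_neg (Finset.mem_sdiff.1 hk).2]
      · exact Finset.sum_congr rfl fun k hk => by rw [if_pos hk]
    rw [e1, e2, Finset.prod_union hdisj, ← Finset.prod_const]
    congr 1
    · exact Finset.prod_congr rfl fun k hk => by simp only [if_neg (Finset.mem_sdiff.1 hk).2]
    · exact Finset.prod_congr rfl fun k hk => by simp only [if_pos hk]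
  refine tendsto_charFun_map_of_lintegral_sub (X := fun m ω =>
      U m ω - weightedSquares ((lowModes m : Set ℤ).indicator w) fun k => Y k ω)
    (X' := fun m ω => 1 / √((m + 1 : ℕ) : ℝ) +
        ∑ k ∈ modes m, ((1 - Y k ω ^ 2) / √((m + 1 : ℕ) : ℝ) - a m k * Y k ω ^ 2))
    (fun m => (hU m).sub (hD _)) (fun m => by fun_prop) ?_ hV
  have hT := tendsto_lintegral_weightedSquares_sub hY
    (w := fun m => (modes m : Set ℤ).indicator (a m))
    (w' := fun m => (lowModes m : Set ℤ).indicator w)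
    (fun m => summable_indicator_finset _ _) (fun m => summable_indicator_finset _ _)
    (hb.mul_left 2) (by
      filter_upwards [hab] with m hm k
      have h1 : |(modes m : Set ℤ).indicator (a m) k| ≤ b k := by
        by_cases hk : k ∈ (modes m : Set ℤ)
        · rw [Set.indicator_of_mem hk]; exact hm k hk
        · rw [Set.indicator_of_notMem hk, abs_zero]; exact hb0 k
      have h2 : |(lowModes m : Set ℤ).indicator w k| ≤ b k := by
        by_cases hk : k ∈ (lowModes m : Set ℤ)
        · rw [Set.indicator_of_mem hk]; exact hwb k
        · rw [Set.indicator_of_notMem hk, abs_zero]; exact hb0 k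
      calc _ ≤ _ := abs_sub _ _
        _ ≤ 2 * b k := by linarith) (fun k => by
      rcases eq_or_ne k 0 with rfl | hk
      · refine tendsto_const_nhds.congr fun m => ?_
        rw [Set.indicator_of_notMem (by simpa using hzero m)]
        by_cases h : (0 : ℤ) ∈ (lowModes m : Set ℤ)
        · rw [Set.indicator_of_mem h, hw0, sub_self]
        · rw [Set.indicator_of_notMem h, sub_self]
      · have h0 := (ha k hk).sub_const (w k)
        rw [sub_self] at h0
        refine h0.congr' ?_
        filter_upwards [hmodes k hk, eventually_mem_lowModes k] with m h1 h2
        rw [Set.indicator_of_mem (by simpa using h1), Set.indicator_of_mem (by simpa using h2)])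
  have hE : Tendsto (fun m : ℕ => ENNReal.ofReal
      (3 * (((lowModes m).card : ℝ) / √((m + 1 : ℕ) : ℝ)))) atTop (𝓝 0) := by
    have := ENNReal.tendsto_ofReal (tendsto_card_lowModes_div_sqrt.const_mul 3)
    simpa using this
  have hsum := hE.add hT
  rw [add_zero] at hsum
  refine tendsto_of_tendsto_of_tendsto_of_le_of_le tendsto_const_nhds hsum (fun _ => zero_le)
    fun m => ?_
  set s : ℝ := √((m + 1 : ℕ) : ℝ) with hs
  have hs0 : 0 < s := Real.sqrt_pos.2 (by positivity)
  have hpt : ∀ ω, ‖(U m ω - weightedSquares ((lowModes m : Set ℤ).indicator w) fun k => Y k ω) -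
      (1 / s + ∑ k ∈ modes m, ((1 - Y k ω ^ 2) / s - a m k * Y k ω ^ 2))‖ₑ ≤
      (‖1 / s‖ₑ + ∑ k ∈ lowModes m, ‖1 / s‖ₑ * ‖1 - Y k ω ^ 2‖ₑ) +
        ‖weightedSquares ((modes m : Set ℤ).indicator (a m)) (fun k => Y k ω) -
          weightedSquares ((lowModes m : Set ℤ).indicator w) (fun k => Y k ω)‖ₑ := by
    intro ω
    have hsplit : ∑ k ∈ modes m, (1 - Y k ω ^ 2) / s =
        U m ω + ∑ k ∈ modes m ∩ lowModes m, (1 - Y k ω ^ 2) / s := by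
      rw [add_comm]
      exact (Finset.sum_inter_add_sum_sdiff (modes m) (lowModes m) _).symm
    have e : (U m ω - weightedSquares ((lowModes m : Set ℤ).indicator w) fun k => Y k ω) -
        (1 / s + ∑ k ∈ modes m, ((1 - Y k ω ^ 2) / s - a m k * Y k ω ^ 2)) =
        -(1 / s + ∑ k ∈ modes m ∩ lowModes m, 1 / s * (1 - Y k ω ^ 2)) +
        (weightedSquares ((modes m : Set ℤ).indicator (a m)) (fun k => Y k ω) -
          weightedSquares ((lowModes m : Set ℤ).indicator w) (fun k => Y k ω)) := by
      rw [Finset.sum_sub_distrib, hsplit, weightedSquares_indicator (modes m)]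
      have : ∑ k ∈ modes m ∩ lowModes m, (1 - Y k ω ^ 2) / s =
          ∑ k ∈ modes m ∩ lowModes m, 1 / s * (1 - Y k ω ^ 2) :=
        Finset.sum_congr rfl fun k _ => by ring
      rw [this]
      ring
    rw [e]
    refine (enorm_add_le _ _).trans (add_le_add_left ?_ _)
    rw [enorm_neg]
    refine (enorm_add_le _ _).trans (add_le_add_right ?_ _)
    refine (enorm_sum_le _ _).trans ?_
    simp_rw [enorm_mul]
    exact Finset.sum_le_sum_of_subset Finset.inter_subset_right
  refine (lintegral_mono hpt).trans ?_
  rw [lintegral_add_left' (by fun_prop)]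
  refine add_le_add_left ?_ _
  rw [lintegral_add_left' (by fun_prop), lintegral_const, measure_univ, mul_one,
    lintegral_finsetSum' _ fun k _ => by fun_prop]
  have hk : ∀ k ∈ lowModes m, ∫⁻ ω, ‖1 / s‖ₑ * ‖1 - Y k ω ^ 2‖ₑ ∂P ≤ ENNReal.ofReal (2 / s) := by
    intro k _
    rw [lintegral_const_mul' _ _ enorm_ne_top, (hY k).lintegral_comp (f := fun x => ‖1 - x ^ 2‖ₑ)
      (by fun_prop), Real.enorm_of_nonneg (by positivity), show 2 / s = 1 / s * 2 by ring,
      ENNReal.ofReal_mul (by positivity)]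
    gcongr
    simpa using lintegral_enorm_one_sub_sq_gaussianReal_le
  refine (add_le_add_right (Finset.sum_le_sum hk) _).trans ?_
  rw [Finset.sum_const, nsmul_eq_mul, Real.enorm_of_nonneg (by positivity), ← ENNReal.ofReal_natCast,
    ← ENNReal.ofReal_mul (by positivity), ← ENNReal.ofReal_add (by positivity) (by positivity)]
  refine ENNReal.ofReal_le_ofReal ?_
  have h1 : (1 : ℝ) ≤ (lowModes m).card := by exact_mod_cast one_le_card_lowModes m
  have : 1 / s ≤ (lowModes m).card / s := div_le_div_of_nonneg_right h1 hs0.le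
  linarith [show ((lowModes m).card : ℝ) * (2 / s) = 2 * ((lowModes m).card / s) by ring]

/-! ### The limit variable and the energy on a common probability space -/

theorem summable_div_sq (c : ℝ) : Summable fun k : ℤ => c / (k : ℝ) ^ 2 := by
  simpa [div_eq_mul_inv] using
    (Real.summable_one_div_int_pow (p := 2).2 (by norm_num)).mul_left c

/-- At `k = 0` the weight is a division by zero, hence zero, so the series may run over all
integers. -/
theorem limitVariable_eq {Ω : Type*} (lam : ℝ) (Y : ℤ → Ω → ℝ) (ω : Ω) :
    limitVariable lam Y ω = √2 * Y 0 ω -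
      weightedSquares (fun k => 3 / (2 * lam ^ 2 * Real.pi ^ 2) / (k : ℝ) ^ 2) fun k => Y k ω := by
  rw [limitVariable, weightedSquares, ← tsum_mul_left]
  congr 1
  refine (tsum_subtype {j : ℤ | j ≠ 0} fun j : ℤ =>
    3 / (2 * lam ^ 2 * Real.pi ^ 2) * (Y j ω ^ 2 / (j : ℝ) ^ 2)).trans ?_
  refine tsum_congr fun j => ?_
  by_cases hj : j = 0
  · simp [hj]
  · rw [Set.indicator_of_mem (show j ∈ {j : ℤ | j ≠ 0} from hj)]
    ring

section

variable {Ω : Type*} [MeasurableSpace Ω] {P : Measure Ω}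

theorem ae_summable_sq_div_sq {Y : ℤ → Ω → ℝ} (hY : ∀ j, HasLaw (Y j) (gaussianReal 0 1) P) :
    ∀ᵐ ω ∂P, Summable fun j : {j : ℤ // j ≠ 0} => Y j ω ^ 2 / (j : ℝ) ^ 2 := by
  filter_upwards [ae_summable_mul_sq hY (summable_div_sq 1)] with ω h
  refine (h.comp_injective Subtype.val_injective).congr fun j => ?_
  simp only [Function.comp_apply]
  ring

theorem aemeasurable_limitVariable (lam : ℝ) {Y : ℤ → Ω → ℝ}
    (hY : ∀ j, HasLaw (Y j) (gaussianReal 0 1) P) : AEMeasurable (limitVariable lam Y) P := by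
  have hYm := fun j => (hY j).aemeasurable
  have e : limitVariable lam Y = fun ω => √2 * Y 0 ω - weightedSquares
      (fun k => 3 / (2 * lam ^ 2 * Real.pi ^ 2) / (k : ℝ) ^ 2) fun k => Y k ω :=
    funext (limitVariable_eq lam Y)
  rw [e]
  exact ((hYm 0).const_mul _).sub (aemeasurable_weightedSquares hYm _)

variable [IsProbabilityMeasure P]

theorem pi_gaussianReal_eq_map {Y : ℤ → Ω → ℝ} (hY : ∀ j, HasLaw (Y j) (gaussianReal 0 1) P)
    (hind : iIndepFun Y P) {m : ℕ} {σ : Fin m → ℤ} (hσ : Function.Injective σ)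
    (v : Fin m → NNReal) :
    (Measure.pi fun i => gaussianReal 0 (v i)) = P.map fun ω i => √(v i) * Y (σ i) ω := by
  have hlaw : ∀ i, HasLaw (fun ω => √(v i) * Y (σ i) ω) (gaussianReal 0 (v i)) P := by
    intro i
    have h := gaussianReal_const_mul (hY (σ i)) (√(v i))
    have e : NNReal.mk (√(v i) ^ 2) (sq_nonneg _) * 1 = v i := by
      ext
      rw [mul_one]
      exact Real.sq_sqrt (v i).2
    rwa [e, mul_zero] at h
  have hind' : iIndepFun (fun i ω => √(v i) * Y (σ i) ω) P :=
    (hind.precomp hσ).comp (fun i x => √(v i) * x) fun i => by fun_prop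
  rw [(iIndepFun_iff_map_fun_eq_pi_map fun i => (hlaw i).aemeasurable).1 hind']
  congr 1
  ext1 i
  exact (hlaw i).map_eq.symm

theorem energyLaw_eq_map {Y : ℤ → Ω → ℝ} (hY : ∀ j, HasLaw (Y j) (gaussianReal 0 1) P)
    (hind : iIndepFun Y P) {m : ℕ} {v : Fin m → NNReal} {a : ℤ → ℝ}
    (hv : ∀ i, (v i : ℝ) = 1 + √((m + 1 : ℕ) : ℝ) * a (signedMode m i)) :
    energyLaw m v = P.map fun ω => 1 / √((m + 1 : ℕ) : ℝ) +
      ∑ k ∈ modes m, ((1 - Y k ω ^ 2) / √((m + 1 : ℕ) : ℝ) - a k * Y k ω ^ 2) := by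
  have hYm := fun j => (hY j).aemeasurable
  rw [energyLaw, pi_gaussianReal_eq_map hY hind (signedMode_injective m) v,
    AEMeasurable.map_map_of_aemeasurable (Measurable.aemeasurable (by fun_prop))
      (aemeasurable_pi_lambda _ fun i => (hYm _).const_mul _)]
  congr 1
  ext ω
  have hs0 : 0 < √((m + 1 : ℕ) : ℝ) := Real.sqrt_pos.2 (by positivity)
  -- There is one mode fewer than the dimension; the unit left over is the summand `1 / √(m + 1)`.
  have hm : (((m + 1 : ℕ) : ℝ)) = 1 + ∑ _i : Fin m, (1 : ℝ) := by simp [add_comm]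
  have h1 : (((m + 1 : ℕ) : ℝ)) - ∑ i, (√(v i) * Y (signedMode m i) ω) ^ 2 =
      1 + ∑ i, (1 - (√(v i) * Y (signedMode m i) ω) ^ 2) := by
    rw [Finset.sum_sub_distrib, hm]
    ring
  rw [sum_modes m fun k => (1 - Y k ω ^ 2) / √((m + 1 : ℕ) : ℝ) - a k * Y k ω ^ 2,
    Function.comp_apply, h1, add_div, Finset.sum_div]
  congr 1
  refine Finset.sum_congr rfl fun i _ => ?_
  rw [mul_pow, Real.sq_sqrt (NNReal.coe_nonneg _), hv]
  field_simp
  ring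

/-- The law of the limit variable is a convolution with a Gaussian of variance two, so it charges
the positive half-line, where the tilting factor is positive. -/
theorem invSqrtTilt_map_limitVariable_ne_zero (lam : ℝ) {Y : ℤ → Ω → ℝ}
    (hY : ∀ j, HasLaw (Y j) (gaussianReal 0 1) P) (hind : iIndepFun Y P) :
    invSqrtTilt (P.map (limitVariable lam Y)) Set.univ ≠ 0 := by
  have hYm := fun j => (hY j).aemeasurable
  set w : ℤ → ℝ := fun k => 3 / (2 * lam ^ 2 * Real.pi ^ 2) / (k : ℝ) ^ 2 with hw
  have e : limitVariable lam Y = fun ω => √2 * Y 0 ω - weightedSquares w fun k => Y k ω :=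
    funext (limitVariable_eq lam Y)
  have hDm := aemeasurable_weightedSquares hYm w
  have hprob : IsProbabilityMeasure (P.map fun ω => 0 - weightedSquares w fun k => Y k ω) :=
    Measure.isProbabilityMeasure_map (aemeasurable_const.sub hDm)
  set ν := P.map fun ω => 0 - weightedSquares w fun k => Y k ω with hν
  have hprob2 : IsProbabilityMeasure (P.map (limitVariable lam Y)) :=
    Measure.isProbabilityMeasure_map (aemeasurable_limitVariable lam hY)
  have hconv : P.map (limitVariable lam Y) = ν ∗ gaussianReal 0 2 := by
    refine Measure.ext_of_charFun (funext fun t => ?_)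
    rw [charFun_conv, e, charFun_sqrt_two_mul_sub_weightedSquares hY hind
      (summable_div_sq _) (by simp), charFun_gaussianReal, mul_comm]
    congr 2
    push_cast
    ring
  intro h0
  rw [invSqrtTilt, withDensity_apply _ MeasurableSet.univ, Measure.restrict_univ,
    lintegral_eq_zero_iff (by fun_prop)] at h0
  have h1 : P.map (limitVariable lam Y) (Set.Ioi 0) = 0 := by
    have h2 := (ae_restrict_iff' measurableSet_Ioi).1 h0
    refine measure_mono_null (fun x hx => ?_) h2
    have : 0 < 1 / √x := one_div_pos.2 (Real.sqrt_pos.2 hx)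
    simp only [Set.mem_compl_iff, Set.mem_ofPred_eq, Classical.not_imp, Pi.zero_apply,
      ENNReal.ofReal_eq_zero, not_le]
    exact ⟨hx, this⟩
  have hm : MeasurableSet ((fun x : ℝ × ℝ => x.1 + x.2) ⁻¹' Set.Ioi 0) :=
    measurableSet_Ioi.preimage (by fun_prop)
  rw [hconv, Measure.conv, Measure.map_apply (by fun_prop) measurableSet_Ioi,
    Measure.measure_prod_null hm] at h1
  obtain ⟨x, hx⟩ := h1.exists
  -- Lebesgue measure is absolutely continuous with respect to the Gaussian, so a null half-line
  -- would have Lebesgue measure zero.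
  have h2 := gaussianReal_absolutelyContinuous' 0 two_ne_zero hx
  have h3 : Prod.mk x ⁻¹' ((fun x : ℝ × ℝ => x.1 + x.2) ⁻¹' Set.Ioi 0) = Set.Ioi (-x) := by
    ext y
    simp only [Set.mem_preimage, Set.mem_Ioi]
    constructor <;> intro h <;> linarith
  rw [h3, Real.volume_Ioi] at h2
  exact ENNReal.top_ne_zero h2

end

/-! ### Convergence of the energy and of the magnetization -/

/-- The variances of the nonconstant modes. -/
def modeVariance (m r : ℕ) (i : Fin m) : NNReal :=
  (1 / (1 - eigenvalue (m + 1) r ((i.succ : Fin (m + 1)) : ℕ))).toNNReal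

theorem eigenvalue_succ_lt_one {r : ℕ} (hr : 0 < r) {m : ℕ} (i : Fin m) :
    eigenvalue (m + 1) r ((i.succ : Fin (m + 1)) : ℕ) < 1 := by
  refine eigenvalue_lt_one hr fun h => ?_
  have h1 := Nat.le_of_dvd (by simp) (Int.natCast_dvd_natCast.1 h)
  have := i.succ.2
  omega

theorem coe_modeVariance {r : ℕ} (hr : 0 < r) {m : ℕ} (i : Fin m) :
    (modeVariance m r i : ℝ) = 1 / (1 - eigenvalue (m + 1) r ((i.succ : Fin (m + 1)) : ℕ)) :=
  Real.coe_toNNReal _ (one_div_nonneg.2 (sub_nonneg.2 (eigenvalue_succ_lt_one hr i).le))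

theorem one_half_le_modeVariance {r : ℕ} (hr : 0 < r) {m : ℕ} (i : Fin m) :
    (1 / 2 : ℝ) ≤ modeVariance m r i := by
  rw [coe_modeVariance hr]
  have h1 := eigenvalue_succ_lt_one hr i
  have h2 := (abs_le.1 (abs_eigenvalue_le_one hr (m + 1) ((i.succ : Fin (m + 1)) : ℕ))).1
  exact one_div_le_one_div_of_le (by linarith) (by linarith)

section

variable {Ω : Type*} [MeasurableSpace Ω] {P : Measure Ω} [IsProbabilityMeasure P]

/-- By Lévy's continuity theorem only characteristic functions matter. The constant `lam / 2` serves
as an eventual lower bound for `r / n^{3/4}` in the domination of the weights. -/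
theorem tendsto_energyLaw {lam : ℝ} (hlam : 0 < lam) {r : ℕ → ℕ}
    (hr : Tendsto (fun m => (r m : ℝ) / ((m + 1 : ℕ) : ℝ) ^ (3 / 4 : ℝ)) atTop (𝓝 lam))
    (hr0 : ∀ᶠ m in atTop, 0 < r m)
    {Y : ℤ → Ω → ℝ} (hY : ∀ j, HasLaw (Y j) (gaussianReal 0 1) P) (hind : iIndepFun Y P)
    {κ : ProbabilityMeasure ℝ} (hκ : (κ : Measure ℝ) = P.map (limitVariable lam Y)) :
    Tendsto (β := ProbabilityMeasure ℝ)
      (fun m => ⟨energyLaw m (modeVariance m (r m)), inferInstance⟩) atTop (𝓝 κ) := by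
  refine ProbabilityMeasure.tendsto_of_tendsto_charFun fun t => ?_
  rw [hκ, funext (limitVariable_eq lam Y)]
  have hlo : 0 < lam / 2 := by linarith
  set b : ℤ → ℝ := fun k => (12 / (lam / 2) ^ 2 + 1 / (lam / 2)) * |(k : ℝ)| ^ (-(5 / 4) : ℝ) with hb
  have hbs : Summable b := (Real.summable_abs_int_rpow (by norm_num)).mul_left _
  have hb0 : ∀ k, 0 ≤ b k := fun k => by
    have := Real.rpow_nonneg (abs_nonneg (k : ℝ)) (-(5 / 4))
    positivity
  have hab : ∀ᶠ m in atTop, ∀ k ∈ modes m, |modeWeight (m + 1) (r m) k| ≤ b k := by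
    filter_upwards [hr0, hr.eventually_const_le (show lam / 2 < lam by linarith)] with m h0 h1 k hk
    simp only [modes, Finset.mem_map, Finset.mem_univ, true_and, Function.Embedding.coeFn_mk] at hk
    obtain ⟨i, rfl⟩ := hk
    refine abs_modeWeight_le hlo h0 ?_ (signedMode_ne_zero m i) ?_
    · rwa [← le_div_iff₀ (by positivity)]
    · have := two_mul_abs_signedMode_le m i
      exact_mod_cast this
  have hlim := tendsto_charFun_modes hY hind (summable_div_sq (3 / (2 * lam ^ 2 * Real.pi ^ 2)))
    (by simp) hbs hb0 hab (fun k hk => tendsto_modeWeight hlam hr hk) t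
  refine hlim.congr' ?_
  filter_upwards [hr0] with m h0
  have hs0 : 0 < √((m + 1 : ℕ) : ℝ) := Real.sqrt_pos.2 (by positivity)
  have e := energyLaw_eq_map hY hind (m := m) (v := modeVariance m (r m))
    (a := modeWeight (m + 1) (r m)) fun i => by
      rw [coe_modeVariance h0, modeWeight, eigenvalue_signedMode]
      field_simp
      ring
  change _ = charFun (energyLaw m (modeVariance m (r m))) t
  rw [e]

/-- The limit inherits the uniform density bound of the energies, so its density needs no separate
study. -/
theorem exists_map_limitVariable_le {lam : ℝ} (hlam : 0 < lam) {r : ℕ → ℕ}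
    (hr : Tendsto (fun m => (r m : ℝ) / ((m + 1 : ℕ) : ℝ) ^ (3 / 4 : ℝ)) atTop (𝓝 lam))
    (hr0 : ∀ᶠ m in atTop, 0 < r m)
    {Y : ℤ → Ω → ℝ} (hY : ∀ j, HasLaw (Y j) (gaussianReal 0 1) P) (hind : iIndepFun Y P) :
    ∃ C : ℝ≥0∞, C ≠ 0 ∧ C ≠ ∞ ∧ P.map (limitVariable lam Y) ≤ C • volume ∧
      ∀ᶠ m in atTop, energyLaw m (modeVariance m (r m)) ≤ C • volume := by
  obtain ⟨C, hC0, hC, h⟩ := exists_energyLaw_le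
  have hev : ∀ᶠ m in atTop, energyLaw m (modeVariance m (r m)) ≤ C • volume := by
    filter_upwards [hr0, eventually_ge_atTop 4] with m h0 hm
    exact h m _ hm (one_half_le_modeVariance h0)
  have hprob := Measure.isProbabilityMeasure_map (aemeasurable_limitVariable lam hY)
  exact ⟨C, hC0, hC, le_smul_volume_of_tendsto hC0 hC (κ := ⟨_, hprob⟩)
    (tendsto_energyLaw hlam hr hr0 hY hind rfl) hev, hev⟩

theorem tendsto_map_model {lam : ℝ} (hlam : 0 < lam) {r : ℕ → ℕ}
    (hr : Tendsto (fun m => (r m : ℝ) / ((m + 1 : ℕ) : ℝ) ^ (3 / 4 : ℝ)) atTop (𝓝 lam))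
    (hr0 : ∀ᶠ m in atTop, 0 < r m)
    {Y : ℤ → Ω → ℝ} (hY : ∀ j, HasLaw (Y j) (gaussianReal 0 1) P) (hind : iIndepFun Y P)
    {f : ℝ → ℝ} (hf : Measurable f)
    (hκ : P.map (limitVariable lam Y) = volume.withDensity fun x => ENNReal.ofReal (f x))
    {μs : ℕ → ProbabilityMeasure ℝ} {μ : ProbabilityMeasure ℝ}
    (hμs : ∀ m, (μs m : Measure ℝ) = (model (m + 1) (r m)).map
      fun x => magnetization (m + 1) x / ((m + 1 : ℕ) : ℝ) ^ (3 / 4 : ℝ))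
    (hμ : (μ : Measure ℝ) = squareLaw f) : Tendsto μs atTop (𝓝 μ) := by
  obtain ⟨C, hC0, hC, hle, hev⟩ := exists_map_limitVariable_le hlam hr hr0 hY hind
  have hprob := Measure.isProbabilityMeasure_map (aemeasurable_limitVariable lam hY)
  have hfin := isFiniteMeasure_invSqrtTilt hC hle
  refine tendsto_scaledSqrtLaw
    (κs := fun m => (⟨energyLaw m (modeVariance m (r m)), inferInstance⟩ : ProbabilityMeasure ℝ))
    (κ := ⟨_, hprob⟩) (ρ := radialLaw) hC0 hC (tendsto_energyLaw hlam hr hr0 hY hind rfl) hev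
    (invSqrtTilt_map_limitVariable_ne_zero lam hY hind) integrable_abs_sub_one_radialLaw ?_ ?_ ?_
  · have h : Tendsto (fun m : ℕ => 3 / (2 * √((m + 1 : ℕ) : ℝ))) atTop (𝓝 0) := by
      have h : Tendsto (fun m : ℕ => ((m + 1 : ℕ) : ℝ)) atTop atTop :=
        tendsto_natCast_atTop_atTop.comp (tendsto_add_atTop_nat 1)
      exact Tendsto.div_atTop tendsto_const_nhds
        ((Real.tendsto_sqrt_atTop.comp h).const_mul_atTop two_pos)
    exact squeeze_zero (fun m => integral_nonneg fun t => abs_nonneg _)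
      integral_abs_sub_one_radialLaw_le h
  · filter_upwards [hr0] with m h0
    rw [hμs]
    refine map_model_eq_scaledSqrtLaw m (r m) _ (fun i h => ?_) (fun i => ?_) h0
    · have := one_half_le_modeVariance h0 i
      rw [h] at this
      norm_num at this
    · rw [coe_modeVariance h0, one_div_one_div]
  · rw [hμ, squareLaw_eq hf hκ]
    rfl

end

end SpinChain

end

theorem theorem2
    (lam : ℝ) (hlam : 0 < lam) (r : ℕ+ → ℕ)
    (hr : (fun n : ℕ+ => (r n : ℝ)) ~[atTop] fun n : ℕ+ => lam * (n : ℝ) ^ (3 / 4 : ℝ))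
    {Ω : Type*} [MeasurableSpace Ω] (P : Measure Ω) [IsProbabilityMeasure P]
    (Y : ℤ → Ω → ℝ) (hY : ∀ j, HasLaw (Y j) (gaussianReal 0 1) P) (hind : iIndepFun Y P) :
    (∀ᵐ ω ∂P, Summable fun j : {j : ℤ // j ≠ 0} => Y j ω ^ 2 / (j : ℝ) ^ 2) ∧
    HasPDF (SpinChain.limitVariable lam Y) P volume ∧
    ∀ f : ℝ → ℝ, Measurable f → (∀ x, 0 ≤ f x) →
      P.map (SpinChain.limitVariable lam Y) = volume.withDensity (fun x => ENNReal.ofReal (f x)) →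
      0 < ∫⁻ t, ENNReal.ofReal (f (t ^ 2)) ∧ ∫⁻ t, ENNReal.ofReal (f (t ^ 2)) < ∞ ∧
      ∃ _ : IsProbabilityMeasure (SpinChain.squareLaw f),
        TendstoInDistribution
          (fun (n : ℕ+) (x : Fin n → ℝ) => SpinChain.magnetization n x / (n : ℝ) ^ (3 / 4 : ℝ))
          atTop id (fun n : ℕ+ => SpinChain.model n (r n)) (SpinChain.squareLaw f) := by
  have hr1 : Tendsto (fun m : ℕ => (r m.succPNat : ℝ) / ((m + 1 : ℕ) : ℝ) ^ (3 / 4 : ℝ)) atTop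
      (𝓝 lam) := by
    have hv : ∀ᶠ n : ℕ+ in atTop, lam * (n : ℝ) ^ (3 / 4 : ℝ) ≠ 0 :=
      Eventually.of_forall fun n => by positivity
    have h1 := ((isEquivalent_iff_tendsto_one hv).1 hr).mul_const lam
    rw [one_mul] at h1
    -- The dimension is reindexed as `n = m + 1`, with `m` the number of nonconstant modes.
    have h2 : Tendsto Nat.succPNat atTop atTop := OrderIso.pnatIsoNat.symm.tendsto_atTop
    refine (h1.comp h2).congr fun m => ?_
    simp only [Function.comp_apply, Pi.div_apply, Nat.succPNat_coe]
    have : (0 : ℝ) < ((m + 1 : ℕ) : ℝ) ^ (3 / 4 : ℝ) := by positivity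
    rw [Nat.succ_eq_add_one]
    field_simp
  have hr0 : ∀ᶠ m : ℕ in atTop, 0 < r m.succPNat := by
    filter_upwards [hr1.eventually_const_lt hlam] with m hm
    by_contra h
    simp [Nat.eq_zero_of_not_pos h] at hm
  obtain ⟨C, -, hC, hle, -⟩ := SpinChain.exists_map_limitVariable_le hlam hr1 hr0 hY hind
  have hm := SpinChain.aemeasurable_limitVariable lam hY
  have hprob := Measure.isProbabilityMeasure_map hm
  -- Domination by a multiple of Lebesgue measure gives absolute continuity, and hence a density by
  -- Radon-Nikodym.
  refine ⟨SpinChain.ae_summable_sq_div_sq hY, ⟨hm, inferInstance,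
    (Measure.absolutelyContinuous_of_le hle).trans Measure.smul_absolutelyContinuous⟩,
    fun f hf _ hκ => ?_⟩
  have hint := SpinChain.lintegral_comp_sq hf hκ
  have hpos : 0 < ∫⁻ t, ENNReal.ofReal (f (t ^ 2)) := by
    rw [hint]
    exact pos_iff_ne_zero.2 (SpinChain.invSqrtTilt_map_limitVariable_ne_zero lam hY hind)
  have hlt : ∫⁻ t, ENNReal.ofReal (f (t ^ 2)) < ∞ := by
    rw [hint]
    exact (SpinChain.isFiniteMeasure_invSqrtTilt hC hle).measure_univ_lt_top
  have hsq : IsProbabilityMeasure (SpinChain.squareLaw f) := by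
    constructor
    rw [SpinChain.squareLaw, Measure.smul_apply, withDensity_apply _ MeasurableSet.univ,
      Measure.restrict_univ, smul_eq_mul]
    exact ENNReal.inv_mul_cancel hpos.ne' hlt.ne
  have hmeas : ∀ n : ℕ+, Measurable fun x : Fin n → ℝ =>
      SpinChain.magnetization n x / (n : ℝ) ^ (3 / 4 : ℝ) := fun n => by
    unfold SpinChain.magnetization; fun_prop
  refine ⟨hpos, hlt, hsq, fun n => (hmeas n).aemeasurable, aemeasurable_id, ?_⟩
  let F : ℕ+ → ProbabilityMeasure ℝ := fun n =>
    ⟨_, Measure.isProbabilityMeasure_map (μ := SpinChain.model n (r n)) (hmeas n).aemeasurable⟩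
  have h := SpinChain.tendsto_map_model hlam hr1 hr0 hY hind hf hκ (μs := fun m => F m.succPNat)
    (μ := ⟨_, Measure.isProbabilityMeasure_map (μ := SpinChain.squareLaw f) aemeasurable_id⟩)
    (fun m => rfl) Measure.map_id
  have h2 : Tendsto PNat.natPred atTop atTop := OrderIso.pnatIsoNat.tendsto_atTop
  refine (h.comp h2).congr fun n => ?_
  change F n.natPred.succPNat = F n
  rw [PNat.succPNat_natPred]
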